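/- Let $0<p<n$, let $P=\{x\in\mathbb R^n:\ \ell_r(x)=\langle x,\nu_r\rangle+\lambda_r\ge 0,\ r=1,\dots,d\}$ be a Delzant polytope ($\nu_r$ the primitive inward facet normals), and let $(M,\omega)$ be the associated compact symplectic toric manifold, with open dense orbit $\mathring M\cong \mathring P\times T^n$, action-angle coordinates $(x,\theta)$ and $\omega=\sum_k dx_k\wedge d\theta_k$ there. Let $g$ be a symplectic potential: $g=\tfrac12\sum_r \ell_r\log \ell_r+h$ on $\mathring P$ with $h\in C^\infty(P)$, the Hessian $G$ of $g$ is positive definite on $\mathring P$, and $\det G=(\delta\prod_r\ell_r)^{-1}$ with $\delta\in C^\infty(P)$ strictly positive. It defines the compatible complex structure $J=\begin{pmatrix}0&-G^{-1}\\ G&0\end{pmatrix}$ on $\mathring M$, which extends smoothly to $M$, and the Kähler polarization $T^{1,0}M$ of $J$. Let $B\in SL(n,\mathbb Z)$, $\tilde x=Bx$, $\tilde\theta={}^tB^{-1}\theta$, $\tilde z_j=\partial g/\partial\tilde x_j+i\tilde\theta_j$ and $H=\tfrac12\sum_{j=1}^p\tilde x_j^2$. Hamiltonian vector fields are defined by $\omega(X_f,\cdot)=df$.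 For $s\ge 0$ let $\mathcal P_s$ be the distribution on $M$ which is $T^{1,0}$ of the complex structure given by $g+sH$ on $\mathring M$, extended to $M$ by continuity. Then: 1. For every $s\ge0$, $\mathcal P_s$ is a Kähler polarization of $(M,\omega)$. It is obtained from $\mathcal P_0$ by the flow of $X_H$ in imaginary time: on $\mathring M$, $\mathcal P_s=\langle X_{\overline{\tilde z_{1,s}}},\dots,X_{\overline{\tilde z_{n,s}}}\rangle_{\mathbb C}$ with $\tilde z_{j,s}=\partial(g+sH)/\partial\tilde x_j+i\tilde\theta_j=\sum_{k\ge0}\frac{(is)^k}{k!}X_H^k(\tilde z_j)$. 2. The limit $\mathcal P_\infty=\lim_{s\to+\infty}\mathcal P_s$ exists at every point of $M$, in the Lagrangian Grassmannian of the complexified tangent space, and it is a singular mixed polarization: it is Lagrangian at every point of $M$ and, on the open dense subset $\mathring M$, it is smooth and involutive with $\mathcal P_\infty\cap\overline{\mathcal P_\infty}$ of constant rank $p$. At every point of $M$ one has $$\mathcal P_\infty=\big((\ker d\mu_p\otimes\mathbb C)\cap \mathcal P_0\big)\oplus \mathcal I_{\mathbb C},$$ where $\mu_p=(\tilde x_1,\dots,\tilde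 x_p)$ is the moment map of the corresponding subtorus $T^p$ and $\mathcal I_{\mathbb C}$ is the complexified tangent space to the orbits of $T^p$. 3. Over $\mathring M$, $$\mathcal P_\infty=\Big\langle \frac{\partial}{\partial\tilde\theta_1},\dots,\frac{\partial}{\partial\tilde\theta_p},X_{\overline{\tilde z_{p+1}}},\dots,X_{\overline{\tilde z_n}}\Big\rangle_{\mathbb C}=\Big\langle \frac{\partial}{\partial\tilde\theta_1},\dots,\frac{\partial}{\partial\tilde\theta_p},\frac{\partial}{\partial\tilde z_{p+1}},\dots,\frac{\partial}{\partial\tilde z_n}\Big\rangle_{\mathbb C},$$ where $\partial/\partial\tilde z_k$ $(k>p)$ is taken in the coordinates $(\tilde x_1,\tilde\theta_1,\dots,\tilde x_p,\tilde\theta_p,\tilde z_{p+1},\dots,\tilde z_n)$. Equivalently, the conjugate polarizations satisfy over $\mathring M$ $$\lim_{s\to+\infty}\overline{\mathcal P_s}=\Big\langle \frac{\partial}{\partial\tilde\theta_1},\dots,\frac{\partial}{\partial\tilde\theta_p},X_{\tilde z_{p+1}},\dots,X_{\tilde z_n}\Big\rangle_{\mathbb C}=\Big\langle \frac{\partial}{\partial\tilde\theta_1},\dots,\frac{\partial}{\partial\tilde\theta_p},\frac{\partial}{\partial\overline{\tilde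 z_{p+1}}},\dots,\frac{\partial}{\partial\overline{\tilde z_n}}\Big\rangle_{\mathbb C}.$$ -/

import Mathlib

open scoped Matrix ContDiff Topology

noncomputable section

namespace ToricPol

/-! ## The standard symplectic vector space and its complexification

All charts below are Darboux charts: they take values in `ℝⁿ × ℝⁿ` with the symplectic form
`ω = ∑ₖ daₖ ∧ dbₖ`, where `(a, b)` are the two groups of coordinates. A complex tangent vector
`∑ₖ αₖ ∂/∂aₖ + βₖ ∂/∂bₖ` is the pair `(α, β) ∈ ℂⁿ × ℂⁿ`. -/

abbrev RSpace (n : ℕ) : Type := (Fin n → ℝ) × (Fin n → ℝ)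

abbrev CSpace (n : ℕ) : Type := (Fin n → ℂ) × (Fin n → ℂ)

/-- The inclusion of real tangent vectors into complex ones. -/
def toC (n : ℕ) : RSpace n →ₗ[ℝ] CSpace n where
  toFun u := (fun k => (u.1 k : ℂ), fun k => (u.2 k : ℂ))
  map_add' u v := by ext k <;> simp
  map_smul' c u := by ext k <;> simp

def rePart {n : ℕ} (w : CSpace n) : RSpace n := (fun k => (w.1 k).re, fun k => (w.2 k).re)

def imPart {n : ℕ} (w : CSpace n) : RSpace n := (fun k => (w.1 k).im, fun k => (w.2 k).im)

/-- Complex conjugation of a complex tangent vector. -/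
def conjVec {n : ℕ} (w : CSpace n) : CSpace n :=
  (fun k => starRingEnd ℂ (w.1 k), fun k => starRingEnd ℂ (w.2 k))

theorem rePart_smul {n : ℕ} (c : ℂ) (w : CSpace n) :
    rePart (c • w) = c.re • rePart w - c.im • imPart w := by
  ext k <;> simp [rePart, imPart]

theorem imPart_smul {n : ℕ} (c : ℂ) (w : CSpace n) :
    imPart (c • w) = c.re • imPart w + c.im • rePart w := by
  ext k <;> simp [rePart, imPart]

/-- The complex linear extension of a real linear map. -/
def extC {n : ℕ} {F : Type} [AddCommGroup F] [Module ℝ F] [Module ℂ F] [IsScalarTower ℝ ℂ F]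
    (T : RSpace n →ₗ[ℝ] F) : CSpace n →ₗ[ℂ] F where
  toFun w := T (rePart w) + Complex.I • T (imPart w)
  map_add' v w := by
    have h1 : rePart (v + w) = rePart v + rePart w := by ext k <;> simp [rePart]
    have h2 : imPart (v + w) = imPart v + imPart w := by ext k <;> simp [imPart]
    rw [h1, h2, map_add, map_add, smul_add]
    abel
  map_smul' c w := by
    have hr : ∀ (r : ℝ) (x : F), r • x = (r : ℂ) • x := fun r x =>
      (algebraMap_smul ℂ r x).symm
    rw [rePart_smul, imPart_smul, map_sub, map_add, map_smul, map_smul, map_smul, map_smul]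
    simp only [hr, RingHom.id_apply, smul_add, smul_smul]
    have hc : c = (c.re : ℂ) + (c.im : ℂ) * Complex.I := (Complex.re_add_im c).symm
    have h1 : c • T (rePart w) = (c.re : ℂ) • T (rePart w)
        + (Complex.I * (c.im : ℂ)) • T (rePart w) := by
      rw [← add_smul, mul_comm Complex.I, ← hc]
    have h2 : (c * Complex.I) • T (imPart w) = (Complex.I * (c.re : ℂ)) • T (imPart w)
        - (c.im : ℂ) • T (imPart w) := by
      rw [← sub_smul]
      congr 1
      conv_lhs => rw [hc]
      ring_nf
      rw [Complex.I_sq]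
      ring
    rw [h1, h2]
    abel

/-- The complexified symplectic form `ω = ∑ₖ daₖ ∧ dbₖ`. -/
def omega {n : ℕ} (u w : CSpace n) : ℂ := ∑ k, (u.1 k * w.2 k - u.2 k * w.1 k)

/-- `L` is Lagrangian: it equals its own `ω`-orthogonal. -/
def IsLagrangian {n : ℕ} (L : Submodule ℂ (CSpace n)) : Prop :=
  ∀ u, u ∈ L ↔ ∀ w ∈ L, omega u w = 0

/-- The complex conjugate `{w̄ : w ∈ L}` of a complex subspace. -/
def conjSub {n : ℕ} (L : Submodule ℂ (CSpace n)) : Submodule ℂ (CSpace n) where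
  carrier := {w | conjVec w ∈ L}
  zero_mem' := by
    have : conjVec (0 : CSpace n) = 0 := by ext k <;> simp [conjVec]
    simp [this]
  add_mem' {v w} hv hw := by
    have : conjVec (v + w) = conjVec v + conjVec w := by ext k <;> simp [conjVec]
    simpa [this] using L.add_mem hv hw
  smul_mem' c w hw := by
    have : conjVec (c • w) = starRingEnd ℂ c • conjVec w := by ext k <;> simp [conjVec]
    simpa [this] using L.smul_mem _ hw

/-- Convergence `F s → L`, as `s → +∞`, in the Grassmannian of complex `n`-planes in `ℂⁿ × ℂⁿ`
(with its usual topology, the quotient of the space of `n`-frames): for large `s` there are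
bases of `F s` converging to a basis of `L`. The Lagrangian Grassmannian carries the subspace
topology. -/
def GrTendsto {n : ℕ} (F : ℝ → Submodule ℂ (CSpace n)) (L : Submodule ℂ (CSpace n)) : Prop :=
  ∃ (e : ℝ → Fin n → CSpace n) (b : Fin n → CSpace n),
    (∀ᶠ s in Filter.atTop,
      LinearIndependent ℂ (e s) ∧ Submodule.span ℂ (Set.range (e s)) = F s) ∧
    LinearIndependent ℂ b ∧ Submodule.span ℂ (Set.range b) = L ∧
    Filter.Tendsto e Filter.atTop (𝓝 b)

/-! ## Calculus in a Darboux chart -/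

/-- The differential of a complex valued function, extended to complex tangent vectors. -/
def dC {n : ℕ} (f : RSpace n → ℂ) (y : RSpace n) : CSpace n →ₗ[ℂ] ℂ :=
  extC (fderiv ℝ f y : RSpace n →ₗ[ℝ] ℂ)

/-- The push forward of complex tangent vectors by a map between charts. -/
def pushC {n : ℕ} (φ : RSpace n → RSpace n) (y : RSpace n) : CSpace n →ₗ[ℂ] CSpace n :=
  extC ((toC n).comp (fderiv ℝ φ y : RSpace n →ₗ[ℝ] RSpace n))

/-- The Hamiltonian vector field of a complex valued function, `ω(X_f, ·) = df`; with this
convention `X_{xₖ} = -∂/∂θₖ` for `ω = ∑ dxₖ ∧ dθₖ`. -/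
def hamVec {n : ℕ} (f : RSpace n → ℂ) (y : RSpace n) : CSpace n :=
  (fun k => dC f y (0, Pi.single k 1), fun k => - dC f y (Pi.single k 1, 0))

/-- The Lie bracket `[X, Y] = X(Y) - Y(X)` of complex vector fields. -/
def bracket {n : ℕ} (X Y : RSpace n → CSpace n) (y : RSpace n) : CSpace n :=
  extC (fderiv ℝ Y y : RSpace n →ₗ[ℝ] CSpace n) (X y)
    - extC (fderiv ℝ X y : RSpace n →ₗ[ℝ] CSpace n) (Y y)

/-- On the set `W`, `D` is a smooth rank `n` subbundle of the complexified tangent bundle: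
it has smooth local frames. -/
def SmoothOn {n : ℕ} (D : RSpace n → Submodule ℂ (CSpace n)) (W : Set (RSpace n)) : Prop :=
  ∀ q ∈ W, ∃ V : Set (RSpace n), IsOpen V ∧ q ∈ V ∧ ∃ e : Fin n → RSpace n → CSpace n,
    (∀ i, ContDiffOn ℝ ∞ (e i) V) ∧
    ∀ q' ∈ V ∩ W, LinearIndependent ℂ (fun i => e i q') ∧
      Submodule.span ℂ (Set.range fun i => e i q') = D q'

/-- Local smooth sections of `D` over `W` are closed under the Lie bracket. -/
def InvolutiveOn {n : ℕ} (D : RSpace n → Submodule ℂ (CSpace n)) (W : Set (RSpace n)) : Prop :=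
  ∀ V : Set (RSpace n), IsOpen V → V ⊆ W → ∀ X Y : RSpace n → CSpace n,
    ContDiffOn ℝ ∞ X V → ContDiffOn ℝ ∞ Y V → (∀ q ∈ V, X q ∈ D q) → (∀ q ∈ V, Y q ∈ D q) →
    ∀ q ∈ V, bracket X Y q ∈ D q

/-! ## Delzant polytopes -/

/-- The affine function `⟨x, ν⟩ + c`. -/
def affineForm {n : ℕ} (ν : Fin n → ℤ) (c : ℝ) (x : Fin n → ℝ) : ℝ := (∑ i, x i * (ν i : ℝ)) + c

/-- A Delzant polytope `P = {x : ℓ_r(x) = ⟨x, ν_r⟩ + λ_r ≥ 0, r = 1, …, d}`: compact, non-empty,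
every `ℓ_r` vanishes somewhere on `P`, and at every vertex exactly `n` of the `ℓ_r` vanish and
their normals form a basis of the lattice `ℤⁿ`. (It follows that `{ℓ_r = 0} ∩ P` are the facets
of `P`, that the `ν_r` are the primitive inward normals, and that the interior of `P` is
`{ℓ_r > 0 for all r}` and is non-empty.) -/
structure DelzantPolytope (n : ℕ) where
  d : ℕ
  normal : Fin d → Fin n → ℤ
  lam : Fin d → ℝ
  nonempty : {x : Fin n → ℝ | ∀ r, 0 ≤ affineForm (normal r) (lam r) x}.Nonempty
  bounded : Bornology.IsBounded {x : Fin n → ℝ | ∀ r, 0 ≤ affineForm (normal r) (lam r) x}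
  facet_nonempty : ∀ r, ∃ x : Fin n → ℝ, (∀ r', 0 ≤ affineForm (normal r') (lam r') x) ∧
    affineForm (normal r) (lam r) x = 0
  delzant : ∀ x ∈ Set.extremePoints ℝ
      {x : Fin n → ℝ | ∀ r, 0 ≤ affineForm (normal r) (lam r) x},
    ∃ σ : Fin n → Fin d, Function.Injective σ ∧
      (∀ r, affineForm (normal r) (lam r) x = 0 ↔ r ∈ Set.range σ) ∧
      IsUnit (Matrix.of fun k => normal (σ k)).det

namespace DelzantPolytope

variable {n : ℕ}

def l (Δ : DelzantPolytope n) (r : Fin Δ.d) (x : Fin n → ℝ) : ℝ :=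
  affineForm (Δ.normal r) (Δ.lam r) x

def polytope (Δ : DelzantPolytope n) : Set (Fin n → ℝ) := {x | ∀ r, 0 ≤ Δ.l r x}

/-- The interior of the polytope. -/
def inside (Δ : DelzantPolytope n) : Set (Fin n → ℝ) := {x | ∀ r, 0 < Δ.l r x}

/-- A vertex of `P`, with a numbering of the `n` facets through it. -/
structure Vertex (Δ : DelzantPolytope n) where
  point : Fin n → ℝ
  facet : Fin n → Fin Δ.d
  mem : point ∈ Set.extremePoints ℝ Δ.polytope
  injective : Function.Injective facet
  active : ∀ r, Δ.l r point = 0 ↔ r ∈ Set.range facet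
  unimodular : IsUnit (Matrix.of fun k => Δ.normal (facet k)).det

/-- The matrix `A_v`, whose rows are the normals of the facets through `v`. -/
def Vertex.mat {Δ : DelzantPolytope n} (v : Δ.Vertex) : Matrix (Fin n) (Fin n) ℝ :=
  (Matrix.of fun k => Δ.normal (v.facet k)).map (Int.cast : ℤ → ℝ)

/-! ## The symplectic toric manifold of a Delzant polytope

The underlying space is the symplectic quotient of `ℂᵈ` by the kernel of the homomorphism
`T^d → T^n` given by the normals. It is covered by Darboux charts, one for each vertex `v`, with
coordinates `ζ_v^k = aₖ + i bₖ = √(2 x_v^k) e^{i θ_v^k}`, where `x_v = A_v x + λ_v`,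
`θ_v = ᵗA_v⁻¹ θ`. Geometric objects on the manifold are given by their expressions in these
charts. -/

/-- The zero level of the moment map of the kernel torus acting on `ℂᵈ`. -/
def levelSet (Δ : DelzantPolytope n) : Set (Fin Δ.d → ℂ) :=
  {z | ∃ x : Fin n → ℝ, ∀ r, ‖z r‖ ^ 2 / 2 = Δ.l r x}

/-- Orbits of the kernel torus `{t ∈ T^d : ∏_r t_r^{ν_r} = 1}` on the level set. -/
def orbitSetoid (Δ : DelzantPolytope n) : Setoid Δ.levelSet where
  r z z' := ∃ t : Fin Δ.d → Circle, (∀ i, ∏ r, t r ^ (Δ.normal r i) = 1) ∧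
    ∀ r, z'.1 r = (t r : ℂ) * z.1 r
  iseqv :=
    { refl := fun z => ⟨fun _ => 1, by simp, by simp⟩
      symm := by
        rintro z z' ⟨t, ht, h⟩
        refine ⟨fun r => (t r)⁻¹, fun i => ?_, fun r => ?_⟩
        · simp [Finset.prod_inv_distrib, ht i]
        · rw [h r, ← mul_assoc, ← Circle.coe_mul, inv_mul_cancel, Circle.coe_one, one_mul]
      trans := by
        rintro z z' z'' ⟨t, ht, h⟩ ⟨t', ht', h'⟩
        refine ⟨fun r => t' r * t r, fun i => ?_, fun r => ?_⟩
        · simp [mul_zpow, Finset.prod_mul_distrib, ht i, ht' i]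
        · rw [h' r, h r, Circle.coe_mul, mul_assoc] }

/-- The toric manifold `M` of `P`. -/
def Manifold (Δ : DelzantPolytope n) : Type := Quotient Δ.orbitSetoid

instance (Δ : DelzantPolytope n) : TopologicalSpace Δ.Manifold :=
  inferInstanceAs (TopologicalSpace (Quotient Δ.orbitSetoid))

/-- The open orbit, the set of points where the action of `T^n` is free. -/
def openOrbit (Δ : DelzantPolytope n) : Set Δ.Manifold :=
  {m | ∃ z : Δ.levelSet, (∀ r, z.1 r ≠ 0) ∧ Quotient.mk Δ.orbitSetoid z = m}

/-- The moment map in the chart at `v`: `A_v x + λ_v = ½ |ζ_v|²`. -/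
def Vertex.moment {Δ : DelzantPolytope n} (v : Δ.Vertex) (q : RSpace n) : Fin n → ℝ :=
  v.mat⁻¹ *ᵥ fun k => (q.1 k ^ 2 + q.2 k ^ 2) / 2 - Δ.lam (v.facet k)

/-- The domain (in `ℝⁿ × ℝⁿ`) of the coordinates at `v`. -/
def Vertex.domain {Δ : DelzantPolytope n} (v : Δ.Vertex) : Set (RSpace n) :=
  {q | ∀ r, r ∉ Set.range v.facet → 0 < Δ.l r (v.moment q)}

/-- The slice of the level set on which the coordinates at `v` live: the coordinates `z_r` are
`ζ_v^k` for the facets `r` through `v`, and positive real numbers for the others. -/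
def Vertex.slice {Δ : DelzantPolytope n} (v : Δ.Vertex) (q : RSpace n) : Fin Δ.d → ℂ :=
  Function.extend v.facet (fun k => (⟨q.1 k, q.2 k⟩ : ℂ))
    (fun r => ((Real.sqrt (2 * Δ.l r (v.moment q)) : ℝ) : ℂ))

theorem Vertex.isUnit_det {Δ : DelzantPolytope n} (v : Δ.Vertex) : IsUnit v.mat.det := by
  have h := v.unimodular.map (Int.castRingHom ℝ)
  rwa [RingHom.map_det] at h

theorem Vertex.l_facet {Δ : DelzantPolytope n} (v : Δ.Vertex) (k : Fin n) (x : Fin n → ℝ) :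
    Δ.l (v.facet k) x = (v.mat *ᵥ x) k + Δ.lam (v.facet k) := by
  simp [DelzantPolytope.l, affineForm, Vertex.mat, Matrix.mulVec, dotProduct, mul_comm]

theorem Vertex.l_moment {Δ : DelzantPolytope n} (v : Δ.Vertex) (q : RSpace n) (k : Fin n) :
    Δ.l (v.facet k) (v.moment q) = (q.1 k ^ 2 + q.2 k ^ 2) / 2 := by
  rw [v.l_facet, Vertex.moment, Matrix.mulVec_mulVec, Matrix.mul_nonsing_inv _ v.isUnit_det,
    Matrix.one_mulVec]
  ring

theorem Vertex.slice_mem {Δ : DelzantPolytope n} (v : Δ.Vertex) {q : RSpace n}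
    (hq : q ∈ v.domain) : v.slice q ∈ Δ.levelSet := by
  refine ⟨v.moment q, fun r => ?_⟩
  by_cases hr : r ∈ Set.range v.facet
  · obtain ⟨k, rfl⟩ := hr
    rw [Vertex.slice, v.injective.extend_apply, v.l_moment, Complex.sq_norm, Complex.normSq_mk]
    ring
  · have h0 := hq r hr
    rw [Vertex.slice, Function.extend_apply' _ _ _ hr, Complex.norm_real, Real.norm_eq_abs, sq_abs,
      Real.sq_sqrt (by linarith)]
    ring

/-- The (inverse of the) chart at the vertex `v`. -/
def Vertex.param {Δ : DelzantPolytope n} (v : Δ.Vertex) (q : RSpace n) (hq : q ∈ v.domain) :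
    Δ.Manifold :=
  Quotient.mk Δ.orbitSetoid ⟨v.slice q, v.slice_mem hq⟩

/-- The part of the domain of the coordinates at `v` that parametrizes a subset `O` of `M`. -/
def Vertex.preimage {Δ : DelzantPolytope n} (v : Δ.Vertex) (O : Set Δ.Manifold) :
    Set (RSpace n) :=
  {q | ∃ hq : q ∈ v.domain, v.param q hq ∈ O}

/-! ## Action-angle coordinates -/

/-- The action-angle coordinates `(x, θ)` of the open orbit: `x` in the interior of `P`, and `θ`
in the universal cover `ℝⁿ` of the torus. -/
def actionAngle (Δ : DelzantPolytope n) : Set (RSpace n) := {y | y.1 ∈ Δ.inside}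

/-- The point with action-angle coordinates `(x, θ)`, in the coordinates at the vertex `v`. -/
def Vertex.ofActionAngle {Δ : DelzantPolytope n} (v : Δ.Vertex) (y : RSpace n) : RSpace n :=
  (fun k => Real.sqrt (2 * Δ.l (v.facet k) y.1) * Real.cos ((v.mat⁻¹ᵀ *ᵥ y.2) k),
   fun k => Real.sqrt (2 * Δ.l (v.facet k) y.1) * Real.sin ((v.mat⁻¹ᵀ *ᵥ y.2) k))

/-! ## Complex distributions on the toric manifold -/

/-- A family of complex subspaces of the complexified tangent spaces of `M`, expressed in the
charts at the vertices; only the values on the domains of the charts matter. -/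
abbrev Distribution (Δ : DelzantPolytope n) : Type :=
  Δ.Vertex → RSpace n → Submodule ℂ (CSpace n)

/-- The expressions in the various charts agree under the changes of coordinates of `M`. -/
def Distribution.IsGlobal {Δ : DelzantPolytope n} (D : Δ.Distribution) : Prop :=
  ∀ (v v' : Δ.Vertex) (W : Set (RSpace n)) (τ : RSpace n → RSpace n),
    IsOpen W → ContDiffOn ℝ ∞ τ W →
    (∀ q ∈ W, ∃ (hq : q ∈ v.domain) (hq' : τ q ∈ v'.domain), v'.param (τ q) hq' = v.param q hq) →
    ∀ q ∈ W, D v' (τ q) = (D v q).map (pushC τ q)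

/-- A Kähler polarization of `M`: a smooth involutive Lagrangian distribution `D` such that
`-i ω(w, w̄) > 0` for `0 ≠ w ∈ D`. (In particular `D ∩ D̄ = 0`, so that `D` is the bundle
`T^{1,0}` of a complex structure, and the complex structure is compatible with `ω`.) -/
def Distribution.IsKahler {Δ : DelzantPolytope n} (D : Δ.Distribution) : Prop :=
  D.IsGlobal ∧ ∀ v : Δ.Vertex,
    (∀ q ∈ v.domain, IsLagrangian (D v q)) ∧
    SmoothOn (D v) v.domain ∧ InvolutiveOn (D v) v.domain ∧
    ∀ q ∈ v.domain, ∀ w ∈ D v q, w ≠ 0 → 0 < (omega w (conjVec w)).im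

/-- `D` is a singular mixed polarization of `M`, regular on `O` and with `p` real directions there:
it is Lagrangian at every point of `M`, and on the open dense set `O` it is smooth and
involutive, with `D ∩ D̄` of constant rank `p`, where `0 < p < n`. -/
def Distribution.IsSingularMixed {Δ : DelzantPolytope n} (D : Δ.Distribution)
    (O : Set Δ.Manifold) (p : ℕ) : Prop :=
  D.IsGlobal ∧ IsOpen O ∧ Dense O ∧ 0 < p ∧ p < n ∧ ∀ v : Δ.Vertex,
    (∀ q ∈ v.domain, IsLagrangian (D v q)) ∧
    SmoothOn (D v) (v.preimage O) ∧ InvolutiveOn (D v) (v.preimage O) ∧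
    ∀ q ∈ v.preimage O, Module.finrank ℂ ↥(D v q ⊓ conjSub (D v q)) = p

/-! ## Symplectic potentials and their Kähler polarizations -/

end DelzantPolytope

/-- The partial derivative `∂g/∂xₖ`. -/
def partialD {n : ℕ} (g : (Fin n → ℝ) → ℝ) (k : Fin n) (x : Fin n → ℝ) : ℝ :=
  fderiv ℝ g x (Pi.single k 1)

def hessian {n : ℕ} (g : (Fin n → ℝ) → ℝ) (x : Fin n → ℝ) : Matrix (Fin n) (Fin n) ℝ :=
  Matrix.of fun k j => partialD (partialD g k) j x

namespace DelzantPolytope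

variable {n : ℕ}

/-- The function `g_P = ½ ∑_r ℓ_r log ℓ_r`. -/
def guillemin (Δ : DelzantPolytope n) (x : Fin n → ℝ) : ℝ :=
  (1 / 2) * ∑ r, Δ.l r x * Real.log (Δ.l r x)

/-- Symplectic potentials `g = g_P + h`, with `h` smooth on `P`, whose Hessian `G` is positive
definite in the interior and satisfies `det G = (δ ∏_r ℓ_r)⁻¹` with `δ` smooth and positive on
`P`. A smooth function on `P` is the restriction of a smooth function on `ℝⁿ`. -/
def IsSymplecticPotential (Δ : DelzantPolytope n) (g : (Fin n → ℝ) → ℝ) : Prop :=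
  (∃ h : (Fin n → ℝ) → ℝ, ContDiff ℝ ∞ h ∧ ∀ x ∈ Δ.inside, g x = Δ.guillemin x + h x) ∧
  (∀ x ∈ Δ.inside, (hessian g x).PosDef) ∧
  ∃ δ : (Fin n → ℝ) → ℝ, ContDiff ℝ ∞ δ ∧ (∀ x ∈ Δ.polytope, 0 < δ x) ∧
    ∀ x ∈ Δ.inside, (hessian g x).det = (δ x * ∏ r, Δ.l r x)⁻¹

end DelzantPolytope

def cMat {n : ℕ} (A : Matrix (Fin n) (Fin n) ℝ) : Matrix (Fin n) (Fin n) ℂ :=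
  A.map (fun a : ℝ => (a : ℂ))

/-- The complex structure `J = [[0, -G⁻¹], [G, 0]]` in action-angle coordinates `(x, θ)`, with `G`
the Hessian of `g`, acting on complex tangent vectors. -/
def toricJ {n : ℕ} (g : (Fin n → ℝ) → ℝ) (y : RSpace n) : Module.End ℂ (CSpace n) :=
  LinearMap.prod
    (-((cMat (hessian g y.1)⁻¹).mulVecLin ∘ₗ LinearMap.snd ℂ (Fin n → ℂ) (Fin n → ℂ)))
    ((cMat (hessian g y.1)).mulVecLin ∘ₗ LinearMap.fst ℂ (Fin n → ℂ) (Fin n → ℂ))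

/-- The holomorphic tangent space `T^{1,0}` of `J`, in action-angle coordinates. -/
def toricT10 {n : ℕ} (g : (Fin n → ℝ) → ℝ) (y : RSpace n) : Submodule ℂ (CSpace n) :=
  Module.End.eigenspace (toricJ g y) Complex.I

namespace DelzantPolytope

variable {n : ℕ}

/-- The Kähler polarization of a symplectic potential `g` on the whole of `M`: on the open orbit
it is `T^{1,0}`, and this is extended to the other points by continuity, a vector being in
the fibre at `q` if it is the limit of vectors of `T^{1,0}` at points of the open orbit that tend
to `q`. -/
def kahlerPol (Δ : DelzantPolytope n) (g : (Fin n → ℝ) → ℝ) : Δ.Distribution := fun v q =>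
  { carrier := {u | ∃ U : RSpace n → CSpace n,
      (∀ y ∈ Δ.actionAngle,
        U (v.ofActionAngle y) ∈ (toricT10 g y).map (pushC v.ofActionAngle y)) ∧
      Filter.Tendsto U (𝓝[v.ofActionAngle '' Δ.actionAngle] q) (𝓝 u)}
    zero_mem' := ⟨fun _ => 0, fun _ _ => Submodule.zero_mem _, tendsto_const_nhds⟩
    add_mem' := by
      rintro a b ⟨U, hU, hU'⟩ ⟨V, hV, hV'⟩
      exact ⟨fun y => U y + V y, fun y hy => Submodule.add_mem _ (hU y hy) (hV y hy),
        hU'.add hV'⟩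
    smul_mem' := by
      rintro c a ⟨U, hU, hU'⟩
      exact ⟨fun y => c • U y, fun y hy => Submodule.smul_mem _ c (hU y hy),
        hU'.const_smul c⟩ }

end DelzantPolytope

/-! ## The coordinates attached to a matrix in `SL(n, ℤ)` -/

/-- `x̃_j = ∑ₖ B_{jk} xₖ`. -/
def xt {n : ℕ} (B : Matrix.SpecialLinearGroup (Fin n) ℤ) (j : Fin n) (x : Fin n → ℝ) : ℝ :=
  ∑ k, (B.1 j k : ℝ) * x k

/-- `θ̃ = ᵗB⁻¹ θ`. -/
def thetat {n : ℕ} (B : Matrix.SpecialLinearGroup (Fin n) ℤ) (j : Fin n) (θ : Fin n → ℝ) : ℝ :=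
  ∑ k, ((B⁻¹).1 k j : ℝ) * θ k

/-- `∂g/∂x̃_j`, the derivative of `g` in the direction of the `j`-th column of `B⁻¹`. -/
def yt {n : ℕ} (B : Matrix.SpecialLinearGroup (Fin n) ℤ) (g : (Fin n → ℝ) → ℝ) (j : Fin n)
    (x : Fin n → ℝ) : ℝ :=
  fderiv ℝ g x (fun k => ((B⁻¹).1 k j : ℝ))

/-- `z̃_j = ∂g/∂x̃_j + i θ̃_j`. -/
def zt {n : ℕ} (B : Matrix.SpecialLinearGroup (Fin n) ℤ) (g : (Fin n → ℝ) → ℝ) (j : Fin n)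
    (y : RSpace n) : ℂ :=
  (yt B g j y.1 : ℂ) + Complex.I * (thetat B j y.2 : ℂ)

/-- The complex conjugate of `z̃_j`. -/
def ztbar {n : ℕ} (B : Matrix.SpecialLinearGroup (Fin n) ℤ) (g : (Fin n → ℝ) → ℝ) (j : Fin n)
    (y : RSpace n) : ℂ :=
  starRingEnd ℂ (zt B g j y)

/-- `∂/∂θ̃_j = ∑ₖ B_{jk} ∂/∂θₖ`. -/
def dtheta {n : ℕ} (B : Matrix.SpecialLinearGroup (Fin n) ℤ) (j : Fin n) : CSpace n :=
  (0, fun k => ((B.1 j k : ℝ) : ℂ))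

/-- `H = ½ ∑_{j ≤ p} x̃_j²`. -/
def hamH {n : ℕ} (B : Matrix.SpecialLinearGroup (Fin n) ℤ) (p : ℕ) (x : Fin n → ℝ) : ℝ :=
  (1 / 2) * ∑ j : Fin n, if j.val < p then xt B j x ^ 2 else 0

/-- The symplectic potential `g + s H`. -/
def potAt {n : ℕ} (B : Matrix.SpecialLinearGroup (Fin n) ℤ) (p : ℕ) (g : (Fin n → ℝ) → ℝ) (s : ℝ)
    (x : Fin n → ℝ) : ℝ :=
  g x + s * hamH B p x

/-- The derivation `X_H` acting on complex valued functions of `(x, θ)`. -/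
def lieH {n : ℕ} (B : Matrix.SpecialLinearGroup (Fin n) ℤ) (p : ℕ) (f : RSpace n → ℂ)
    (y : RSpace n) : ℂ :=
  dC f y (hamVec (fun y' => ((hamH B p y'.1 : ℝ) : ℂ)) y)

/-- `w` is the value at `y` of the coordinate vector field `∂/∂z̃ₖ` (`k > p`) in the coordinates
`(x̃_1, θ̃_1, …, x̃_p, θ̃_p, z̃_{p+1}, …, z̃_n)`, that is, of the holomorphic derivative along the
level sets of `x̃_1, θ̃_1, …, x̃_p, θ̃_p`. -/
def IsPartialZ {n : ℕ} (B : Matrix.SpecialLinearGroup (Fin n) ℤ) (p : ℕ) (g : (Fin n → ℝ) → ℝ)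
    (y : RSpace n) (k : Fin n) (w : CSpace n) : Prop :=
  (∀ j : Fin n, j.val < p →
    dC (fun y' => (xt B j y'.1 : ℂ)) y w = 0 ∧ dC (fun y' => (thetat B j y'.2 : ℂ)) y w = 0) ∧
  ∀ j : Fin n, p ≤ j.val →
    dC (zt B g j) y w = (if j = k then 1 else 0) ∧ dC (ztbar B g j) y w = 0

/-- `⟨∂/∂θ̃_1, …, ∂/∂θ̃_p⟩ + ⟨X_{f_{p+1}}, …, X_{f_n}⟩` -/
def spanHam {n : ℕ} (B : Matrix.SpecialLinearGroup (Fin n) ℤ) (p : ℕ)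
    (f : Fin n → RSpace n → ℂ) (y : RSpace n) : Submodule ℂ (CSpace n) :=
  Submodule.span ℂ ({w | ∃ j : Fin n, j.val < p ∧ w = dtheta B j} ∪
    {w | ∃ k : Fin n, p ≤ k.val ∧ w = hamVec (f k) y})

/-- `⟨∂/∂θ̃_1, …, ∂/∂θ̃_p⟩ + ⟨∂/∂z̃_{p+1}, …, ∂/∂z̃_n⟩` -/
def spanHol {n : ℕ} (B : Matrix.SpecialLinearGroup (Fin n) ℤ) (p : ℕ) (g : (Fin n → ℝ) → ℝ)
    (y : RSpace n) : Submodule ℂ (CSpace n) :=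
  Submodule.span ℂ ({w | ∃ j : Fin n, j.val < p ∧ w = dtheta B j} ∪
    {w | ∃ k : Fin n, p ≤ k.val ∧ IsPartialZ B p g y k w})

/-- The component `x̃_j` of the moment map in the chart at a vertex. -/
def muChart {n : ℕ} {Δ : DelzantPolytope n} (B : Matrix.SpecialLinearGroup (Fin n) ℤ)
    (v : Δ.Vertex) (j : Fin n) (q : RSpace n) : ℂ :=
  (xt B j (v.moment q) : ℂ)

/-- `ker dμ_p ⊗ ℂ`, for the moment map `μ_p = (x̃_1, …, x̃_p)` of the subtorus `T^p`. -/
def kerMu {n : ℕ} {Δ : DelzantPolytope n} (B : Matrix.SpecialLinearGroup (Fin n) ℤ) (p : ℕ)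
    (v : Δ.Vertex) (q : RSpace n) : Submodule ℂ (CSpace n) :=
  ⨅ j : {j : Fin n // j.val < p}, LinearMap.ker (dC (muChart B v j.1) q)

/-- The complexified tangent space of the orbit of `T^p`, spanned by the Hamiltonian vector fields
of the components of its moment map. -/
def orbitTangent {n : ℕ} {Δ : DelzantPolytope n} (B : Matrix.SpecialLinearGroup (Fin n) ℤ) (p : ℕ)
    (v : Δ.Vertex) (q : RSpace n) : Submodule ℂ (CSpace n) :=
  Submodule.span ℂ {w | ∃ j : Fin n, j.val < p ∧ w = hamVec (muChart B v j) q}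

theorem DelzantPolytope.exists_vertex {n : ℕ} (Δ : DelzantPolytope n) {x : Fin n → ℝ}
    (hx : x ∈ Δ.polytope) : ∃ v : Δ.Vertex, ∀ r, r ∉ Set.range v.facet → 0 < Δ.l r x := by
  have hcont : ∀ r, Continuous (Δ.l r) := fun r => by
    unfold DelzantPolytope.l affineForm
    fun_prop
  have haff : ∀ r (a b : Fin n → ℝ) (c d : ℝ), c + d = 1 →
      Δ.l r (c • a + d • b) = c * Δ.l r a + d * Δ.l r b := by
    intro r a b c d hcd
    simp only [DelzantPolytope.l, affineForm, Pi.add_apply, Pi.smul_apply, smul_eq_mul, add_mul,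
      Finset.sum_add_distrib, mul_add, Finset.mul_sum, mul_assoc]
    linear_combination (-Δ.lam r) * hcd
  set F : Set (Fin n → ℝ) := {x' | x' ∈ Δ.polytope ∧ ∀ r, Δ.l r x = 0 → Δ.l r x' = 0} with hF
  have hclosed : IsClosed F := by
    have h1 : IsClosed Δ.polytope := by
      have : Δ.polytope = ⋂ r, {x | 0 ≤ Δ.l r x} := by
        ext y
        simp [DelzantPolytope.polytope]
      rw [this]
      exact isClosed_iInter fun r => isClosed_le continuous_const (hcont r)
    have h2 : F = Δ.polytope ∩ ⋂ r, ⋂ (_ : Δ.l r x = 0), {x' | Δ.l r x' = 0} := by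
      ext y
      simp [hF]
    rw [h2]
    exact h1.inter (isClosed_iInter fun r => isClosed_iInter fun _ =>
      isClosed_eq (hcont r) continuous_const)
  have hbdd : Bornology.IsBounded F := Δ.bounded.subset fun y hy => hy.1
  have hcomp : IsCompact F := Metric.isCompact_of_isClosed_isBounded hclosed hbdd
  obtain ⟨w, hw⟩ := hcomp.extremePoints_nonempty ⟨x, hx, fun _ h => h⟩
  have hext : IsExtreme ℝ Δ.polytope F := by
    refine ⟨fun y hy => hy.1, ?_⟩
    intro a ha b hb y hy hyab
    obtain ⟨c, d, hc, hd, hcd, rfl⟩ := hyab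
    refine ⟨ha, fun r hr => ?_⟩
    have h1 := hy.2 r hr
    rw [haff r a b c d hcd] at h1
    have h2 := mul_nonneg hc.le (ha r)
    have h3 := mul_nonneg hd.le (hb r)
    have h4 : c * Δ.l r a = 0 := by linarith
    exact (mul_eq_zero.mp h4).resolve_left hc.ne'
  have hwP : w ∈ Set.extremePoints ℝ Δ.polytope := hext.extremePoints_subset_extremePoints hw
  obtain ⟨σ, h1, h2, h3⟩ := Δ.delzant w hwP
  refine ⟨⟨w, σ, hwP, h1, h2, h3⟩, fun r hr => lt_of_le_of_ne (hx r) fun h => hr ?_⟩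
  exact (h2 r).mp (hw.1.2 r h.symm)

/-- Every point of `M` lies in the chart at some vertex. -/
theorem DelzantPolytope.exists_chart {n : ℕ} (Δ : DelzantPolytope n) (m : Δ.Manifold) :
    ∃ (v : Δ.Vertex) (q : RSpace n) (hq : q ∈ v.domain), v.param q hq = m := by
  classical
  obtain ⟨⟨z, x, hz⟩, rfl⟩ := Quotient.exists_rep m
  have hx : x ∈ Δ.polytope := fun r => by rw [← hz r]; positivity
  obtain ⟨v, hv⟩ := Δ.exists_vertex hx
  -- phases of the coordinates that do not vanish
  have hph : ∀ r, ∃ t : Circle, r ∉ Set.range v.facet → (t : ℂ) * z r = (‖z r‖ : ℂ) := by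
    intro r
    by_cases hr : r ∈ Set.range v.facet
    · exact ⟨1, fun h => absurd hr h⟩
    · refine ⟨Circle.exp (-(z r).arg), fun _ => ?_⟩
      rw [Circle.coe_exp]
      conv_lhs => rw [← Complex.norm_mul_exp_arg_mul_I (z r)]
      rw [mul_left_comm, ← Complex.exp_add]
      simp
  choose u hu using hph
  let A : Matrix (Fin n) (Fin n) ℤ := Matrix.of fun k => Δ.normal (v.facet k)
  have hA : A⁻¹ * A = 1 := Matrix.nonsing_inv_mul _ v.unimodular
  let c : Fin n → Circle := fun i => ∏ r ∈ Finset.univ.filter (fun r => r ∉ Set.range v.facet),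
    u r ^ (Δ.normal r i)
  let t : Fin Δ.d → Circle := Function.extend v.facet (fun k => ∏ j, (c j)⁻¹ ^ (A⁻¹ j k)) u
  have ht1 : ∀ k, t (v.facet k) = ∏ j, (c j)⁻¹ ^ (A⁻¹ j k) := fun k =>
    v.injective.extend_apply _ _ _
  have ht2 : ∀ r, r ∉ Set.range v.facet → t r = u r := fun r hr =>
    Function.extend_apply' _ _ _ hr
  have ht : ∀ i, ∏ r, t r ^ (Δ.normal r i) = 1 := by
    intro i
    rw [← Finset.prod_filter_mul_prod_filter_not Finset.univ (fun r => r ∈ Set.range v.facet)]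
    have h2 : ∏ r ∈ Finset.univ.filter (fun r => ¬ r ∈ Set.range v.facet),
        t r ^ (Δ.normal r i) = c i := by
      refine Finset.prod_congr rfl fun r hr => ?_
      rw [ht2 r (Finset.mem_filter.mp hr).2]
    have h1 : ∏ r ∈ Finset.univ.filter (fun r => r ∈ Set.range v.facet),
        t r ^ (Δ.normal r i) = (c i)⁻¹ := by
      have himg : Finset.univ.filter (fun r => r ∈ Set.range v.facet)
          = Finset.univ.image v.facet := by
        ext r
        simp
      rw [himg, Finset.prod_image (fun a _ b _ h => v.injective h)]
      have : ∀ k, t (v.facet k) ^ (Δ.normal (v.facet k) i)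
          = ∏ j, (c j)⁻¹ ^ (A⁻¹ j k * A k i) := by
        intro k
        rw [ht1, ← Finset.prod_zpow]
        refine Finset.prod_congr rfl fun j _ => ?_
        rw [zpow_mul]
        rfl
      simp only [this]
      rw [Finset.prod_comm]
      have h4 : ∀ j, ∏ k, (c j)⁻¹ ^ (A⁻¹ j k * A k i) = (c j)⁻¹ ^ ((1 : Matrix _ _ ℤ) j i) := by
        intro j
        rw [← hA, Matrix.mul_apply]
        exact (map_sum (zpowersHom Circle (c j)⁻¹).toAdditive _ _).symm
      simp only [h4]
      rw [Finset.prod_eq_single i]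
      · simp
      · intro j _ hj
        simp [Matrix.one_apply_ne hj]
      · simp
    rw [h1, h2, inv_mul_cancel]
  let q : RSpace n := (fun k => ((t (v.facet k) : ℂ) * z (v.facet k)).re,
    fun k => ((t (v.facet k) : ℂ) * z (v.facet k)).im)
  have hnorm : ∀ k, (q.1 k ^ 2 + q.2 k ^ 2) / 2 = Δ.l (v.facet k) x := by
    intro k
    rw [← hz]
    have : ‖z (v.facet k)‖ = ‖(t (v.facet k) : ℂ) * z (v.facet k)‖ := by
      rw [norm_mul, Circle.norm_coe, one_mul]
    rw [this, Complex.sq_norm, Complex.normSq_apply]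
    simp only [q]
    ring
  have hmom : v.moment q = x := by
    unfold DelzantPolytope.Vertex.moment
    have : (fun k => (q.1 k ^ 2 + q.2 k ^ 2) / 2 - Δ.lam (v.facet k)) = v.mat *ᵥ x := by
      ext k
      rw [hnorm, v.l_facet]
      ring
    rw [this, Matrix.mulVec_mulVec, Matrix.nonsing_inv_mul _ v.isUnit_det, Matrix.one_mulVec]
  have hq : q ∈ v.domain := fun r hr => by rw [hmom]; exact hv r hr
  refine ⟨v, q, hq, ?_⟩
  refine Quotient.sound (Δ.orbitSetoid.symm ⟨t, ht, fun r => ?_⟩)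
  change v.slice q r = _
  by_cases hr : r ∈ Set.range v.facet
  · obtain ⟨k, rfl⟩ := hr
    rw [DelzantPolytope.Vertex.slice, v.injective.extend_apply]
  · rw [DelzantPolytope.Vertex.slice, Function.extend_apply' _ _ _ hr, ht2 r hr, hu r hr, hmom,
      ← hz r]
    congr 1
    rw [mul_div_cancel₀ _ (two_ne_zero), Real.sqrt_sq (norm_nonneg _)]

end ToricPol

end

/-!
Everything reduces to an explicit linear model in the Darboux chart `ζ_k = a_k + i b_k` at a vertex
`v` of the polytope. Write `ξ_k = ½ |ζ_k|²`. There the potential is `½ ∑_k ξ_k log ξ_k` plus a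
function that is smooth on the whole chart; let `K` be the Hessian of the latter in the coordinates
`ξ` (`Vertex.curv`). In action-angle coordinates `T^{1,0}` is the kernel of the forms `G dx - i dθ`,
and after multiplication by `ζ̄_j` these become `dζ̄_j + ζ̄_j ∑_k K_{jk} dξ_k`, which make sense and
are independent at every point of the chart. Hence the extension by continuity of `T^{1,0}` is their
kernel `modelPol K q` (`IsAdmissible.kahlerPol_eq`). It is Lagrangian because `K` is symmetric and
involutive because the forms are, up to factors, the differentials of the functions
`ζ̄_j exp(∂_j reg)` (`Vertex.dC_antiHol`). Its Hermitian form is `1 + ζ K ζ̄`: this is positive on the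
open orbit since `G` is, so positive semidefinite everywhere, and the condition on `det G` says
exactly that its determinant does not vanish on the boundary
(`isAdmissible_of_isSymplecticPotential`).

Passing from `g` to `g + s H` replaces `K` by `K + s ᵗC C`, where `C` is the matrix of
`d(x̃_1, …, x̃_p)` in the coordinates `ξ`. So positivity persists for `s ≥ 0`, and the limit is a
statement of linear algebra (`grTendsto_modelPol`): the frame vector with parameter `c` changes by
`s` times the rotation field in the direction `ᵗC C (ζ̄ c)`. For `c` in the kernel of `C ζ̄` nothing
changes, which gives `ker dμ_p ∩ P_0`; for `c` in a complement, division by `s` gives in the limit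
all the rotation fields in the directions `ᵗC z`, because `C ζ̄` and its Gram matrix have the same
rank; these fields span the orbits of the subtorus.

The remaining properties of the limit are obtained from uniqueness of limits in the Grassmannian:
it is Lagrangian, independent of the chart, and on the open orbit equal to the limit computed in
action-angle coordinates, where `-s⁻¹ X_{z̃bar_{j,s}}` tends to `∂/∂θ̃_j` for `j ≤ p` and
`X_{z̃bar_{j,s}}` does not depend on `s` for `j > p` (`grTendsto_toricT10`). There it is the common
kernel of the closed forms `dx̃_j` for `j ≤ p` and `dz̃bar_j` for `j > p`, and so involutive.
-/

noncomputable section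

namespace ToricPol

/-! ### Complexification of tangent vectors -/

theorem toC_rePart_add {n : ℕ} (w : CSpace n) :
    toC n (rePart w) + Complex.I • toC n (imPart w) = w := by
  ext k <;> simp [toC, rePart, imPart, mul_comm Complex.I]

@[simp] theorem rePart_toC {n : ℕ} (u : RSpace n) : rePart (toC n u) = u := by
  ext k <;> simp [toC, rePart]

@[simp] theorem imPart_toC {n : ℕ} (u : RSpace n) : imPart (toC n u) = 0 := by
  ext k <;> simp [toC, imPart]

theorem extC_toC {n : ℕ} {F : Type} [AddCommGroup F] [Module ℝ F] [Module ℂ F]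
    [IsScalarTower ℝ ℂ F] (T : RSpace n →ₗ[ℝ] F) (u : RSpace n) : extC T (toC n u) = T u := by
  change T (rePart (toC n u)) + Complex.I • T (imPart (toC n u)) = T u
  simp

/-- A complex linear map is the complexification of its restriction to real vectors. -/
theorem extC_eq {n : ℕ} {F : Type} [AddCommGroup F] [Module ℝ F] [Module ℂ F]
    [IsScalarTower ℝ ℂ F] {T : RSpace n →ₗ[ℝ] F} {Λ : CSpace n →ₗ[ℂ] F}
    (h : ∀ u, Λ (toC n u) = T u) : extC T = Λ := by
  refine LinearMap.ext fun w => ?_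
  rw [← toC_rePart_add w, map_add, map_add, map_smul, map_smul, extC_toC, extC_toC, h, h]

theorem pushC_eq {n : ℕ} {φ : RSpace n → RSpace n} {y : RSpace n}
    {φ' : RSpace n →L[ℝ] RSpace n} (hφ : HasFDerivAt φ φ' y) {Λ : CSpace n →ₗ[ℂ] CSpace n}
    (h : ∀ u, Λ (toC n u) = toC n (φ' u)) : pushC φ y = Λ := by
  unfold pushC
  rw [hφ.fderiv]
  exact extC_eq h

theorem pushC_toC {n : ℕ} (φ : RSpace n → RSpace n) (y u : RSpace n) :
    pushC φ y (toC n u) = toC n (fderiv ℝ φ y u) := extC_toC _ _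

theorem pushC_apply {n : ℕ} (φ : RSpace n → RSpace n) (y : RSpace n) (w : CSpace n) :
    pushC φ y w = toC n (fderiv ℝ φ y (rePart w))
      + Complex.I • toC n (fderiv ℝ φ y (imPart w)) := rfl

theorem dC_apply {n : ℕ} (f : RSpace n → ℂ) (y : RSpace n) (w : CSpace n) :
    dC f y w = fderiv ℝ f y (rePart w) + Complex.I • fderiv ℝ f y (imPart w) := rfl

theorem pushC_comp {n : ℕ} {ψ φ : RSpace n → RSpace n} {y : RSpace n}
    (hψ : DifferentiableAt ℝ ψ (φ y)) (hφ : DifferentiableAt ℝ φ y) :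
    pushC (ψ ∘ φ) y = pushC ψ (φ y) ∘ₗ pushC φ y := by
  refine pushC_eq (hψ.hasFDerivAt.comp y hφ.hasFDerivAt) fun u => ?_
  rw [LinearMap.comp_apply, pushC_toC, pushC_toC]
  rfl

theorem dC_congr {n : ℕ} {f₁ f₂ : RSpace n → ℂ} {y : RSpace n} (h : f₁ =ᶠ[𝓝 y] f₂) :
    dC f₁ y = dC f₂ y := by
  unfold dC
  rw [h.fderiv_eq]

theorem continuous_rePart {n : ℕ} : Continuous (rePart : CSpace n → RSpace n) := by
  unfold rePart; fun_prop

theorem continuous_imPart {n : ℕ} : Continuous (imPart : CSpace n → RSpace n) := by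
  unfold imPart; fun_prop

theorem continuous_toC {n : ℕ} : Continuous (toC n) := by
  change Continuous fun u : RSpace n =>
    ((fun k => (u.1 k : ℂ), fun k => (u.2 k : ℂ)) : CSpace n)
  fun_prop

theorem continuous_conjVec {n : ℕ} : Continuous (conjVec : CSpace n → CSpace n) := by
  unfold conjVec
  refine Continuous.prodMk ?_ ?_ <;> refine continuous_pi fun k => ?_ <;>
    exact Complex.continuous_conj.comp (by fun_prop)

@[simp] theorem conjVec_conjVec {n : ℕ} (w : CSpace n) : conjVec (conjVec w) = w := by
  ext k <;> simp [conjVec]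

theorem conjVec_add {n : ℕ} (v w : CSpace n) : conjVec (v + w) = conjVec v + conjVec w := by
  ext k <;> simp [conjVec]

theorem conjVec_smul {n : ℕ} (c : ℂ) (w : CSpace n) :
    conjVec (c • w) = starRingEnd ℂ c • conjVec w := by
  ext k <;> simp [conjVec]

theorem mem_conjSub {n : ℕ} {L : Submodule ℂ (CSpace n)} {w : CSpace n} :
    w ∈ conjSub L ↔ conjVec w ∈ L := Iff.rfl

@[simp] theorem conjVec_zero {n : ℕ} : conjVec (0 : CSpace n) = 0 := by ext k <;> simp [conjVec]

theorem conjVec_sum {n : ℕ} {ι : Type*} (s : Finset ι) (f : ι → CSpace n) :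
    conjVec (∑ i ∈ s, f i) = ∑ i ∈ s, conjVec (f i) := by
  classical
  induction s using Finset.induction_on with
  | empty => simp
  | insert a s ha ih => rw [Finset.sum_insert ha, Finset.sum_insert ha, conjVec_add, ih]

theorem conjSub_span {n : ℕ} (S : Set (CSpace n)) :
    conjSub (Submodule.span ℂ S) = Submodule.span ℂ (conjVec '' S) := by
  apply le_antisymm
  · intro w hw
    have key : ∀ x ∈ Submodule.span ℂ S, conjVec x ∈ Submodule.span ℂ (conjVec '' S) := by
      intro x hx
      induction hx using Submodule.span_induction with
      | mem x h => exact Submodule.subset_span ⟨x, h, rfl⟩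
      | zero => simp
      | add x y _ _ hx hy => rw [conjVec_add]; exact Submodule.add_mem _ hx hy
      | smul c x _ hx => rw [conjVec_smul]; exact Submodule.smul_mem _ _ hx
    have := key _ (mem_conjSub.mp hw)
    rwa [conjVec_conjVec] at this
  · refine Submodule.span_le.mpr ?_
    rintro _ ⟨x, hx, rfl⟩
    change conjVec (conjVec x) ∈ Submodule.span ℂ S
    rw [conjVec_conjVec]
    exact Submodule.subset_span hx

/-! ### Lagrangian subspaces and limits in the Grassmannian -/

/-- The complexified symplectic form as a bilinear form. -/
def omegaForm (n : ℕ) : LinearMap.BilinForm ℂ (CSpace n) :=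
  LinearMap.mk₂ ℂ omega
    (fun u v w => by
      simp only [omega, Prod.fst_add, Prod.snd_add, Pi.add_apply, ← Finset.sum_add_distrib]
      exact Finset.sum_congr rfl fun k _ => by ring)
    (fun c u w => by
      simp only [omega, Prod.smul_fst, Prod.smul_snd, Pi.smul_apply, smul_eq_mul, Finset.mul_sum]
      exact Finset.sum_congr rfl fun k _ => by ring)
    (fun u v w => by
      simp only [omega, Prod.fst_add, Prod.snd_add, Pi.add_apply, ← Finset.sum_add_distrib]
      exact Finset.sum_congr rfl fun k _ => by ring)
    (fun c u w => by
      simp only [omega, Prod.smul_fst, Prod.smul_snd, Pi.smul_apply, smul_eq_mul, Finset.mul_sum]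
      exact Finset.sum_congr rfl fun k _ => by ring)

theorem omegaForm_apply {n : ℕ} (u w : CSpace n) : omegaForm n u w = omega u w := rfl

theorem omega_swap {n : ℕ} (u w : CSpace n) : omega u w = - omega w u := by
  simp only [omega, ← Finset.sum_neg_distrib]
  exact Finset.sum_congr rfl fun k _ => by ring

theorem eq_zero_of_omega {n : ℕ} {u : CSpace n} (h : ∀ w, omega u w = 0) : u = 0 := by
  ext k
  · have := h (0, Pi.single k 1)
    simpa [omega, Pi.single_apply] using this
  · have := h (Pi.single k 1, 0)
    simpa [omega, Pi.single_apply] using this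

theorem omegaForm_nondegenerate (n : ℕ) : (omegaForm n).Nondegenerate := by
  refine ⟨fun u hu => eq_zero_of_omega hu, fun u hu => eq_zero_of_omega fun w => ?_⟩
  rw [omega_swap, ← omegaForm_apply, hu w, neg_zero]

theorem mem_orthogonal {n : ℕ} {L : Submodule ℂ (CSpace n)} {u : CSpace n} :
    u ∈ (omegaForm n).orthogonal L ↔ ∀ w ∈ L, omega u w = 0 := by
  rw [LinearMap.BilinForm.mem_orthogonal_iff]
  refine forall₂_congr fun w _ => ?_
  change omega w u = 0 ↔ _
  rw [omega_swap, neg_eq_zero]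

theorem finrank_orthogonal {n : ℕ} (L : Submodule ℂ (CSpace n)) :
    Module.finrank ℂ ((omegaForm n).orthogonal L) = 2 * n - Module.finrank ℂ L := by
  rw [LinearMap.BilinForm.finrank_orthogonal (omegaForm_nondegenerate n)]
  simp [CSpace, two_mul]

theorem isLagrangian_iff {n : ℕ} {L : Submodule ℂ (CSpace n)} :
    IsLagrangian L ↔ (omegaForm n).orthogonal L = L := by
  rw [IsLagrangian, SetLike.ext_iff]
  exact forall_congr' fun u => by rw [mem_orthogonal]; exact Iff.comm

theorem IsLagrangian.finrank {n : ℕ} {L : Submodule ℂ (CSpace n)} (h : IsLagrangian L) :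
    Module.finrank ℂ L = n := by
  have h1 := finrank_orthogonal L
  have h2 : Module.finrank ℂ L ≤ Module.finrank ℂ (CSpace n) := Submodule.finrank_le L
  rw [isLagrangian_iff.mp h] at h1
  have h3 : Module.finrank ℂ (CSpace n) = 2 * n := by simp [CSpace, two_mul]
  omega

theorem isLagrangian_of_isotropic {n : ℕ} {L : Submodule ℂ (CSpace n)}
    (h : ∀ u ∈ L, ∀ w ∈ L, omega u w = 0) (hn : Module.finrank ℂ L = n) : IsLagrangian L := by
  rw [isLagrangian_iff]
  refine (Submodule.eq_of_le_of_finrank_eq (fun u hu => mem_orthogonal.mpr (h u hu)) ?_).symm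
  rw [finrank_orthogonal]
  omega

theorem continuous_omega {n : ℕ} :
    Continuous fun w : CSpace n × CSpace n => omega w.1 w.2 := by
  unfold omega
  fun_prop

theorem omega_eq_zero_of_span {n : ℕ} {S T : Set (CSpace n)}
    (h : ∀ u ∈ S, ∀ w ∈ T, omega u w = 0) {u w : CSpace n} (hu : u ∈ Submodule.span ℂ S)
    (hw : w ∈ Submodule.span ℂ T) : omega u w = 0 := by
  have h1 : ∀ u ∈ S, omega u w = 0 := by
    intro u hu
    have : Submodule.span ℂ T ≤ LinearMap.ker (omegaForm n u) :=
      Submodule.span_le.mpr fun w hw => h u hu w hw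
    exact this hw
  have : Submodule.span ℂ S ≤ LinearMap.ker ((omegaForm n).flip w) :=
    Submodule.span_le.mpr fun u hu => h1 u hu
  exact this hu

/-- Orthogonality with respect to `ω` passes to limits in the Grassmannian. -/
theorem GrTendsto.omega_eq_zero {n : ℕ} {F F' : ℝ → Submodule ℂ (CSpace n)}
    {L L' : Submodule ℂ (CSpace n)} (h : GrTendsto F L) (h' : GrTendsto F' L')
    (hF : ∀ᶠ s in Filter.atTop, ∀ u ∈ F s, ∀ w ∈ F' s, omega u w = 0) :
    ∀ u ∈ L, ∀ w ∈ L', omega u w = 0 := by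
  obtain ⟨e, b, he, -, rfl, hlim⟩ := h
  obtain ⟨e', b', he', -, rfl, hlim'⟩ := h'
  intro u hu w hw
  refine omega_eq_zero_of_span ?_ hu hw
  rintro _ ⟨i, rfl⟩ _ ⟨j, rfl⟩
  have h0 : Filter.Tendsto (fun s => (e s i, e' s j)) Filter.atTop (𝓝 (b i, b' j)) :=
    (tendsto_pi_nhds.mp hlim i).prodMk_nhds (tendsto_pi_nhds.mp hlim' j)
  have h1 := (continuous_omega.tendsto (b i, b' j)).comp h0
  refine tendsto_nhds_unique h1 (tendsto_const_nhds.congr' ?_)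
  filter_upwards [he, he', hF] with s hs hs' hz
  exact (hz _ (hs.2 ▸ Submodule.subset_span ⟨i, rfl⟩) _
    (hs'.2 ▸ Submodule.subset_span ⟨j, rfl⟩)).symm

theorem GrTendsto.finrank {n : ℕ} {F : ℝ → Submodule ℂ (CSpace n)}
    {L : Submodule ℂ (CSpace n)} (h : GrTendsto F L) : Module.finrank ℂ L = n := by
  obtain ⟨e, b, -, hb, rfl, -⟩ := h
  rw [finrank_span_eq_card hb, Fintype.card_fin]

theorem GrTendsto.isLagrangian {n : ℕ} {F : ℝ → Submodule ℂ (CSpace n)}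
    {L : Submodule ℂ (CSpace n)} (h : GrTendsto F L)
    (hF : ∀ᶠ s in Filter.atTop, IsLagrangian (F s)) : IsLagrangian L := by
  refine isLagrangian_of_isotropic (h.omega_eq_zero h ?_) h.finrank
  filter_upwards [hF] with s hs u hu w hw
  exact (hs u).mp hu w hw

/-- Limits of Lagrangian subspaces are unique: two limits are `ω`-orthogonal to each other. -/
theorem GrTendsto.unique {n : ℕ} {F : ℝ → Submodule ℂ (CSpace n)}
    {L L' : Submodule ℂ (CSpace n)} (h : GrTendsto F L) (h' : GrTendsto F L')
    (hF : ∀ᶠ s in Filter.atTop, IsLagrangian (F s)) : L = L' := by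
  have hL := h.isLagrangian hF
  refine (Submodule.eq_of_le_of_finrank_eq ?_ (h'.finrank.trans h.finrank.symm)).symm
  intro u hu
  refine (hL u).mpr (h'.omega_eq_zero h ?_ u hu)
  filter_upwards [hF] with s hs u hu w hw
  exact (hs u).mp hu w hw

theorem GrTendsto.congr' {n : ℕ} {F F' : ℝ → Submodule ℂ (CSpace n)}
    {L : Submodule ℂ (CSpace n)} (h : GrTendsto F L) (hF : F =ᶠ[Filter.atTop] F') :
    GrTendsto F' L := by
  obtain ⟨e, b, he, h1, h2, h3⟩ := h
  refine ⟨e, b, ?_, h1, h2, h3⟩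
  filter_upwards [he, hF] with s hs hs'
  exact ⟨hs.1, hs.2.trans hs'⟩

theorem GrTendsto.map {n : ℕ} {F : ℝ → Submodule ℂ (CSpace n)} {L : Submodule ℂ (CSpace n)}
    (h : GrTendsto F L) {T : CSpace n →ₗ[ℂ] CSpace n} (hT : Function.Injective T) :
    GrTendsto (fun s => (F s).map T) (L.map T) := by
  obtain ⟨e, b, he, h1, rfl, h3⟩ := h
  have hspan : ∀ c : Fin n → CSpace n, Submodule.span ℂ (Set.range fun i => T (c i))
      = (Submodule.span ℂ (Set.range c)).map T := by
    intro c
    rw [Submodule.map_span, ← Set.range_comp]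
    rfl
  refine ⟨fun s i => T (e s i), fun i => T (b i), ?_, ?_, hspan b, ?_⟩
  · filter_upwards [he] with s hs
    exact ⟨hs.1.map' T (LinearMap.ker_eq_bot.mpr hT), by rw [hspan, hs.2]⟩
  · exact h1.map' T (LinearMap.ker_eq_bot.mpr hT)
  · refine tendsto_pi_nhds.mpr fun i => ?_
    exact ((LinearMap.continuous_of_finiteDimensional T).tendsto _).comp (tendsto_pi_nhds.mp h3 i)

theorem linearIndependent_conjVec {n : ℕ} {e : Fin n → CSpace n} (h : LinearIndependent ℂ e) :
    LinearIndependent ℂ fun i => conjVec (e i) := by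
  rw [Fintype.linearIndependent_iff] at h ⊢
  intro c hc i
  have h1 := congrArg conjVec hc
  rw [conjVec_sum, conjVec_zero] at h1
  simp only [conjVec_smul, conjVec_conjVec] at h1
  simpa using h (fun i => starRingEnd ℂ (c i)) h1 i

theorem GrTendsto.conj {n : ℕ} {F : ℝ → Submodule ℂ (CSpace n)} {L : Submodule ℂ (CSpace n)}
    (h : GrTendsto F L) : GrTendsto (fun s => conjSub (F s)) (conjSub L) := by
  obtain ⟨e, b, he, h1, rfl, h3⟩ := h
  have hspan : ∀ c : Fin n → CSpace n, Submodule.span ℂ (Set.range fun i => conjVec (c i))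
      = conjSub (Submodule.span ℂ (Set.range c)) := by
    intro c
    rw [conjSub_span, ← Set.range_comp]
    rfl
  refine ⟨fun s i => conjVec (e s i), fun i => conjVec (b i), ?_, ?_, hspan b, ?_⟩
  · filter_upwards [he] with s hs
    exact ⟨linearIndependent_conjVec hs.1, by rw [hspan, hs.2]⟩
  · exact linearIndependent_conjVec h1
  · refine tendsto_pi_nhds.mpr fun i => ?_
    exact (continuous_conjVec.tendsto _).comp (tendsto_pi_nhds.mp h3 i)

/-- A family of injective parametrizations of `n`-planes that converges to an injective linear map
gives a convergent family in the Grassmannian. -/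
theorem grTendsto_range {n : ℕ} {T : ℝ → (Fin n → ℂ) →ₗ[ℂ] CSpace n}
    {T₀ : (Fin n → ℂ) →ₗ[ℂ] CSpace n} (hT : ∀ᶠ s in Filter.atTop, Function.Injective (T s))
    (hT₀ : Function.Injective T₀)
    (h : ∀ c, Filter.Tendsto (fun s => T s c) Filter.atTop (𝓝 (T₀ c))) :
    GrTendsto (fun s => LinearMap.range (T s)) (LinearMap.range T₀) := by
  have hspan : ∀ S : (Fin n → ℂ) →ₗ[ℂ] CSpace n,
      Submodule.span ℂ (Set.range fun i => S (Pi.basisFun ℂ (Fin n) i)) = LinearMap.range S := by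
    intro S
    rw [LinearMap.range_eq_map, ← (Pi.basisFun ℂ (Fin n)).span_eq, Submodule.map_span,
      ← Set.range_comp]
    rfl
  have hli : ∀ S : (Fin n → ℂ) →ₗ[ℂ] CSpace n, Function.Injective S →
      LinearIndependent ℂ fun i => S (Pi.basisFun ℂ (Fin n) i) := fun S hS =>
    (Pi.basisFun ℂ (Fin n)).linearIndependent.map' S (LinearMap.ker_eq_bot.mpr hS)
  refine ⟨fun s i => T s (Pi.basisFun ℂ (Fin n) i), fun i => T₀ (Pi.basisFun ℂ (Fin n) i),
    ?_, hli _ hT₀, hspan _, tendsto_pi_nhds.mpr fun i => h _⟩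
  filter_upwards [hT] with s hs
  exact ⟨hli _ hs, hspan _⟩

/-! ### Involutivity of distributions cut out by functions -/

theorem rePart_add {n : ℕ} (v w : CSpace n) : rePart (v + w) = rePart v + rePart w := by
  ext k <;> simp [rePart]

theorem imPart_add {n : ℕ} (v w : CSpace n) : imPart (v + w) = imPart v + imPart w := by
  ext k <;> simp [imPart]

/-- The real part of a complex vector, as a continuous real linear map. -/
def reL (n : ℕ) : CSpace n →L[ℝ] RSpace n :=
  LinearMap.toContinuousLinearMap
    { toFun := rePart
      map_add' := rePart_add
      map_smul' := fun c w => by ext k <;> simp [rePart] }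

/-- The imaginary part of a complex vector, as a continuous real linear map. -/
def imL (n : ℕ) : CSpace n →L[ℝ] RSpace n :=
  LinearMap.toContinuousLinearMap
    { toFun := imPart
      map_add' := imPart_add
      map_smul' := fun c w => by ext k <;> simp [imPart] }

/-- The Hessian form of `f` on complex vectors controls the derivative of `df(Y)` when `df(Y)`
vanishes identically near `q`. -/
theorem dC_extC_fderiv {n : ℕ} {f : RSpace n → ℂ} {Y : RSpace n → CSpace n} {q : RSpace n}
    (hf : ContDiffAt ℝ ∞ f q) (hY : DifferentiableAt ℝ Y q)
    (h0 : ∀ᶠ q' in 𝓝 q, dC f q' (Y q') = 0) (u : RSpace n) :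
    dC f q (fderiv ℝ Y q u) = - (fderiv ℝ (fderiv ℝ f) q u (rePart (Y q))
      + Complex.I • fderiv ℝ (fderiv ℝ f) q u (imPart (Y q))) := by
  have hdf : DifferentiableAt ℝ (fderiv ℝ f) q :=
    (hf.fderiv_right (m := ∞) (by simp)).differentiableAt (by simp)
  have h1 : HasFDerivAt (fun q' => fderiv ℝ f q' (reL n (Y q'))) _ q :=
    hdf.hasFDerivAt.clm_apply ((reL n).hasFDerivAt.comp q hY.hasFDerivAt)
  have h2 : HasFDerivAt (fun q' => fderiv ℝ f q' (imL n (Y q'))) _ q :=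
    hdf.hasFDerivAt.clm_apply ((imL n).hasFDerivAt.comp q hY.hasFDerivAt)
  have h3 := h1.add (h2.const_smul Complex.I)
  have h4 : HasFDerivAt (fun _ : RSpace n => (0 : ℂ)) _ q :=
    h3.congr_of_eventuallyEq (by
      filter_upwards [h0] with q' hq'
      exact hq'.symm)
  have h5 := congrArg (fun T => T u) (h4.unique (hasFDerivAt_const 0 q))
  have h6 : fderiv ℝ f q (rePart (fderiv ℝ Y q u))
      + fderiv ℝ (fderiv ℝ f) q u (rePart (Y q))
      + Complex.I • (fderiv ℝ f q (imPart (fderiv ℝ Y q u))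
      + fderiv ℝ (fderiv ℝ f) q u (imPart (Y q))) = 0 := h5
  rw [dC_apply]
  rw [smul_add] at h6
  linear_combination h6

/-- The second derivatives of `f` cancel in `df[X, Y] = X(df(Y)) - Y(df(X))`. -/
theorem dC_bracket {n : ℕ} {f : RSpace n → ℂ} {X Y : RSpace n → CSpace n} {q : RSpace n}
    (hf : ContDiffAt ℝ ∞ f q) (hX : DifferentiableAt ℝ X q) (hY : DifferentiableAt ℝ Y q)
    (hX0 : ∀ᶠ q' in 𝓝 q, dC f q' (X q') = 0) (hY0 : ∀ᶠ q' in 𝓝 q, dC f q' (Y q') = 0) :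
    dC f q (bracket X Y q) = 0 := by
  have hsymm : ∀ u w, fderiv ℝ (fderiv ℝ f) q u w = fderiv ℝ (fderiv ℝ f) q w u :=
    hf.isSymmSndFDerivAt (by simp; exact WithTop.coe_le_coe.mpr le_top)
  have hext : ∀ Z W : RSpace n → CSpace n, extC (fderiv ℝ Z q : RSpace n →ₗ[ℝ] CSpace n) (W q)
      = fderiv ℝ Z q (rePart (W q)) + Complex.I • fderiv ℝ Z q (imPart (W q)) := fun _ _ => rfl
  rw [bracket, hext, hext, map_sub, map_add, map_add, map_smul, map_smul,
    dC_extC_fderiv hf hY hY0, dC_extC_fderiv hf hY hY0, dC_extC_fderiv hf hX hX0,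
    dC_extC_fderiv hf hX hX0, hsymm (rePart (Y q)) (rePart (X q)),
    hsymm (imPart (Y q)) (rePart (X q)), hsymm (rePart (Y q)) (imPart (X q)),
    hsymm (imPart (Y q)) (imPart (X q))]
  simp only [smul_eq_mul]
  ring

/-- A distribution that near every point is the common kernel of the differentials of some
functions is involutive. -/
theorem involutiveOn_of_functions {n : ℕ} {D : RSpace n → Submodule ℂ (CSpace n)}
    {W : Set (RSpace n)}
    (h : ∀ q ∈ W, ∃ f : Fin n → RSpace n → ℂ, (∀ i, ContDiffAt ℝ ∞ (f i) q) ∧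
      (∀ᶠ q' in 𝓝 q, q' ∈ W → ∀ u ∈ D q', ∀ i, dC (f i) q' u = 0) ∧
      ∀ u, (∀ i, dC (f i) q u = 0) → u ∈ D q) : InvolutiveOn D W := by
  intro V hV hVW X Y hX hY hXD hYD q hq
  obtain ⟨f, hf, hker, hmem⟩ := h q (hVW hq)
  have hVq := hV.mem_nhds hq
  refine hmem _ fun i => dC_bracket (hf i) ?_ ?_ ?_ ?_
  · exact ((hX q hq).contDiffAt hVq).differentiableAt (by simp)
  · exact ((hY q hq).contDiffAt hVq).differentiableAt (by simp)
  · filter_upwards [hker, hVq] with q' h1 h2 using h1 (hVW h2) _ (hXD q' h2) i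
  · filter_upwards [hker, hVq] with q' h1 h2 using h1 (hVW h2) _ (hYD q' h2) i

/-! ### Hessians -/

theorem fderiv_eq_sum_partialD {n : ℕ} (f : (Fin n → ℝ) → ℝ) (x w : Fin n → ℝ) :
    fderiv ℝ f x w = ∑ k, w k * partialD f k x := by
  conv_lhs => rw [← Finset.univ_sum_single w, map_sum]
  refine Finset.sum_congr rfl fun k _ => ?_
  have : (Pi.single k (w k) : Fin n → ℝ) = w k • Pi.single k 1 := by
    rw [← Pi.single_smul]; simp
  rw [this, map_smul, smul_eq_mul, partialD]

theorem partialD_eventuallyEq {n : ℕ} {f g : (Fin n → ℝ) → ℝ} {x : Fin n → ℝ}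
    (h : f =ᶠ[𝓝 x] g) (k : Fin n) : partialD f k =ᶠ[𝓝 x] partialD g k := by
  filter_upwards [h.fderiv (𝕜 := ℝ)] with y hy
  rw [partialD, hy, partialD]

theorem hessian_congr {n : ℕ} {f g : (Fin n → ℝ) → ℝ} {x : Fin n → ℝ} (h : f =ᶠ[𝓝 x] g) :
    hessian f x = hessian g x := by
  ext k j
  exact (partialD_eventuallyEq (partialD_eventuallyEq h k) j).self_of_nhds

theorem contDiffOn_partialD {n : ℕ} {f : (Fin n → ℝ) → ℝ} {U : Set (Fin n → ℝ)} (hU : IsOpen U)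
    (hf : ContDiffOn ℝ ∞ f U) (k : Fin n) : ContDiffOn ℝ ∞ (partialD f k) U :=
  (hf.fderiv_of_isOpen hU (by simp)).clm_apply contDiffOn_const

theorem contDiffAt_partialD {n : ℕ} {f : (Fin n → ℝ) → ℝ} {x : Fin n → ℝ}
    (hf : ContDiffAt ℝ ∞ f x) (k : Fin n) : ContDiffAt ℝ ∞ (partialD f k) x :=
  (hf.fderiv_right (m := ∞) (by simp)).clm_apply contDiffAt_const

theorem contDiffOn_hessian {n : ℕ} {f : (Fin n → ℝ) → ℝ} {U : Set (Fin n → ℝ)} (hU : IsOpen U)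
    (hf : ContDiffOn ℝ ∞ f U) (k j : Fin n) : ContDiffOn ℝ ∞ (fun x => hessian f x k j) U :=
  contDiffOn_partialD hU (contDiffOn_partialD hU hf k) j

theorem hessian_apply_eq {n : ℕ} {f : (Fin n → ℝ) → ℝ} {x : Fin n → ℝ}
    (hf : ContDiffAt ℝ ∞ f x) (k j : Fin n) :
    hessian f x k j = fderiv ℝ (fderiv ℝ f) x (Pi.single j 1) (Pi.single k 1) := by
  have hdf : DifferentiableAt ℝ (fderiv ℝ f) x :=
    (hf.fderiv_right (m := ∞) (by simp)).differentiableAt (by simp)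
  have h := hdf.hasFDerivAt.clm_apply (hasFDerivAt_const (Pi.single k (1 : ℝ)) x)
  change fderiv ℝ (fun y => fderiv ℝ f y (Pi.single k 1)) x (Pi.single j 1) = _
  rw [h.fderiv]
  simp

theorem hessian_transpose {n : ℕ} {f : (Fin n → ℝ) → ℝ} {x : Fin n → ℝ}
    (hf : ContDiffAt ℝ ∞ f x) : (hessian f x)ᵀ = hessian f x := by
  ext k j
  rw [Matrix.transpose_apply, hessian_apply_eq hf, hessian_apply_eq hf]
  exact hf.isSymmSndFDerivAt (by simp; exact WithTop.coe_le_coe.mpr le_top) _ _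

theorem hessian_add {n : ℕ} {f g : (Fin n → ℝ) → ℝ} {x : Fin n → ℝ}
    (hf : ContDiffAt ℝ ∞ f x) (hg : ContDiffAt ℝ ∞ g x) :
    hessian (fun y => f y + g y) x = hessian f x + hessian g x := by
  have key : ∀ {f g : (Fin n → ℝ) → ℝ}, ContDiffAt ℝ ∞ f x → ContDiffAt ℝ ∞ g x → ∀ k,
      partialD (fun y => f y + g y) k =ᶠ[𝓝 x] fun y => partialD f k y + partialD g k y := by
    intro f g hf hg k
    filter_upwards [(hf.of_le (m := 1) (by simp)).eventually (by simp),
      (hg.of_le (m := 1) (by simp)).eventually (by simp)] with y h1 h2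
    rw [partialD, fderiv_fun_add (h1.differentiableAt (by simp)) (h2.differentiableAt (by simp))]
    rfl
  ext k j
  change partialD (partialD (fun y => f y + g y) k) j x = _
  rw [(partialD_eventuallyEq (key hf hg k) j).self_of_nhds,
    (key (contDiffAt_partialD hf k) (contDiffAt_partialD hg k) j).self_of_nhds]
  rfl

theorem hessian_const_mul {n : ℕ} {f : (Fin n → ℝ) → ℝ} {x : Fin n → ℝ}
    (hf : ContDiffAt ℝ ∞ f x) (c : ℝ) :
    hessian (fun y => c * f y) x = c • hessian f x := by
  have key : ∀ {f : (Fin n → ℝ) → ℝ}, ContDiffAt ℝ ∞ f x → ∀ k,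
      partialD (fun y => c * f y) k =ᶠ[𝓝 x] fun y => c * partialD f k y := by
    intro f hf k
    filter_upwards [(hf.of_le (m := 1) (by simp)).eventually (by simp)] with y h1
    rw [partialD, fderiv_const_mul (h1.differentiableAt (by simp))]
    rfl
  ext k j
  change partialD (partialD (fun y => c * f y) k) j x = _
  rw [(partialD_eventuallyEq (key hf k) j).self_of_nhds,
    (key (contDiffAt_partialD hf k) j).self_of_nhds]
  rfl

theorem hessian_const {n : ℕ} (c : ℝ) (x : Fin n → ℝ) :
    hessian (fun _ : Fin n → ℝ => c) x = 0 := by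
  have h : ∀ (c : ℝ) (k : Fin n), partialD (fun _ : Fin n → ℝ => c) k = fun _ => 0 := by
    intro c k
    ext y
    simp [partialD]
  ext k j
  change partialD (partialD (fun _ => c) k) j x = 0
  rw [h, h]

theorem hessian_sum {n : ℕ} {ι : Type*} (S : Finset ι) {f : ι → (Fin n → ℝ) → ℝ}
    {x : Fin n → ℝ} (hf : ∀ i ∈ S, ContDiffAt ℝ ∞ (f i) x) :
    hessian (fun y => ∑ i ∈ S, f i y) x = ∑ i ∈ S, hessian (f i) x := by
  classical
  induction S using Finset.induction_on with
  | empty => simpa using hessian_const 0 x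
  | insert a S ha ih =>
    simp only [Finset.sum_insert ha]
    rw [hessian_add (hf a (Finset.mem_insert_self _ _))
      (ContDiffAt.sum fun i hi => hf i (Finset.mem_insert_of_mem hi)),
      ih fun i hi => hf i (Finset.mem_insert_of_mem hi)]

/-- The Hessian of a function of one affine form. -/
theorem hessian_comp_affine {n : ℕ} {φ φ' : ℝ → ℝ} {φ'' : ℝ} {L : (Fin n → ℝ) → ℝ}
    {ν : Fin n → ℝ} {x : Fin n → ℝ}
    (hL : ∀ y, HasFDerivAt L (∑ i, ν i • ContinuousLinearMap.proj (R := ℝ) (φ := fun _ => ℝ) i) y)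
    (hφ : ∀ᶠ t in 𝓝 (L x), HasDerivAt φ (φ' t) t) (hφ' : HasDerivAt φ' φ'' (L x)) :
    hessian (fun y => φ (L y)) x = φ'' • Matrix.vecMulVec ν ν := by
  have happ : ∀ k, (∑ i, ν i • ContinuousLinearMap.proj (R := ℝ) (φ := fun _ => ℝ) i)
      (Pi.single k (1 : ℝ)) = ν k := by
    intro k
    simp [Pi.single_apply]
  have h1 : ∀ k, partialD (fun y => φ (L y)) k =ᶠ[𝓝 x] fun y => φ' (L y) * ν k := by
    intro k
    filter_upwards [(hL x).continuousAt.eventually hφ] with y hy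
    have hd : HasFDerivAt (fun y => φ (L y)) _ y := hy.comp_hasFDerivAt y (hL y)
    rw [partialD, hd.fderiv]
    simp only [smul_apply, happ, smul_eq_mul]
  ext k j
  change partialD (partialD (fun y => φ (L y)) k) j x = _
  have hd : HasFDerivAt (fun y => φ' (L y)) _ x := hφ'.comp_hasFDerivAt x (hL x)
  rw [(partialD_eventuallyEq (h1 k) j).self_of_nhds, partialD, (hd.mul_const (ν k)).fderiv]
  simp only [smul_apply, happ, smul_eq_mul, Matrix.smul_apply,
    Matrix.vecMulVec_apply]
  ring

namespace DelzantPolytope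

variable {n : ℕ} {Δ : DelzantPolytope n}

theorem hasFDerivAt_l (Δ : DelzantPolytope n) (r : Fin Δ.d) (x : Fin n → ℝ) :
    HasFDerivAt (Δ.l r) (∑ i, (Δ.normal r i : ℝ) •
      ContinuousLinearMap.proj (R := ℝ) (φ := fun _ => ℝ) i) x := by
  unfold DelzantPolytope.l affineForm
  refine HasFDerivAt.add_const _ (HasFDerivAt.fun_sum fun i _ => ?_)
  exact (ContinuousLinearMap.proj (R := ℝ) (φ := fun _ => ℝ) i).hasFDerivAt.mul_const _

theorem contDiff_l (Δ : DelzantPolytope n) (r : Fin Δ.d) : ContDiff ℝ ∞ (Δ.l r) := by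
  unfold DelzantPolytope.l affineForm
  fun_prop

theorem isOpen_inside (Δ : DelzantPolytope n) : IsOpen Δ.inside := by
  have : Δ.inside = ⋂ r, {x | 0 < Δ.l r x} := by
    ext y
    simp [inside]
  rw [this]
  exact isOpen_iInter_of_finite fun r => isOpen_lt continuous_const (Δ.contDiff_l r).continuous

/-- The affine forms of the facets that do not contain the vertex are positive on this set; it is a
neighbourhood of the part of the polytope seen by the chart at `v`. -/
def Vertex.nearby (v : Δ.Vertex) : Set (Fin n → ℝ) :=
  {x | ∀ r, r ∉ Set.range v.facet → 0 < Δ.l r x}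

theorem Vertex.isOpen_nearby (v : Δ.Vertex) : IsOpen v.nearby := by
  have : v.nearby = ⋂ r, ⋂ (_ : r ∉ Set.range v.facet), {x | 0 < Δ.l r x} := by
    ext y
    simp [nearby]
  rw [this]
  exact isOpen_iInter_of_finite fun r => isOpen_iInter_of_finite fun _ =>
    isOpen_lt continuous_const (Δ.contDiff_l r).continuous

theorem Vertex.inside_subset_nearby (v : Δ.Vertex) : Δ.inside ⊆ v.nearby := fun _ hx r _ => hx r

open Classical in
/-- The part of the potential `g_P + h` that stays smooth on the faces through the vertex `v`: the
terms `½ ℓ_r log ℓ_r` of the facets through `v` are left out. -/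
def Vertex.reg (v : Δ.Vertex) (h : (Fin n → ℝ) → ℝ) (x : Fin n → ℝ) : ℝ :=
  h x + ∑ r ∈ Finset.univ.filter (fun r => r ∉ Set.range v.facet),
    (1 / 2) * (Δ.l r x * Real.log (Δ.l r x))

theorem contDiffAt_l_mul_log {r : Fin Δ.d} {x : Fin n → ℝ} (hx : 0 < Δ.l r x) :
    ContDiffAt ℝ ∞ (fun y => (1 / 2) * (Δ.l r y * Real.log (Δ.l r y))) x :=
  contDiffAt_const.mul ((Δ.contDiff_l r).contDiffAt.mul ((Δ.contDiff_l r).contDiffAt.log hx.ne'))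

theorem Vertex.contDiffOn_reg (v : Δ.Vertex) {h : (Fin n → ℝ) → ℝ} (hh : ContDiff ℝ ∞ h) :
    ContDiffOn ℝ ∞ (v.reg h) v.nearby := by
  intro x hx
  refine ContDiffAt.contDiffWithinAt (hh.contDiffAt.add (ContDiffAt.sum fun r hr => ?_))
  exact contDiffAt_l_mul_log (hx r (Finset.mem_filter.mp hr).2)

theorem Vertex.contDiffAt_reg (v : Δ.Vertex) {h : (Fin n → ℝ) → ℝ} (hh : ContDiff ℝ ∞ h)
    {x : Fin n → ℝ} (hx : x ∈ v.nearby) : ContDiffAt ℝ ∞ (v.reg h) x :=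
  (v.contDiffOn_reg hh).contDiffAt (v.isOpen_nearby.mem_nhds hx)

theorem Vertex.guillemin_add (v : Δ.Vertex) (h : (Fin n → ℝ) → ℝ) (x : Fin n → ℝ) :
    Δ.guillemin x + h x = v.reg h x
      + ∑ k, (1 / 2) * (Δ.l (v.facet k) x * Real.log (Δ.l (v.facet k) x)) := by
  classical
  have himg : Finset.univ.filter (fun r => r ∈ Set.range v.facet)
      = Finset.univ.image v.facet := by
    ext r
    simp
  rw [guillemin, reg, Finset.mul_sum,
    ← Finset.sum_filter_add_sum_filter_not Finset.univ (fun r => r ∈ Set.range v.facet), himg,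
    Finset.sum_image fun a _ b _ h => v.injective h]
  ring_nf

/-- The Hessian of the regular part of the potential in the coordinates `x_v = A_v x + λ_v`. -/
def Vertex.curv (v : Δ.Vertex) (h : (Fin n → ℝ) → ℝ) (x : Fin n → ℝ) : Matrix (Fin n) (Fin n) ℝ :=
  v.mat⁻¹ᵀ * hessian (v.reg h) x * v.mat⁻¹

theorem Vertex.mat_mul_inv (v : Δ.Vertex) : v.mat * v.mat⁻¹ = 1 :=
  Matrix.mul_nonsing_inv _ v.isUnit_det

theorem Vertex.inv_mul_mat (v : Δ.Vertex) : v.mat⁻¹ * v.mat = 1 :=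
  Matrix.nonsing_inv_mul _ v.isUnit_det

theorem Vertex.curv_transpose (v : Δ.Vertex) {h : (Fin n → ℝ) → ℝ} (hh : ContDiff ℝ ∞ h)
    {x : Fin n → ℝ} (hx : x ∈ v.nearby) : (v.curv h x)ᵀ = v.curv h x := by
  rw [curv, Matrix.transpose_mul, Matrix.transpose_mul, hessian_transpose (v.contDiffAt_reg hh hx),
    Matrix.transpose_transpose, Matrix.mul_assoc]

theorem Vertex.contDiffOn_curv (v : Δ.Vertex) {h : (Fin n → ℝ) → ℝ} (hh : ContDiff ℝ ∞ h)
    (i j : Fin n) : ContDiffOn ℝ ∞ (fun x => v.curv h x i j) v.nearby := by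
  simp only [curv, Matrix.mul_apply]
  refine ContDiffOn.sum fun k _ => ContDiffOn.mul (ContDiffOn.sum fun l _ => ?_) contDiffOn_const
  exact contDiffOn_const.mul (contDiffOn_hessian v.isOpen_nearby (v.contDiffOn_reg hh) l k)

theorem Vertex.contDiffAt_potential (v : Δ.Vertex) {g h : (Fin n → ℝ) → ℝ} (hh : ContDiff ℝ ∞ h)
    (hg : ∀ x ∈ Δ.inside, g x = Δ.guillemin x + h x) {x : Fin n → ℝ} (hx : x ∈ Δ.inside) :
    ContDiffAt ℝ ∞ g x := by
  have heq : g =ᶠ[𝓝 x] fun y => v.reg h y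
      + ∑ k, (1 / 2) * (Δ.l (v.facet k) y * Real.log (Δ.l (v.facet k) y)) := by
    filter_upwards [Δ.isOpen_inside.mem_nhds hx] with y hy
    rw [hg y hy, v.guillemin_add]
  refine ContDiffAt.congr_of_eventuallyEq ?_ heq
  exact (v.contDiffAt_reg hh (v.inside_subset_nearby hx)).add
    (ContDiffAt.sum fun k _ => contDiffAt_l_mul_log (hx _))

/-- The Hessian of a symplectic potential near the vertex `v`. -/
theorem Vertex.hessian_potential (v : Δ.Vertex) {g h : (Fin n → ℝ) → ℝ} (hh : ContDiff ℝ ∞ h)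
    (hg : ∀ x ∈ Δ.inside, g x = Δ.guillemin x + h x) {x : Fin n → ℝ} (hx : x ∈ Δ.inside) :
    hessian g x = v.matᵀ * (v.curv h x
      + Matrix.diagonal fun k => (2 * Δ.l (v.facet k) x)⁻¹) * v.mat := by
  have heq : g =ᶠ[𝓝 x] fun y => v.reg h y
      + ∑ k, (1 / 2) * (Δ.l (v.facet k) y * Real.log (Δ.l (v.facet k) y)) := by
    filter_upwards [Δ.isOpen_inside.mem_nhds hx] with y hy
    rw [hg y hy, v.guillemin_add]
  rw [hessian_congr heq, hessian_add (v.contDiffAt_reg hh (v.inside_subset_nearby hx))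
    (ContDiffAt.sum fun k _ => contDiffAt_l_mul_log (hx _)),
    hessian_sum _ fun k _ => contDiffAt_l_mul_log (hx _), Matrix.mul_add, Matrix.add_mul]
  congr 1
  · rw [curv, ← Matrix.mul_assoc, ← Matrix.mul_assoc, ← Matrix.transpose_mul, v.inv_mul_mat,
      Matrix.transpose_one, Matrix.one_mul, Matrix.mul_assoc, v.inv_mul_mat, Matrix.mul_one]
  · have h1 : ∀ k, hessian (fun y => (1 / 2) * (Δ.l (v.facet k) y * Real.log (Δ.l (v.facet k) y))) x
        = (2 * Δ.l (v.facet k) x)⁻¹ • Matrix.vecMulVec (v.mat k) (v.mat k) := by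
      intro k
      refine hessian_comp_affine (φ := fun t => (1 / 2) * (t * Real.log t))
        (φ' := fun t => (1 / 2) * (Real.log t + 1)) (Δ.hasFDerivAt_l (v.facet k)) ?_ ?_
      · filter_upwards [lt_mem_nhds (hx (v.facet k))] with t ht
        exact (Real.hasDerivAt_mul_log ht.ne').const_mul _
      · have := ((Real.hasDerivAt_log (hx (v.facet k)).ne').add_const 1).const_mul (1 / 2 : ℝ)
        have he : (2 * Δ.l (v.facet k) x)⁻¹ = 1 / 2 * (Δ.l (v.facet k) x)⁻¹ := by
          rw [mul_inv, one_div]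
        rw [he]
        exact this
    simp only [h1]
    ext i j
    rw [Matrix.mul_apply]
    simp only [Matrix.sum_apply, Matrix.smul_apply, Matrix.vecMulVec_apply,
      Matrix.mul_diagonal, Matrix.transpose_apply, smul_eq_mul]
    exact Finset.sum_congr rfl fun k _ => by ring

end DelzantPolytope

/-! ### The Hamiltonian of the subtorus -/

/-- The differential of `(x̃_1, …, x̃_p)`, padded with zero rows. -/
def subtorusMat {n : ℕ} (B : Matrix.SpecialLinearGroup (Fin n) ℤ) (p : ℕ) :
    Matrix (Fin n) (Fin n) ℝ :=
  Matrix.of fun j k => if j.val < p then (B.1 j k : ℝ) else 0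

theorem contDiff_xt {n : ℕ} (B : Matrix.SpecialLinearGroup (Fin n) ℤ) (j : Fin n) :
    ContDiff ℝ ∞ (xt B j) := by
  unfold xt
  fun_prop

theorem hasFDerivAt_xt {n : ℕ} (B : Matrix.SpecialLinearGroup (Fin n) ℤ) (j : Fin n)
    (x : Fin n → ℝ) : HasFDerivAt (xt B j) (∑ i, (B.1 j i : ℝ) •
      ContinuousLinearMap.proj (R := ℝ) (φ := fun _ => ℝ) i) x := by
  unfold xt
  refine HasFDerivAt.fun_sum fun i _ => ?_
  exact (ContinuousLinearMap.proj (R := ℝ) (φ := fun _ => ℝ) i).hasFDerivAt.const_mul _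

theorem contDiff_hamH {n : ℕ} (B : Matrix.SpecialLinearGroup (Fin n) ℤ) (p : ℕ) :
    ContDiff ℝ ∞ (hamH B p) := by
  unfold hamH
  refine contDiff_const.mul (ContDiff.sum fun j _ => ?_)
  by_cases hj : j.val < p
  · simp only [hj, if_true]
    exact (contDiff_xt B j).pow 2
  · simp only [hj, if_false]
    exact contDiff_const

theorem hessian_hamH {n : ℕ} (B : Matrix.SpecialLinearGroup (Fin n) ℤ) (p : ℕ) (x : Fin n → ℝ) :
    hessian (hamH B p) x = (subtorusMat B p)ᵀ * subtorusMat B p := by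
  have hsm : ∀ j : Fin n, ContDiffAt ℝ ∞ (fun y => if j.val < p then xt B j y ^ 2 else 0) x := by
    intro j
    by_cases hj : j.val < p
    · simp only [hj, if_true]
      exact ((contDiff_xt B j).pow 2).contDiffAt
    · simp only [hj, if_false]
      exact contDiffAt_const
  have h1 : ∀ j : Fin n, hessian (fun y => if j.val < p then xt B j y ^ 2 else 0) x
      = (2 : ℝ) • Matrix.vecMulVec (subtorusMat B p j) (subtorusMat B p j) := by
    intro j
    by_cases hj : j.val < p
    · simp only [hj, if_true]
      have hrow : subtorusMat B p j = fun i => (B.1 j i : ℝ) := by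
        ext i
        simp [subtorusMat, hj]
      rw [hrow]
      refine hessian_comp_affine (φ := fun t => t ^ 2) (φ' := fun t => 2 * t)
        (hasFDerivAt_xt B j) (Filter.Eventually.of_forall fun t => ?_) ?_
      · simpa using hasDerivAt_pow 2 t
      · simpa using (hasDerivAt_id (xt B j x)).const_mul (2 : ℝ)
    · simp only [hj, if_false]
      rw [hessian_const]
      ext i k
      simp [subtorusMat, hj, Matrix.vecMulVec_apply]
  unfold hamH
  rw [hessian_const_mul (ContDiffAt.sum fun j _ => hsm j), hessian_sum _ fun j _ => hsm j]
  simp only [h1]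
  ext i k
  simp only [Matrix.smul_apply, Matrix.sum_apply, Matrix.vecMulVec_apply, Matrix.mul_apply,
    Matrix.transpose_apply, smul_eq_mul, Finset.mul_sum]
  exact Finset.sum_congr rfl fun j _ => by ring

theorem hessian_potAt {n : ℕ} (B : Matrix.SpecialLinearGroup (Fin n) ℤ) (p : ℕ)
    {g : (Fin n → ℝ) → ℝ} (s : ℝ) {x : Fin n → ℝ} (hg : ContDiffAt ℝ ∞ g x) :
    hessian (potAt B p g s) x
      = hessian g x + s • ((subtorusMat B p)ᵀ * subtorusMat B p) := by
  unfold potAt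
  rw [hessian_add hg (contDiffAt_const.mul (contDiff_hamH B p).contDiffAt),
    hessian_const_mul (contDiff_hamH B p).contDiffAt, hessian_hamH]

/-- The differential of `(x̃_1, …, x̃_p)` in the coordinates `x_v`, padded with zero rows. -/
def DelzantPolytope.Vertex.subMat {n : ℕ} {Δ : DelzantPolytope n} (v : Δ.Vertex)
    (B : Matrix.SpecialLinearGroup (Fin n) ℤ) (p : ℕ) : Matrix (Fin n) (Fin n) ℝ :=
  subtorusMat B p * v.mat⁻¹

theorem DelzantPolytope.Vertex.curv_potAt {n : ℕ} {Δ : DelzantPolytope n} (v : Δ.Vertex)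
    (B : Matrix.SpecialLinearGroup (Fin n) ℤ) (p : ℕ) {h : (Fin n → ℝ) → ℝ}
    (hh : ContDiff ℝ ∞ h) (s : ℝ) {x : Fin n → ℝ} (hx : x ∈ v.nearby) :
    v.curv (potAt B p h s) x = v.curv h x + s • ((v.subMat B p)ᵀ * v.subMat B p) := by
  have hreg : v.reg (potAt B p h s) = potAt B p (v.reg h) s := by
    ext y
    simp only [reg, potAt]
    ring
  rw [curv, hreg, hessian_potAt B p s (v.contDiffAt_reg hh hx), Matrix.mul_add, Matrix.add_mul,
    curv, subMat, Matrix.transpose_mul, Matrix.mul_smul, Matrix.smul_mul]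
  simp only [Matrix.mul_assoc]

/-! ### The linear model of the Kähler polarization in a Darboux chart -/

theorem cMat_mul {n : ℕ} (A B : Matrix (Fin n) (Fin n) ℝ) : cMat (A * B) = cMat A * cMat B :=
  Matrix.map_mul (f := Complex.ofRealHom)

theorem cMat_add {n : ℕ} (A B : Matrix (Fin n) (Fin n) ℝ) : cMat (A + B) = cMat A + cMat B := by
  ext i j
  simp [cMat]

theorem cMat_smul {n : ℕ} (s : ℝ) (A : Matrix (Fin n) (Fin n) ℝ) :
    cMat (s • A) = (s : ℂ) • cMat A := by
  ext i j
  simp [cMat]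

theorem cMat_one {n : ℕ} : cMat (1 : Matrix (Fin n) (Fin n) ℝ) = 1 := by
  ext i j
  simp [cMat, Matrix.one_apply, apply_ite]

theorem cMat_transpose {n : ℕ} (A : Matrix (Fin n) (Fin n) ℝ) : cMat Aᵀ = (cMat A)ᵀ := rfl

theorem cMat_conjTranspose {n : ℕ} (A : Matrix (Fin n) (Fin n) ℝ) :
    (cMat A)ᴴ = (cMat A)ᵀ := by
  ext i j
  simp [cMat]

/-- The conjugates `ζ̄_k = a_k - i b_k` of the complex coordinates. -/
def zbar {n : ℕ} (q : RSpace n) (k : Fin n) : ℂ := q.1 k - q.2 k * Complex.I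

/-- The complexified differential of the functions `½ (a_k² + b_k²)`. -/
def dXi {n : ℕ} (q : RSpace n) : CSpace n →ₗ[ℂ] (Fin n → ℂ) where
  toFun u k := q.1 k * u.1 k + q.2 k * u.2 k
  map_add' u w := by
    ext k
    simp only [Prod.fst_add, Prod.snd_add, Pi.add_apply]
    ring
  map_smul' c u := by
    ext k
    simp only [Prod.smul_fst, Prod.smul_snd, Pi.smul_apply, smul_eq_mul, RingHom.id_apply]
    ring

/-- The vector field `-i ∑_k w_k ∂/∂θ_k`, where `∂/∂θ_k = a_k ∂/∂b_k - b_k ∂/∂a_k`. -/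
def rot {n : ℕ} (q : RSpace n) : (Fin n → ℂ) →ₗ[ℂ] CSpace n where
  toFun w := (fun k => Complex.I * (q.2 k * w k), fun k => -(Complex.I * (q.1 k * w k)))
  map_add' u w := by
    ext k <;> simp only [Prod.fst_add, Prod.snd_add, Pi.add_apply] <;> ring
  map_smul' c u := by
    ext k <;> simp only [Prod.smul_fst, Prod.smul_snd, Pi.smul_apply, smul_eq_mul,
      RingHom.id_apply] <;> ring

/-- The one-forms `dζ̄_j + ζ̄_j ∑_k K_{jk} d(½|ζ_k|²)`. -/
def modelForm {n : ℕ} (K : Matrix (Fin n) (Fin n) ℝ) (q : RSpace n) :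
    CSpace n →ₗ[ℂ] (Fin n → ℂ) where
  toFun u j := u.1 j - Complex.I * u.2 j + zbar q j * (cMat K *ᵥ dXi q u) j
  map_add' u w := by
    ext k
    simp only [Prod.fst_add, Prod.snd_add, Pi.add_apply, map_add, Matrix.mulVec_add]
    ring
  map_smul' c u := by
    ext k
    simp only [Prod.smul_fst, Prod.smul_snd, Pi.smul_apply, smul_eq_mul, RingHom.id_apply,
      map_smul, Matrix.mulVec_smul]
    ring

/-- A parametrization of the common kernel of the forms `modelForm K q`. The value at the `k`-th
basis vector is `2 ∂/∂ζ_k` corrected by a combination of the rotation fields. -/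
def modelFrame {n : ℕ} (K : Matrix (Fin n) (Fin n) ℝ) (q : RSpace n) :
    (Fin n → ℂ) →ₗ[ℂ] CSpace n where
  toFun c := (c, fun k => -(Complex.I * c k)) + rot q (cMat K *ᵥ fun k => zbar q k * c k)
  map_add' u w := by
    have h : (fun k => zbar q k * (u + w) k)
        = (fun k => zbar q k * u k) + fun k => zbar q k * w k := by
      ext k
      simp only [Pi.add_apply]
      ring
    rw [h, Matrix.mulVec_add, map_add]
    ext k <;> simp only [Prod.fst_add, Prod.snd_add, Pi.add_apply] <;> ring
  map_smul' c u := by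
    have h : (fun k => zbar q k * (c • u) k) = c • fun k => zbar q k * u k := by
      ext k
      simp only [Pi.smul_apply, smul_eq_mul]
      ring
    rw [h, Matrix.mulVec_smul, map_smul]
    ext k <;> simp only [Prod.fst_add, Prod.snd_add, Pi.add_apply, Prod.smul_fst, Prod.smul_snd,
      Pi.smul_apply, smul_eq_mul, RingHom.id_apply] <;> ring

/-- The linear model of a toric Kähler polarization. -/
def modelPol {n : ℕ} (K : Matrix (Fin n) (Fin n) ℝ) (q : RSpace n) : Submodule ℂ (CSpace n) :=
  LinearMap.ker (modelForm K q)

theorem dXi_apply {n : ℕ} (q : RSpace n) (u : CSpace n) (k : Fin n) :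
    dXi q u k = q.1 k * u.1 k + q.2 k * u.2 k := rfl

theorem modelForm_apply {n : ℕ} (K : Matrix (Fin n) (Fin n) ℝ) (q : RSpace n) (u : CSpace n)
    (j : Fin n) : modelForm K q u j
      = u.1 j - Complex.I * u.2 j + zbar q j * (cMat K *ᵥ dXi q u) j := rfl

theorem modelFrame_fst {n : ℕ} (K : Matrix (Fin n) (Fin n) ℝ) (q : RSpace n) (c : Fin n → ℂ)
    (k : Fin n) : (modelFrame K q c).1 k
      = c k + Complex.I * (q.2 k * (cMat K *ᵥ fun k => zbar q k * c k) k) := rfl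

theorem modelFrame_snd {n : ℕ} (K : Matrix (Fin n) (Fin n) ℝ) (q : RSpace n) (c : Fin n → ℂ)
    (k : Fin n) : (modelFrame K q c).2 k
      = -(Complex.I * c k) + -(Complex.I * (q.1 k * (cMat K *ᵥ fun k => zbar q k * c k) k)) := rfl

theorem mem_modelPol {n : ℕ} {K : Matrix (Fin n) (Fin n) ℝ} {q : RSpace n} {u : CSpace n} :
    u ∈ modelPol K q ↔ ∀ j, modelForm K q u j = 0 := by
  rw [modelPol, LinearMap.mem_ker, funext_iff]
  rfl

theorem dXi_rot {n : ℕ} (q : RSpace n) (w : Fin n → ℂ) : dXi q (rot q w) = 0 := by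
  ext k
  change (q.1 k : ℂ) * (Complex.I * (q.2 k * w k)) + q.2 k * -(Complex.I * (q.1 k * w k)) = 0
  ring

theorem dXi_modelFrame {n : ℕ} (K : Matrix (Fin n) (Fin n) ℝ) (q : RSpace n) (c : Fin n → ℂ) :
    dXi q (modelFrame K q c) = fun k => zbar q k * c k := by
  ext k
  rw [dXi_apply, modelFrame_fst, modelFrame_snd, zbar]
  ring

theorem modelFrame_mem {n : ℕ} (K : Matrix (Fin n) (Fin n) ℝ) (q : RSpace n) (c : Fin n → ℂ) :
    modelFrame K q c ∈ modelPol K q := by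
  refine mem_modelPol.mpr fun j => ?_
  rw [modelForm_apply, dXi_modelFrame, modelFrame_fst, modelFrame_snd]
  generalize (cMat K *ᵥ fun k => zbar q k * c k) j = w
  rw [zbar]
  linear_combination (c j + q.1 j * w) * Complex.I_sq

theorem range_modelFrame {n : ℕ} (K : Matrix (Fin n) (Fin n) ℝ) (q : RSpace n) :
    LinearMap.range (modelFrame K q) = modelPol K q := by
  apply le_antisymm
  · rintro _ ⟨c, rfl⟩
    exact modelFrame_mem K q c
  · intro u hu
    rw [mem_modelPol] at hu
    -- `c` is half of `dζ(u) - ζ K dξ(u)`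
    refine ⟨fun k => (u.1 k + Complex.I * u.2 k
      - (q.1 k + q.2 k * Complex.I) * (cMat K *ᵥ dXi q u) k) / 2, ?_⟩
    have hη : (fun k => zbar q k * ((u.1 k + Complex.I * u.2 k
        - (q.1 k + q.2 k * Complex.I) * (cMat K *ᵥ dXi q u) k) / 2)) = dXi q u := by
      ext k
      have := hu k
      rw [modelForm_apply] at this
      rw [dXi_apply, zbar] at *
      linear_combination (-(q.1 k + q.2 k * Complex.I) / 2) * this
        - (q.2 k * u.2 k) * Complex.I_sq
    ext k
    · rw [modelFrame_fst, hη]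
      have := hu k
      rw [modelForm_apply, zbar] at this
      linear_combination -this / 2
    · rw [modelFrame_snd, hη]
      have := hu k
      rw [modelForm_apply, zbar] at this
      linear_combination (-Complex.I / 2) * this - u.2 k * Complex.I_sq

theorem modelFrame_injective {n : ℕ} (K : Matrix (Fin n) (Fin n) ℝ) (q : RSpace n) :
    Function.Injective (modelFrame K q) := by
  rw [← LinearMap.ker_eq_bot, LinearMap.ker_eq_bot']
  intro c hc
  have h1 : (fun k => zbar q k * c k) = 0 := by
    rw [← dXi_modelFrame K, hc, map_zero]
  ext k
  have h2 := modelFrame_fst K q c k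
  rw [hc, h1, Matrix.mulVec_zero] at h2
  simpa using h2.symm

theorem cMat_dotProduct_comm {n : ℕ} {K : Matrix (Fin n) (Fin n) ℝ} (hK : Kᵀ = K)
    (u w : Fin n → ℂ) : u ⬝ᵥ (cMat K *ᵥ w) = (cMat K *ᵥ u) ⬝ᵥ w := by
  rw [Matrix.dotProduct_mulVec, ← Matrix.mulVec_transpose, ← cMat_transpose, hK]

/-- The `ω`-dual of the frame of the model polarization consists of the forms that define it, which
is why the polarization is its own orthogonal when `K` is symmetric. -/
theorem omega_modelFrame {n : ℕ} {K : Matrix (Fin n) (Fin n) ℝ} (hK : Kᵀ = K) (q : RSpace n)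
    (u : CSpace n) (c : Fin n → ℂ) :
    omega u (modelFrame K q c) = -Complex.I * ∑ j, c j * modelForm K q u j := by
  have h1 := cMat_dotProduct_comm hK (dXi q u) (fun k => zbar q k * c k)
  simp only [dotProduct] at h1
  have h2 : omega u (modelFrame K q c) = -Complex.I * (∑ j, c j * (u.1 j - Complex.I * u.2 j)
      + ∑ j, dXi q u j * (cMat K *ᵥ fun k => zbar q k * c k) j) := by
    rw [omega, ← Finset.sum_add_distrib, Finset.mul_sum]
    refine Finset.sum_congr rfl fun k _ => ?_
    rw [modelFrame_fst, modelFrame_snd, dXi_apply]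
    linear_combination (-c k * u.2 k) * Complex.I_sq
  rw [h2, h1, ← Finset.sum_add_distrib]
  congr 1
  refine Finset.sum_congr rfl fun k _ => ?_
  rw [modelForm_apply]
  ring

theorem isLagrangian_modelPol {n : ℕ} {K : Matrix (Fin n) (Fin n) ℝ} (hK : Kᵀ = K)
    (q : RSpace n) : IsLagrangian (modelPol K q) := by
  intro u
  rw [mem_modelPol, ← range_modelFrame]
  constructor
  · rintro h _ ⟨c, rfl⟩
    rw [omega_modelFrame hK]
    simp [h]
  · intro h j
    have := h _ ⟨Pi.single j 1, rfl⟩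
    rw [omega_modelFrame hK] at this
    simpa [Pi.single_apply] using this

/-- The Hermitian form `-i ω(w, w̄)` of the model polarization, up to a factor 2, in its frame. -/
theorem omega_modelFrame_conjVec {n : ℕ} {K : Matrix (Fin n) (Fin n) ℝ} (hK : Kᵀ = K) (q : RSpace n)
    (c : Fin n → ℂ) :
    omega (modelFrame K q c) (conjVec (modelFrame K q c)) = 2 * Complex.I *
      (star c ⬝ᵥ c + star (fun k => zbar q k * c k) ⬝ᵥ (cMat K *ᵥ fun k => zbar q k * c k)) := by
  have h1 := cMat_dotProduct_comm hK (star fun k => zbar q k * c k) (fun k => zbar q k * c k)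
  set w := cMat K *ᵥ fun k => zbar q k * c k with hw
  have hconj : cMat K *ᵥ (star fun k => zbar q k * c k) = star w := by
    rw [hw, Matrix.star_mulVec, cMat_conjTranspose, Matrix.vecMul_transpose]
  rw [hconj] at h1
  have hf1 : ∀ k, (modelFrame K q c).1 k = c k + Complex.I * (q.2 k * w k) := fun _ => rfl
  have hf2 : ∀ k, (modelFrame K q c).2 k
      = -(Complex.I * c k) + -(Complex.I * (q.1 k * w k)) := fun _ => rfl
  clear_value w
  have h2 : omega (modelFrame K q c) (conjVec (modelFrame K q c)) = Complex.I *
      (2 * (star c ⬝ᵥ c) + (star (fun k => zbar q k * c k) ⬝ᵥ w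
        + star w ⬝ᵥ (fun k => zbar q k * c k))) := by
    simp only [dotProduct, omega, ← Finset.sum_add_distrib, Finset.mul_sum]
    refine Finset.sum_congr rfl fun k _ => ?_
    simp only [conjVec, hf1, hf2, Pi.star_apply, zbar, map_add,
      map_mul, map_neg, Complex.conj_I, Complex.conj_ofReal, RCLike.star_def, map_sub]
    ring
  rw [h2, ← h1]
  ring

theorem modelFrame_add_smul {n : ℕ} (K C : Matrix (Fin n) (Fin n) ℝ) (q : RSpace n) (s : ℝ)
    (c : Fin n → ℂ) : modelFrame (K + s • (Cᵀ * C)) q c = modelFrame K q c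
      + (s : ℂ) • rot q ((cMat C)ᵀ *ᵥ (cMat C *ᵥ fun k => zbar q k * c k)) := by
  change (_ : CSpace n) + rot q _ = _ + rot q _ + _
  rw [cMat_add, cMat_smul, cMat_mul, cMat_transpose, Matrix.add_mulVec, Matrix.smul_mulVec,
    Matrix.mulVec_mulVec, map_add, map_smul, add_assoc]

open ComplexOrder in
/-- The rotation fields in the directions `Cᵀ z` are already obtained from `z` of the form
`C (ζ̄ c)`, and such a field vanishes only if `C (ζ̄ c) = 0`. Both facts say that, for
`S = C diag(ζ̄)`, the matrix `S^* S` has the image of `S^*` and the kernel of `S`. -/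
theorem rot_transpose_mulVec {n : ℕ} (C : Matrix (Fin n) (Fin n) ℝ) (q : RSpace n) :
    (∀ c : Fin n → ℂ, rot q ((cMat C)ᵀ *ᵥ (cMat C *ᵥ fun k => zbar q k * c k)) = 0 →
      (cMat C *ᵥ fun k => zbar q k * c k) = 0) ∧
    ∀ z, ∃ c : Fin n → ℂ, rot q ((cMat C)ᵀ *ᵥ (cMat C *ᵥ fun k => zbar q k * c k))
      = rot q ((cMat C)ᵀ *ᵥ z) := by
  set S : Matrix (Fin n) (Fin n) ℂ := cMat C * Matrix.diagonal (zbar q) with hS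
  have hSc : ∀ c, S *ᵥ c = cMat C *ᵥ fun k => zbar q k * c k := by
    intro c
    rw [hS, ← Matrix.mulVec_mulVec]
    congr 1
    ext k
    rw [Matrix.mulVec_diagonal]
  have hSH : ∀ w k, (Sᴴ *ᵥ w) k = star (zbar q k) * ((cMat C)ᵀ *ᵥ w) k := by
    intro w k
    rw [hS, Matrix.conjTranspose_mul, ← Matrix.mulVec_mulVec, Matrix.diagonal_conjTranspose,
      Matrix.mulVec_diagonal, cMat_conjTranspose, Pi.star_apply]
  have hrot : ∀ w : Fin n → ℂ, rot q w = 0 ↔ ∀ k, star (zbar q k) * w k = 0 := by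
    intro w
    have hz : ∀ k, star (zbar q k) = q.1 k + q.2 k * Complex.I := by
      intro k
      simp [zbar]
    constructor
    · intro h k
      have h1 : Complex.I * (q.2 k * w k) = 0 := congrFun (congrArg Prod.fst h) k
      have h2 : -(Complex.I * (q.1 k * w k)) = 0 := congrFun (congrArg Prod.snd h) k
      rw [hz]
      linear_combination h1 + Complex.I * h2 + q.1 k * w k * Complex.I_sq
    · intro h
      have h0 : ∀ k, w k = 0 ∨ (q.1 k = 0 ∧ q.2 k = 0) := by
        intro k
        rcases mul_eq_zero.mp (h k) with h1 | h1
        · right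
          rw [hz] at h1
          exact ⟨by simpa using congrArg Complex.re h1, by simpa using congrArg Complex.im h1⟩
        · exact Or.inl h1
      ext k
      · change Complex.I * (q.2 k * w k) = 0
        rcases h0 k with h1 | h1 <;> simp [h1]
      · change -(Complex.I * (q.1 k * w k)) = 0
        rcases h0 k with h1 | h1 <;> simp [h1]
  constructor
  · intro c hc
    rw [← hSc] at hc ⊢
    have h1 : c ∈ LinearMap.ker (Sᴴ * S).mulVecLin := by
      rw [LinearMap.mem_ker, Matrix.mulVecLin_apply, ← Matrix.mulVec_mulVec]
      ext k
      rw [hSH]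
      exact (hrot _).mp hc k
    rw [Matrix.ker_mulVecLin_conjTranspose_mul_self] at h1
    exact h1
  · intro z
    have hle : LinearMap.range (Sᴴ * S).mulVecLin ≤ LinearMap.range Sᴴ.mulVecLin := by
      rw [Matrix.mulVecLin_mul]
      exact LinearMap.range_comp_le_range _ _
    have heq := Submodule.eq_of_le_of_finrank_eq hle
      ((Matrix.rank_conjTranspose_mul_self S).trans (Matrix.rank_conjTranspose S).symm)
    have hz : Sᴴ.mulVecLin z ∈ LinearMap.range (Sᴴ * S).mulVecLin := heq ▸ ⟨z, rfl⟩
    obtain ⟨c, hc⟩ := hz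
    refine ⟨c, ?_⟩
    rw [← sub_eq_zero, ← map_sub, hrot]
    intro k
    have := congrFun hc k
    rw [Matrix.mulVecLin_apply, Matrix.mulVecLin_apply, ← Matrix.mulVec_mulVec, hSH, hSH,
      hSc] at this
    rw [Pi.sub_apply, mul_sub, this, sub_self]

/-- A vector of the model polarization that is a rotation field satisfies `ζ̄ c = dξ = 0`, so that
it is `2 ∑_k c_k ∂/∂ζ_k` and is annihilated by `dζ̄`; a rotation field annihilated by `dζ̄` is zero. -/
theorem disjoint_modelPol_rot {n : ℕ} (K C : Matrix (Fin n) (Fin n) ℝ) (q : RSpace n) :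
    Disjoint (LinearMap.ker ((cMat C).mulVecLin ∘ₗ dXi q) ⊓ modelPol K q)
      (LinearMap.range (rot q ∘ₗ (cMat C)ᵀ.mulVecLin)) := by
  rw [Submodule.disjoint_def]
  rintro _ ⟨-, hu⟩ ⟨z, rfl⟩
  have hu' : (rot q ∘ₗ (cMat C)ᵀ.mulVecLin) z ∈ modelPol K q := hu
  rw [LinearMap.comp_apply] at hu' ⊢
  rw [← range_modelFrame] at hu'
  obtain ⟨c, hc⟩ := hu'
  have h1 := dXi_modelFrame K q c
  rw [hc, dXi_rot] at h1
  have h2 : modelFrame K q c = (c, fun k => -(Complex.I * c k)) + 0 := by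
    change (_ : CSpace n) + rot q _ = _
    rw [← h1, Matrix.mulVec_zero, map_zero]
  rw [add_zero, hc] at h2
  generalize (cMat C)ᵀ.mulVecLin z = w at *
  -- `dζ̄` of the left hand side is `-ζ̄ w`, of the right hand side it vanishes
  have h3 : ∀ k, zbar q k * w k = 0 := by
    intro k
    have e1 : Complex.I * (q.2 k * w k) = c k := congrFun (congrArg Prod.fst h2) k
    have e2 : -(Complex.I * (q.1 k * w k)) = -(Complex.I * c k) :=
      congrFun (congrArg Prod.snd h2) k
    rw [zbar]
    linear_combination -e1 + Complex.I * e2 + (q.1 k * w k - c k) * Complex.I_sq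
  have h4 : ∀ k, w k = 0 ∨ (q.1 k = 0 ∧ q.2 k = 0) := by
    intro k
    rcases mul_eq_zero.mp (h3 k) with h | h
    · right
      rw [zbar] at h
      exact ⟨by simpa using congrArg Complex.re h, by simpa using congrArg Complex.im h⟩
    · exact Or.inl h
  ext k
  · change Complex.I * (q.2 k * w k) = 0
    rcases h4 k with h | h <;> simp [h]
  · change -(Complex.I * (q.1 k * w k)) = 0
    rcases h4 k with h | h <;> simp [h]

/-- The limit of the model polarizations. On a complement of the kernel of `S = C diag(ζ̄)` the
parametrization is divided by `s`, which leaves only the rotation part in the limit. -/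
theorem grTendsto_modelPol {n : ℕ} (K C : Matrix (Fin n) (Fin n) ℝ) (q : RSpace n) :
    GrTendsto (fun s : ℝ => modelPol (K + s • (Cᵀ * C)) q)
      ((LinearMap.ker ((cMat C).mulVecLin ∘ₗ dXi q) ⊓ modelPol K q) ⊔
        LinearMap.range (rot q ∘ₗ (cMat C)ᵀ.mulVecLin)) := by
  obtain ⟨hker, hran⟩ := rot_transpose_mulVec C q
  -- `S c = C (ζ̄ c)`
  set S : (Fin n → ℂ) →ₗ[ℂ] (Fin n → ℂ) :=
    (cMat C).mulVecLin ∘ₗ dXi q ∘ₗ modelFrame K q with hSdef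
  have hS : ∀ c, S c = cMat C *ᵥ fun k => zbar q k * c k := by
    intro c
    rw [hSdef, LinearMap.comp_apply, LinearMap.comp_apply, dXi_modelFrame, Matrix.mulVecLin_apply]
  obtain ⟨π, hπ⟩ := LinearMap.exists_leftInverse_of_injective (LinearMap.ker S).subtype
    (Submodule.ker_subtype _)
  set P : (Fin n → ℂ) →ₗ[ℂ] (Fin n → ℂ) := (LinearMap.ker S).subtype ∘ₗ π with hP
  have hSP : ∀ c, S (P c) = 0 := fun c => (π c).2
  have hPid : ∀ c, S c = 0 → P c = c := by
    intro c hc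
    have := congrArg (fun f => ((f ⟨c, hc⟩ : LinearMap.ker S) : Fin n → ℂ)) hπ
    exact this
  set R : (Fin n → ℂ) →ₗ[ℂ] CSpace n := rot q ∘ₗ (cMat C)ᵀ.mulVecLin with hR
  have hRS : ∀ c, R (S c) = rot q ((cMat C)ᵀ *ᵥ (cMat C *ᵥ fun k => zbar q k * c k)) := by
    intro c
    rw [hS, hR, LinearMap.comp_apply, Matrix.mulVecLin_apply]
  have hRker : ∀ c, R (S c) = 0 → S c = 0 := by
    intro c hc
    rw [hRS] at hc
    rw [hS]
    exact hker c hc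
  have hPmem : ∀ c, modelFrame K q (P c) ∈
      LinearMap.ker ((cMat C).mulVecLin ∘ₗ dXi q) ⊓ modelPol K q :=
    fun c => ⟨hSP c, modelFrame_mem K q _⟩
  let T : ℝ → (Fin n → ℂ) →ₗ[ℂ] (Fin n → ℂ) := fun s => P + (s : ℂ)⁻¹ • (LinearMap.id - P)
  have hT : ∀ s : ℝ, s ≠ 0 → Function.Bijective (T s) := by
    intro s hs
    have hs' : (s : ℂ) ≠ 0 := by exact_mod_cast hs
    have hinj : Function.Injective (T s) := by
      rw [← LinearMap.ker_eq_bot, LinearMap.ker_eq_bot']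
      intro c hc
      have h0 : P c + (s : ℂ)⁻¹ • (c - P c) = 0 := hc
      have h1 : P c = 0 := by
        have h2 := congrArg P h0
        rw [map_add, map_smul, map_sub, hPid _ (hSP c), sub_self, smul_zero, add_zero,
          map_zero] at h2
        exact h2
      rw [h1, zero_add, sub_zero] at h0
      exact (smul_eq_zero.mp h0).resolve_left (inv_ne_zero hs')
    exact ⟨hinj, LinearMap.injective_iff_surjective.mp hinj⟩
  have hTs : ∀ s : ℝ, s ≠ 0 → ∀ c, modelFrame (K + s • (Cᵀ * C)) q (T s c)
      = modelFrame K q (P c) + (s : ℂ)⁻¹ • modelFrame K q (c - P c) + R (S c) := by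
    intro s hs c
    have hs' : (s : ℂ) ≠ 0 := by exact_mod_cast hs
    have h1 : S (T s c) = (s : ℂ)⁻¹ • S c := by
      change S (P c + (s : ℂ)⁻¹ • (c - P c)) = _
      rw [map_add, map_smul, map_sub, hSP, sub_zero, zero_add]
    rw [modelFrame_add_smul, ← hRS, h1, map_smul, smul_smul, mul_inv_cancel₀ hs', one_smul]
    congr 1
    change modelFrame K q (P c + (s : ℂ)⁻¹ • (c - P c)) = _
    rw [map_add, map_smul]
  have hlim : GrTendsto
      (fun s : ℝ => LinearMap.range (modelFrame (K + s • (Cᵀ * C)) q ∘ₗ T s))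
      (LinearMap.range (modelFrame K q ∘ₗ P + R ∘ₗ S)) := by
    refine grTendsto_range ?_ ?_ ?_
    · filter_upwards [Filter.eventually_ne_atTop 0] with s hs
      exact (modelFrame_injective _ q).comp (hT s hs).1
    · rw [← LinearMap.ker_eq_bot, LinearMap.ker_eq_bot']
      intro c hc
      have h0 : modelFrame K q (P c) + R (S c) = 0 := hc
      have h1 : modelFrame K q (P c) = 0 := by
        refine Submodule.disjoint_def.mp (disjoint_modelPol_rot K C q) _ (hPmem c) ?_
        rw [eq_neg_of_add_eq_zero_left h0]
        exact Submodule.neg_mem _ ⟨S c, rfl⟩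
      rw [h1, zero_add] at h0
      rw [← hPid c (hRker c h0)]
      exact modelFrame_injective K q (by rw [h1, map_zero])
    · intro c
      have h1 : Filter.Tendsto (fun s : ℝ => (s : ℂ)⁻¹) Filter.atTop (𝓝 0) := by
        have := (Complex.continuous_ofReal.tendsto 0).comp tendsto_inv_atTop_zero
        simpa [Function.comp_def] using this
      have h2 : Filter.Tendsto (fun s : ℝ => modelFrame K q (P c)
          + (s : ℂ)⁻¹ • modelFrame K q (c - P c) + R (S c)) Filter.atTop
          (𝓝 (modelFrame K q (P c) + (0 : ℂ) • modelFrame K q (c - P c) + R (S c))) :=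
        (tendsto_const_nhds.add (h1.smul_const _)).add tendsto_const_nhds
      rw [zero_smul, add_zero] at h2
      refine h2.congr' ?_
      filter_upwards [Filter.eventually_ne_atTop 0] with s hs
      exact (hTs s hs c).symm
  have hlimit : LinearMap.range (modelFrame K q ∘ₗ P + R ∘ₗ S)
      = (LinearMap.ker ((cMat C).mulVecLin ∘ₗ dXi q) ⊓ modelPol K q) ⊔ LinearMap.range R := by
    apply le_antisymm
    · rintro _ ⟨c, rfl⟩
      exact Submodule.add_mem_sup (hPmem c) ⟨S c, rfl⟩
    · refine sup_le ?_ ?_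
      · rintro u ⟨hu1, hu2⟩
        have hu2' : u ∈ modelPol K q := hu2
        rw [← range_modelFrame] at hu2'
        obtain ⟨c, rfl⟩ := hu2'
        have hc : S c = 0 := hu1
        refine ⟨c, ?_⟩
        change modelFrame K q (P c) + R (S c) = _
        rw [hc, map_zero, add_zero, hPid c hc]
      · rintro _ ⟨z, rfl⟩
        obtain ⟨c, hc⟩ := hran z
        refine ⟨c - P c, ?_⟩
        change modelFrame K q (P (c - P c)) + R (S (c - P c)) = _
        rw [map_sub P, hPid _ (hSP c), sub_self, map_zero, zero_add, map_sub S, hSP, sub_zero, hRS,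
          hc, hR, LinearMap.comp_apply, Matrix.mulVecLin_apply]
  rw [hlimit] at hlim
  refine hlim.congr' ?_
  filter_upwards [Filter.eventually_ne_atTop 0] with s hs
  rw [LinearMap.range_comp_of_range_eq_top _ (LinearMap.range_eq_top.mpr (hT s hs).2),
    range_modelFrame]

/-! ### The holomorphic tangent space in action-angle coordinates -/

theorem mem_toricT10 {n : ℕ} {g : (Fin n → ℝ) → ℝ} {y : RSpace n}
    (hG : (hessian g y.1).PosDef) {w : CSpace n} :
    w ∈ toricT10 g y ↔ cMat (hessian g y.1) *ᵥ w.1 = Complex.I • w.2 := by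
  have hdet : IsUnit (hessian g y.1).det := (hG.det_pos.ne').isUnit
  rw [toricT10, Module.End.mem_eigenspace_iff]
  change ((-(cMat (hessian g y.1)⁻¹ *ᵥ w.2), cMat (hessian g y.1) *ᵥ w.1) : CSpace n)
    = Complex.I • w ↔ _
  constructor
  · intro h
    exact congrArg Prod.snd h
  · intro h
    refine Prod.ext ?_ h
    change -(cMat (hessian g y.1)⁻¹ *ᵥ w.2) = Complex.I • w.1
    have h1 : w.1 = Complex.I • (cMat (hessian g y.1)⁻¹ *ᵥ w.2) := by
      rw [← Matrix.mulVec_smul, ← h, Matrix.mulVec_mulVec, ← cMat_mul,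
        Matrix.nonsing_inv_mul _ hdet, cMat_one, Matrix.one_mulVec]
    rw [h1, smul_smul, Complex.I_mul_I, neg_one_smul]

namespace DelzantPolytope

variable {n : ℕ} {Δ : DelzantPolytope n}

/-! ### Action-angle coordinates in the chart at a vertex -/

theorem Vertex.contDiff_moment (v : Δ.Vertex) : ContDiff ℝ ∞ v.moment := by
  unfold Vertex.moment
  refine contDiff_pi.mpr fun i => ?_
  simp only [Matrix.mulVec, dotProduct]
  fun_prop

theorem Vertex.isOpen_domain (v : Δ.Vertex) : IsOpen v.domain :=
  v.isOpen_nearby.preimage v.contDiff_moment.continuous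

/-- The part of the chart at a vertex that lies in the open orbit. -/
def Vertex.chartInterior (v : Δ.Vertex) : Set (RSpace n) :=
  {q | q ∈ v.domain ∧ ∀ k, q.1 k ^ 2 + q.2 k ^ 2 ≠ 0}

theorem Vertex.isOpen_chartInterior (v : Δ.Vertex) : IsOpen v.chartInterior := by
  have : v.chartInterior = v.domain ∩ ⋂ k, {q | q.1 k ^ 2 + q.2 k ^ 2 ≠ 0} := by
    ext q
    simp [chartInterior]
  rw [this]
  exact v.isOpen_domain.inter (isOpen_iInter_of_finite fun k =>
    isOpen_ne_fun (by fun_prop) continuous_const)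

theorem Vertex.moment_mem_inside (v : Δ.Vertex) {q : RSpace n} (hq : q ∈ v.chartInterior) :
    v.moment q ∈ Δ.inside := by
  intro r
  by_cases hr : r ∈ Set.range v.facet
  · obtain ⟨k, rfl⟩ := hr
    rw [v.l_moment]
    have := hq.2 k
    positivity
  · exact hq.1 r hr

theorem Vertex.ofActionAngle_sq (v : Δ.Vertex) {y : RSpace n} (hy : y ∈ Δ.actionAngle)
    (k : Fin n) : (v.ofActionAngle y).1 k ^ 2 + (v.ofActionAngle y).2 k ^ 2
      = 2 * Δ.l (v.facet k) y.1 := by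
  have hpos : 0 < Δ.l (v.facet k) y.1 := hy _
  simp only [ofActionAngle]
  rw [mul_pow, mul_pow, ← mul_add, Real.cos_sq_add_sin_sq, mul_one,
    Real.sq_sqrt (by positivity)]

theorem Vertex.moment_ofActionAngle (v : Δ.Vertex) {y : RSpace n} (hy : y ∈ Δ.actionAngle) :
    v.moment (v.ofActionAngle y) = y.1 := by
  have h : (fun k => ((v.ofActionAngle y).1 k ^ 2 + (v.ofActionAngle y).2 k ^ 2) / 2
      - Δ.lam (v.facet k)) = v.mat *ᵥ y.1 := by
    ext k
    rw [v.ofActionAngle_sq hy, v.l_facet]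
    ring
  rw [moment, h, Matrix.mulVec_mulVec, v.inv_mul_mat, Matrix.one_mulVec]

theorem Vertex.ofActionAngle_mem (v : Δ.Vertex) {y : RSpace n} (hy : y ∈ Δ.actionAngle) :
    v.ofActionAngle y ∈ v.chartInterior := by
  refine ⟨fun r _ => ?_, fun k => ?_⟩
  · rw [v.moment_ofActionAngle hy]
    exact hy r
  · rw [v.ofActionAngle_sq hy]
    have : 0 < Δ.l (v.facet k) y.1 := hy _
    positivity

/-- Every point of the open orbit has action-angle coordinates. -/
theorem Vertex.exists_actionAngle (v : Δ.Vertex) {q : RSpace n} (hq : q ∈ v.chartInterior) :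
    ∃ y ∈ Δ.actionAngle, v.ofActionAngle y = q := by
  refine ⟨(v.moment q, v.matᵀ *ᵥ fun k => Complex.arg ⟨q.1 k, q.2 k⟩), v.moment_mem_inside hq, ?_⟩
  have hT : v.mat⁻¹ᵀ * v.matᵀ = 1 := by
    rw [← Matrix.transpose_mul, v.mat_mul_inv, Matrix.transpose_one]
  have hnorm : ∀ k, Real.sqrt (2 * Δ.l (v.facet k) (v.moment q)) = ‖(⟨q.1 k, q.2 k⟩ : ℂ)‖ := by
    intro k
    rw [v.l_moment, Complex.norm_def, Complex.normSq_mk]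
    congr 1
    ring
  simp only [ofActionAngle, Matrix.mulVec_mulVec, hT, Matrix.one_mulVec, hnorm]
  ext k
  · exact Complex.norm_mul_cos_arg _
  · exact Complex.norm_mul_sin_arg _

theorem Vertex.image_ofActionAngle (v : Δ.Vertex) :
    v.ofActionAngle '' Δ.actionAngle = v.chartInterior := by
  ext q
  constructor
  · rintro ⟨y, hy, rfl⟩
    exact v.ofActionAngle_mem hy
  · exact v.exists_actionAngle

/-- The open orbit is dense in every chart. -/
theorem Vertex.neBot_chartInterior (v : Δ.Vertex) {q : RSpace n} (hq : q ∈ v.domain) :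
    (𝓝[v.chartInterior] q).NeBot := by
  -- move every coordinate `a_k` away from zero
  let γ : ℝ → RSpace n := fun t => (fun k => if 0 ≤ q.1 k then q.1 k + t else q.1 k - t, q.2)
  have hγ : Continuous γ := by
    refine Continuous.prodMk (continuous_pi fun k => ?_) continuous_const
    by_cases h : 0 ≤ q.1 k
    · simp only [h, if_true]; fun_prop
    · simp only [h, if_false]; fun_prop
  have hγ0 : γ 0 = q := by
    ext k <;> simp [γ]
  have hlim : Filter.Tendsto γ (𝓝[>] 0) (𝓝[v.chartInterior] q) := by
    refine tendsto_nhdsWithin_iff.mpr ⟨?_, ?_⟩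
    · have := hγ.tendsto 0
      rw [hγ0] at this
      exact this.mono_left nhdsWithin_le_nhds
    · have hdom : ∀ᶠ t in 𝓝[>] 0, γ t ∈ v.domain := by
        have h1 : v.domain ∈ 𝓝 (γ 0) := v.isOpen_domain.mem_nhds (hγ0 ▸ hq)
        exact nhdsWithin_le_nhds (hγ.tendsto 0 h1)
      filter_upwards [hdom, self_mem_nhdsWithin] with t ht ht0
      refine ⟨ht, fun k => ?_⟩
      have ht0' : 0 < t := ht0
      have : (γ t).1 k ≠ 0 := by
        by_cases h : 0 ≤ q.1 k
        · simp only [γ, h, if_true]; positivity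
        · simp only [γ, h, if_false]; linarith
      positivity
  exact hlim.neBot

/-- The push forward of tangent vectors from action-angle coordinates to the chart at `v`, in terms
of the point `q` of the chart: `∂/∂x_v^k` and `∂/∂θ_v^k` go to the radial field
`(a_k ∂/∂a_k + b_k ∂/∂b_k) / |ζ_k|²` and to the rotation field. -/
def Vertex.frameMap (v : Δ.Vertex) (q : RSpace n) : CSpace n →ₗ[ℂ] CSpace n where
  toFun w :=
    (fun k => (q.1 k * ((q.1 k ^ 2 + q.2 k ^ 2)⁻¹ : ℝ)) * (cMat v.mat *ᵥ w.1) k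
        - q.2 k * (cMat v.mat⁻¹ᵀ *ᵥ w.2) k,
      fun k => (q.2 k * ((q.1 k ^ 2 + q.2 k ^ 2)⁻¹ : ℝ)) * (cMat v.mat *ᵥ w.1) k
        + q.1 k * (cMat v.mat⁻¹ᵀ *ᵥ w.2) k)
  map_add' u w := by
    ext k <;> simp only [Prod.fst_add, Prod.snd_add, Pi.add_apply, Matrix.mulVec_add] <;> ring
  map_smul' c u := by
    ext k <;> simp only [Prod.smul_fst, Prod.smul_snd, Pi.smul_apply, smul_eq_mul,
      Matrix.mulVec_smul, RingHom.id_apply] <;> ring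

theorem Vertex.frameMap_fst (v : Δ.Vertex) (q : RSpace n) (w : CSpace n) (k : Fin n) :
    (v.frameMap q w).1 k = (q.1 k * ((q.1 k ^ 2 + q.2 k ^ 2)⁻¹ : ℝ)) * (cMat v.mat *ᵥ w.1) k
        - q.2 k * (cMat v.mat⁻¹ᵀ *ᵥ w.2) k := rfl

theorem Vertex.frameMap_snd (v : Δ.Vertex) (q : RSpace n) (w : CSpace n) (k : Fin n) :
    (v.frameMap q w).2 k = (q.2 k * ((q.1 k ^ 2 + q.2 k ^ 2)⁻¹ : ℝ)) * (cMat v.mat *ᵥ w.1) k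
        + q.1 k * (cMat v.mat⁻¹ᵀ *ᵥ w.2) k := rfl

theorem cMat_mulVec_ofReal (A : Matrix (Fin n) (Fin n) ℝ) (u : Fin n → ℝ) (k : Fin n) :
    (cMat A *ᵥ fun i => (u i : ℂ)) k = ((A *ᵥ u) k : ℝ) := by
  simp [Matrix.mulVec, dotProduct, cMat]

theorem Vertex.exists_hasFDerivAt_ofActionAngle (v : Δ.Vertex) {y : RSpace n}
    (hy : y ∈ Δ.actionAngle) : ∃ L : RSpace n →L[ℝ] RSpace n, HasFDerivAt v.ofActionAngle L y ∧
      ∀ u, v.frameMap (v.ofActionAngle y) (toC n u) = toC n (L u) := by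
  have hpos : ∀ k, 0 < 2 * Δ.l (v.facet k) y.1 := fun k => by
    have : 0 < Δ.l (v.facet k) y.1 := hy _
    positivity
  let φ : Fin n → RSpace n →L[ℝ] ℝ := fun k => LinearMap.toContinuousLinearMap
    (LinearMap.proj k ∘ₗ v.mat⁻¹ᵀ.mulVecLin ∘ₗ LinearMap.snd ℝ (Fin n → ℝ) (Fin n → ℝ))
  have hφ : ∀ k, HasFDerivAt (fun y : RSpace n => (v.mat⁻¹ᵀ *ᵥ y.2) k) (φ k) y :=
    fun k => (φ k).hasFDerivAt
  let ψ : Fin n → RSpace n →L[ℝ] ℝ := fun k => LinearMap.toContinuousLinearMap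
    (LinearMap.proj k ∘ₗ v.mat.mulVecLin ∘ₗ LinearMap.fst ℝ (Fin n → ℝ) (Fin n → ℝ))
  have hψ : ∀ k, HasFDerivAt (fun y : RSpace n => 2 * Δ.l (v.facet k) y.1) ((2 : ℝ) • ψ k) y := by
    intro k
    simp only [v.l_facet]
    exact ((ψ k).hasFDerivAt.add_const _).const_mul 2
  have hs := fun k => (hψ k).sqrt (hpos k).ne'
  have h1 := fun k => (hs k).mul (hφ k).cos
  have h2 := fun k => (hs k).mul (hφ k).sin
  refine ⟨_, (hasFDerivAt_pi.mpr h1).prodMk (hasFDerivAt_pi.mpr h2), fun u => ?_⟩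
  have hinv : ∀ k, ((v.ofActionAngle y).1 k ^ 2 + (v.ofActionAngle y).2 k ^ 2)⁻¹
      = (Real.sqrt (2 * Δ.l (v.facet k) y.1))⁻¹ * (Real.sqrt (2 * Δ.l (v.facet k) y.1))⁻¹ := by
    intro k
    rw [v.ofActionAngle_sq hy, ← mul_inv, Real.mul_self_sqrt (hpos k).le]
  have hsq : ∀ k, Real.sqrt (2 * Δ.l (v.facet k) y.1) ≠ 0 := fun k =>
    (Real.sqrt_pos.mpr (hpos k)).ne'
  have e1 : ∀ k, (cMat v.mat *ᵥ (toC n u).1) k = ((v.mat *ᵥ u.1) k : ℝ) :=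
    fun k => cMat_mulVec_ofReal _ _ _
  have e2 : ∀ k, (cMat v.mat⁻¹ᵀ *ᵥ (toC n u).2) k = ((v.mat⁻¹ᵀ *ᵥ u.2) k : ℝ) :=
    fun k => cMat_mulVec_ofReal _ _ _
  ext k
  · rw [v.frameMap_fst, e1, e2, hinv]
    change _ = (((Real.sqrt (2 * Δ.l (v.facet k) y.1)) *
      (-Real.sin ((v.mat⁻¹ᵀ *ᵥ y.2) k) * (v.mat⁻¹ᵀ *ᵥ u.2) k)
      + Real.cos ((v.mat⁻¹ᵀ *ᵥ y.2) k) *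
        (1 / (2 * Real.sqrt (2 * Δ.l (v.facet k) y.1)) * (2 * (v.mat *ᵥ u.1) k)) : ℝ) : ℂ)
    have := hsq k
    simp only [ofActionAngle]
    norm_cast
    field_simp
    ring
  · rw [v.frameMap_snd, e1, e2, hinv]
    change _ = (((Real.sqrt (2 * Δ.l (v.facet k) y.1)) *
      (Real.cos ((v.mat⁻¹ᵀ *ᵥ y.2) k) * (v.mat⁻¹ᵀ *ᵥ u.2) k)
      + Real.sin ((v.mat⁻¹ᵀ *ᵥ y.2) k) *
        (1 / (2 * Real.sqrt (2 * Δ.l (v.facet k) y.1)) * (2 * (v.mat *ᵥ u.1) k)) : ℝ) : ℂ)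
    have := hsq k
    simp only [ofActionAngle]
    norm_cast
    field_simp
    ring

theorem Vertex.differentiableAt_ofActionAngle (v : Δ.Vertex) {y : RSpace n}
    (hy : y ∈ Δ.actionAngle) : DifferentiableAt ℝ v.ofActionAngle y := by
  obtain ⟨L, hL, -⟩ := v.exists_hasFDerivAt_ofActionAngle hy
  exact hL.differentiableAt

theorem Vertex.pushC_ofActionAngle (v : Δ.Vertex) {y : RSpace n} (hy : y ∈ Δ.actionAngle) :
    pushC v.ofActionAngle y = v.frameMap (v.ofActionAngle y) := by
  obtain ⟨L, hL, h⟩ := v.exists_hasFDerivAt_ofActionAngle hy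
  exact pushC_eq hL h

theorem Vertex.sq_ne_zero (v : Δ.Vertex) {q : RSpace n} (hq : q ∈ v.chartInterior) (k : Fin n) :
    ((q.1 k : ℂ) ^ 2 + (q.2 k : ℂ) ^ 2) ≠ 0 := by
  exact_mod_cast hq.2 k

theorem Vertex.dXi_frameMap (v : Δ.Vertex) {q : RSpace n} (hq : q ∈ v.chartInterior)
    (w : CSpace n) : dXi q (v.frameMap q w) = cMat v.mat *ᵥ w.1 := by
  ext k
  have := v.sq_ne_zero hq k
  rw [dXi_apply, v.frameMap_fst, v.frameMap_snd]
  push_cast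
  field_simp
  ring

/-- The action-angle coordinates are Darboux coordinates. -/
theorem Vertex.omega_frameMap (v : Δ.Vertex) {q : RSpace n} (hq : q ∈ v.chartInterior)
    (u w : CSpace n) : omega (v.frameMap q u) (v.frameMap q w) = omega u w := by
  have h : ∀ a b : Fin n → ℂ, (cMat v.mat *ᵥ a) ⬝ᵥ (cMat v.mat⁻¹ᵀ *ᵥ b) = a ⬝ᵥ b := by
    intro a b
    rw [Matrix.dotProduct_mulVec, cMat_transpose, Matrix.vecMul_transpose, Matrix.mulVec_mulVec,
      ← cMat_mul, v.inv_mul_mat, cMat_one, Matrix.one_mulVec]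
  have h2 : omega u w = (cMat v.mat *ᵥ u.1) ⬝ᵥ (cMat v.mat⁻¹ᵀ *ᵥ w.2)
      - (cMat v.mat *ᵥ w.1) ⬝ᵥ (cMat v.mat⁻¹ᵀ *ᵥ u.2) := by
    rw [h, h, omega, dotProduct, dotProduct, ← Finset.sum_sub_distrib]
    exact Finset.sum_congr rfl fun k _ => by ring
  rw [h2, dotProduct, dotProduct, ← Finset.sum_sub_distrib, omega]
  refine Finset.sum_congr rfl fun k _ => ?_
  have := v.sq_ne_zero hq k
  rw [v.frameMap_fst, v.frameMap_snd, v.frameMap_fst, v.frameMap_snd]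
  push_cast
  field_simp
  ring

theorem Vertex.frameMap_injective (v : Δ.Vertex) {q : RSpace n} (hq : q ∈ v.chartInterior) :
    Function.Injective (v.frameMap q) := by
  rw [← LinearMap.ker_eq_bot, LinearMap.ker_eq_bot']
  intro u hu
  refine eq_zero_of_omega fun w => ?_
  rw [← v.omega_frameMap hq, hu]
  simp [omega]

theorem Vertex.frameMap_surjective (v : Δ.Vertex) {q : RSpace n} (hq : q ∈ v.chartInterior) :
    Function.Surjective (v.frameMap q) :=
  LinearMap.injective_iff_surjective.mp (v.frameMap_injective hq)

theorem conj_cMat_mulVec (A : Matrix (Fin n) (Fin n) ℝ) (w : Fin n → ℂ) (k : Fin n) :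
    starRingEnd ℂ ((cMat A *ᵥ w) k) = (cMat A *ᵥ fun i => starRingEnd ℂ (w i)) k := by
  simp [Matrix.mulVec, dotProduct, cMat]

theorem Vertex.conjVec_frameMap (v : Δ.Vertex) (q : RSpace n) (w : CSpace n) :
    conjVec (v.frameMap q w) = v.frameMap q (conjVec w) := by
  ext k
  · change starRingEnd ℂ ((v.frameMap q w).1 k) = _
    rw [v.frameMap_fst, v.frameMap_fst]
    simp only [map_sub, map_mul, Complex.conj_ofReal, conj_cMat_mulVec]
    rfl
  · change starRingEnd ℂ ((v.frameMap q w).2 k) = _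
    rw [v.frameMap_snd, v.frameMap_snd]
    simp only [map_add, map_mul, Complex.conj_ofReal, conj_cMat_mulVec]
    rfl

/-- On the open orbit, the forms of the model polarization are combinations of the components of
`G dx - i dθ`: the singular part `(2 ℓ_k)⁻¹` of the Hessian accounts for `dζ̄_j`. -/
theorem Vertex.modelForm_frameMap (v : Δ.Vertex) {g h : (Fin n → ℝ) → ℝ} (hh : ContDiff ℝ ∞ h)
    (hg : ∀ x ∈ Δ.inside, g x = Δ.guillemin x + h x) {q : RSpace n} (hq : q ∈ v.chartInterior)
    (w : CSpace n) (j : Fin n) : modelForm (v.curv h (v.moment q)) q (v.frameMap q w) j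
      = zbar q j * (cMat v.mat⁻¹ᵀ *ᵥ
        (cMat (hessian g (v.moment q)) *ᵥ w.1 - Complex.I • w.2)) j := by
  have hT : v.mat⁻¹ᵀ * v.matᵀ = 1 := by
    rw [← Matrix.transpose_mul, v.mat_mul_inv, Matrix.transpose_one]
  have hH : v.mat⁻¹ᵀ * hessian g (v.moment q) = (v.curv h (v.moment q)
      + Matrix.diagonal fun k => (2 * Δ.l (v.facet k) (v.moment q))⁻¹) * v.mat := by
    rw [v.hessian_potential hh hg (v.moment_mem_inside hq), ← Matrix.mul_assoc, ← Matrix.mul_assoc,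
      hT, Matrix.one_mul]
  have hdiag : (cMat (Matrix.diagonal fun k => (2 * Δ.l (v.facet k) (v.moment q))⁻¹)
      *ᵥ (cMat v.mat *ᵥ w.1)) j
      = ((q.1 j ^ 2 + q.2 j ^ 2)⁻¹ : ℝ) * (cMat v.mat *ᵥ w.1) j := by
    have : cMat (Matrix.diagonal fun k => (2 * Δ.l (v.facet k) (v.moment q))⁻¹)
        = Matrix.diagonal fun k => (((2 * Δ.l (v.facet k) (v.moment q))⁻¹ : ℝ) : ℂ) := by
      ext i k
      rw [cMat, Matrix.map_apply, Matrix.diagonal_apply, Matrix.diagonal_apply]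
      split_ifs <;> simp
    rw [this, Matrix.mulVec_diagonal, v.l_moment]
    congr 4
    ring
  have hG : cMat v.mat⁻¹ᵀ *ᵥ (cMat (hessian g (v.moment q)) *ᵥ w.1)
      = cMat (v.curv h (v.moment q)) *ᵥ (cMat v.mat *ᵥ w.1)
        + cMat (Matrix.diagonal fun k => (2 * Δ.l (v.facet k) (v.moment q))⁻¹)
          *ᵥ (cMat v.mat *ᵥ w.1) := by
    rw [Matrix.mulVec_mulVec, ← cMat_mul, hH, cMat_mul, ← Matrix.mulVec_mulVec, cMat_add,
      Matrix.add_mulVec]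
  rw [modelForm_apply, v.dXi_frameMap hq, Matrix.mulVec_sub, hG, Matrix.mulVec_smul,
    Pi.sub_apply, Pi.add_apply, hdiag, Pi.smul_apply, smul_eq_mul, v.frameMap_fst, v.frameMap_snd,
    zbar]
  linear_combination (-(q.2 j * (cMat v.mat⁻¹ᵀ *ᵥ w.2) j)) * Complex.I_sq

theorem zbar_ne_zero {q : RSpace n} {k : Fin n} (h : q.1 k ^ 2 + q.2 k ^ 2 ≠ 0) :
    zbar q k ≠ 0 := by
  intro h0
  rw [zbar] at h0
  have h1 : q.1 k = 0 := by simpa using congrArg Complex.re h0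
  have h2 : q.2 k = 0 := by simpa using congrArg Complex.im h0
  exact h (by rw [h1, h2]; norm_num)

theorem Vertex.frameMap_mem_modelPol (v : Δ.Vertex) {g h : (Fin n → ℝ) → ℝ} (hh : ContDiff ℝ ∞ h)
    (hg : ∀ x ∈ Δ.inside, g x = Δ.guillemin x + h x) {q : RSpace n} (hq : q ∈ v.chartInterior)
    (w : CSpace n) : v.frameMap q w ∈ modelPol (v.curv h (v.moment q)) q ↔
      cMat (hessian g (v.moment q)) *ᵥ w.1 = Complex.I • w.2 := by
  rw [mem_modelPol, ← sub_eq_zero]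
  constructor
  · intro h1
    have h2 : cMat v.mat⁻¹ᵀ *ᵥ (cMat (hessian g (v.moment q)) *ᵥ w.1 - Complex.I • w.2) = 0 := by
      ext j
      have h3 := h1 j
      rw [v.modelForm_frameMap hh hg hq] at h3
      exact (mul_eq_zero.mp h3).resolve_left (zbar_ne_zero (hq.2 j))
    have h4 := congrArg (fun z => cMat v.matᵀ *ᵥ z) h2
    simpa only [Matrix.mulVec_mulVec, ← cMat_mul, ← Matrix.transpose_mul, v.inv_mul_mat,
      Matrix.transpose_one, cMat_one, Matrix.one_mulVec, Matrix.mulVec_zero] using h4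
  · intro h1 j
    rw [v.modelForm_frameMap hh hg hq, h1]
    simp

/-- A potential `g = g_P + h` with positive definite Hessian, for which the Hermitian form of the
polarization is positive definite also at the points outside the open orbit. -/
structure IsAdmissible (Δ : DelzantPolytope n) (g h : (Fin n → ℝ) → ℝ) : Prop where
  smooth : ContDiff ℝ ∞ h
  eq : ∀ x ∈ Δ.inside, g x = Δ.guillemin x + h x
  posDef : ∀ x ∈ Δ.inside, (hessian g x).PosDef
  pos : ∀ (v : Δ.Vertex), ∀ q ∈ v.domain, ∀ c : Fin n → ℂ, c ≠ 0 →
    0 < (star c ⬝ᵥ c + star (fun k => zbar q k * c k) ⬝ᵥ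
      (cMat (v.curv h (v.moment q)) *ᵥ fun k => zbar q k * c k)).re

theorem IsAdmissible.map_toricT10 {g h : (Fin n → ℝ) → ℝ} (H : Δ.IsAdmissible g h)
    (v : Δ.Vertex) {y : RSpace n} (hy : y ∈ Δ.actionAngle) :
    (toricT10 g y).map (pushC v.ofActionAngle y)
      = modelPol (v.curv h (v.moment (v.ofActionAngle y))) (v.ofActionAngle y) := by
  have hq := v.ofActionAngle_mem hy
  rw [v.pushC_ofActionAngle hy]
  ext u
  obtain ⟨w, rfl⟩ := v.frameMap_surjective hq u
  rw [v.frameMap_mem_modelPol H.smooth H.eq hq, v.moment_ofActionAngle hy,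
    ← mem_toricT10 (H.posDef y.1 hy)]
  constructor
  · rintro ⟨w', hw', h⟩
    rwa [← v.frameMap_injective hq h]
  · intro h
    exact ⟨w, h, rfl⟩

theorem Vertex.continuousAt_cMat_curv (v : Δ.Vertex) {h : (Fin n → ℝ) → ℝ} (hh : ContDiff ℝ ∞ h)
    {q : RSpace n} (hq : q ∈ v.domain) :
    ContinuousAt (fun q' => cMat (v.curv h (v.moment q'))) q := by
  refine continuousAt_pi.mpr fun i => continuousAt_pi.mpr fun j => ?_
  have h1 : ContinuousAt (fun x => v.curv h x i j) (v.moment q) :=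
    (v.contDiffOn_curv hh i j).continuousOn.continuousAt (v.isOpen_nearby.mem_nhds hq)
  exact Complex.continuous_ofReal.continuousAt.comp
    (ContinuousAt.comp (f := v.moment) h1 v.contDiff_moment.continuous.continuousAt)

theorem continuous_zbar (k : Fin n) : Continuous fun q : RSpace n => zbar q k := by
  unfold zbar
  fun_prop

theorem Vertex.continuousAt_modelFrame (v : Δ.Vertex) {h : (Fin n → ℝ) → ℝ} (hh : ContDiff ℝ ∞ h)
    {q : RSpace n} (hq : q ∈ v.domain) (c : Fin n → ℂ) :
    ContinuousAt (fun q' => modelFrame (v.curv h (v.moment q')) q' c) q := by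
  have h1 : ContinuousAt (fun q' => cMat (v.curv h (v.moment q')) *ᵥ fun k => zbar q' k * c k) q :=
    ContinuousAt.comp₂ (f := fun p : Matrix (Fin n) (Fin n) ℂ × (Fin n → ℂ) => p.1 *ᵥ p.2)
      (Continuous.continuousAt (by fun_prop)) (v.continuousAt_cMat_curv hh hq)
      (continuousAt_pi.mpr fun k => ((continuous_zbar k).mul continuous_const).continuousAt)
  have h2 := fun k => continuousAt_pi.mp h1 k
  have e1 : ∀ k, Continuous fun q' : RSpace n => (q'.1 k : ℂ) := fun k => by fun_prop
  have e2 : ∀ k, Continuous fun q' : RSpace n => (q'.2 k : ℂ) := fun k => by fun_prop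
  refine ContinuousAt.prodMk (continuousAt_pi.mpr fun k => ?_) (continuousAt_pi.mpr fun k => ?_)
  · exact continuousAt_const.add (continuousAt_const.mul ((e2 k).continuousAt.mul (h2 k)))
  · exact continuousAt_const.add (continuousAt_const.mul ((e1 k).continuousAt.mul (h2 k))).neg

theorem Vertex.tendsto_modelForm (v : Δ.Vertex) {h : (Fin n → ℝ) → ℝ} (hh : ContDiff ℝ ∞ h)
    {X : Type*} {F : Filter X} {q : RSpace n} (hq : q ∈ v.domain) {Q : X → RSpace n}
    {U : X → CSpace n} {u : CSpace n} (hQ : Filter.Tendsto Q F (𝓝 q))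
    (hU : Filter.Tendsto U F (𝓝 u)) (j : Fin n) :
    Filter.Tendsto (fun t => modelForm (v.curv h (v.moment (Q t))) (Q t) (U t) j) F
      (𝓝 (modelForm (v.curv h (v.moment q)) q u j)) := by
  have hK : ∀ k, Filter.Tendsto (fun t => cMat (v.curv h (v.moment (Q t))) j k) F
      (𝓝 (cMat (v.curv h (v.moment q)) j k)) := fun k =>
    (continuousAt_pi.mp (continuousAt_pi.mp (v.continuousAt_cMat_curv hh hq) j) k).tendsto.comp hQ
  have hd : ∀ k, Filter.Tendsto (fun t => dXi (Q t) (U t) k) F (𝓝 (dXi q u k)) := by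
    intro k
    have hc : Continuous fun p : RSpace n × CSpace n => dXi p.1 p.2 k := by
      simp only [dXi_apply]
      fun_prop
    have hp := (hc.tendsto (q, u)).comp (hQ.prodMk_nhds hU)
    simpa only [Function.comp_def] using hp
  have h2 : Filter.Tendsto (fun t => (cMat (v.curv h (v.moment (Q t))) *ᵥ dXi (Q t) (U t)) j) F
      (𝓝 ((cMat (v.curv h (v.moment q)) *ᵥ dXi q u) j)) := by
    have hs := tendsto_finsetSum Finset.univ fun k _ => (hK k).mul (hd k)
    simpa only [Matrix.mulVec, dotProduct] using hs
  have h3 : Continuous fun w : CSpace n => w.1 j - Complex.I * w.2 j := by fun_prop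
  have h4 := ((h3.tendsto u).comp hU).add ((((continuous_zbar j).tendsto q).comp hQ).mul h2)
  simpa only [Function.comp_def, modelForm_apply] using h4

/-- The extension by continuity of `T^{1,0}` to the chart at a vertex is the model polarization. -/
theorem IsAdmissible.kahlerPol_eq {g h : (Fin n → ℝ) → ℝ} (H : Δ.IsAdmissible g h)
    (v : Δ.Vertex) {q : RSpace n} (hq : q ∈ v.domain) :
    Δ.kahlerPol g v q = modelPol (v.curv h (v.moment q)) q := by
  have hne := v.neBot_chartInterior hq
  ext u
  change (∃ U : RSpace n → CSpace n, (∀ y ∈ Δ.actionAngle,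
        U (v.ofActionAngle y) ∈ (toricT10 g y).map (pushC v.ofActionAngle y)) ∧
      Filter.Tendsto U (𝓝[v.ofActionAngle '' Δ.actionAngle] q) (𝓝 u)) ↔ _
  rw [v.image_ofActionAngle]
  constructor
  · rintro ⟨U, hU, hlim⟩
    refine mem_modelPol.mpr fun j => ?_
    have h1 := v.tendsto_modelForm H.smooth hq
      (Filter.tendsto_id.mono_left (nhdsWithin_le_nhds (s := v.chartInterior))) hlim j
    refine tendsto_nhds_unique h1 (tendsto_const_nhds.congr' ?_)
    filter_upwards [self_mem_nhdsWithin] with q' hq'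
    obtain ⟨y, hy, rfl⟩ := v.exists_actionAngle hq'
    have := hU y hy
    rw [H.map_toricT10 v hy] at this
    exact (mem_modelPol.mp this j).symm
  · intro hu
    rw [← range_modelFrame] at hu
    obtain ⟨c, rfl⟩ := hu
    refine ⟨fun q' => modelFrame (v.curv h (v.moment q')) q' c, fun y hy => ?_,
      (v.continuousAt_modelFrame H.smooth hq c).tendsto.mono_left nhdsWithin_le_nhds⟩
    rw [H.map_toricT10 v hy]
    exact modelFrame_mem _ _ _

end DelzantPolytope

namespace DelzantPolytope

variable {n : ℕ} {Δ : DelzantPolytope n}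

/-! ### The open orbit and the changes of charts -/

theorem circleExp_sum (m : Fin n → ℤ) (θ : Fin n → ℝ) :
    Circle.exp (∑ j, (m j : ℝ) * θ j) = ∏ j, Circle.exp (θ j) ^ m j := by
  have h : ∀ S : Finset (Fin n),
      Circle.exp (∑ j ∈ S, (m j : ℝ) * θ j) = ∏ j ∈ S, Circle.exp (θ j) ^ m j := by
    intro S
    induction S using Finset.induction_on with
    | empty => simp
    | insert a S ha ih =>
      rw [Finset.sum_insert ha, Finset.prod_insert ha, Circle.exp_add, ih, ← zsmul_eq_mul,
        Circle.exp_zsmul]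
  exact h Finset.univ

theorem Vertex.mat_inv_apply (v : Δ.Vertex) (j k : Fin n) :
    v.mat⁻¹ j k = (((Matrix.of fun k => Δ.normal (v.facet k))⁻¹ j k : ℤ) : ℝ) := by
  have h : v.mat⁻¹ = (Matrix.of fun k => Δ.normal (v.facet k))⁻¹.map (Int.castRingHom ℝ) := by
    refine Matrix.inv_eq_left_inv ?_
    change _ * (Matrix.of fun k => Δ.normal (v.facet k)).map (Int.castRingHom ℝ) = 1
    rw [← Matrix.map_mul, Matrix.nonsing_inv_mul _ v.unimodular]
    simp
  rw [h]
  rfl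

/-- The phases of the coordinates `z_r` of the point with action-angle coordinates `y` that
represents it in the slice of the chart at `v`. -/
def Vertex.phase (v : Δ.Vertex) (y : RSpace n) : Fin Δ.d → Circle :=
  Function.extend v.facet (fun k => Circle.exp ((v.mat⁻¹ᵀ *ᵥ y.2) k)) fun _ => 1

theorem Vertex.slice_ofActionAngle (v : Δ.Vertex) {y : RSpace n} (hy : y ∈ Δ.actionAngle)
    (r : Fin Δ.d) : v.slice (v.ofActionAngle y) r
      = (Real.sqrt (2 * Δ.l r y.1) : ℂ) * (v.phase y r : ℂ) := by
  by_cases hr : r ∈ Set.range v.facet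
  · obtain ⟨k, rfl⟩ := hr
    rw [slice, v.injective.extend_apply, phase, v.injective.extend_apply, Circle.coe_exp,
      Complex.exp_mul_I]
    apply Complex.ext
    · simp [ofActionAngle, ← Complex.ofReal_cos, ← Complex.ofReal_sin]
    · simp [ofActionAngle, ← Complex.ofReal_cos, ← Complex.ofReal_sin]
  · rw [slice, Function.extend_apply' _ _ _ hr, phase, Function.extend_apply' _ _ _ hr,
      v.moment_ofActionAngle hy]
    simp

/-- The phases determine the angles modulo `2π`, through the characters `∏_r z_r^{ν_r}` of `T^d` that
are trivial on the kernel torus. -/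
theorem Vertex.prod_phase (v : Δ.Vertex) (y : RSpace n) (i : Fin n) :
    ∏ r, v.phase y r ^ Δ.normal r i = Circle.exp (y.2 i) := by
  classical
  have himg : Finset.univ.filter (fun r => r ∈ Set.range v.facet)
      = Finset.univ.image v.facet := by
    ext r
    simp
  rw [← Finset.prod_filter_mul_prod_filter_not Finset.univ (fun r => r ∈ Set.range v.facet)]
  have h2 : ∏ r ∈ Finset.univ.filter (fun r => ¬ r ∈ Set.range v.facet),
      v.phase y r ^ (Δ.normal r i) = 1 := by
    refine Finset.prod_eq_one fun r hr => ?_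
    rw [phase, Function.extend_apply' _ _ _ (Finset.mem_filter.mp hr).2, one_zpow]
  rw [h2, mul_one, himg, Finset.prod_image fun a _ b _ h => v.injective h]
  simp only [phase, v.injective.extend_apply]
  rw [← circleExp_sum]
  congr 1
  have h3 : y.2 = v.matᵀ *ᵥ (v.mat⁻¹ᵀ *ᵥ y.2) := by
    rw [Matrix.mulVec_mulVec, ← Matrix.transpose_mul, v.inv_mul_mat, Matrix.transpose_one,
      Matrix.one_mulVec]
  conv_rhs => rw [h3]
  rfl

theorem Vertex.ofActionAngle_congr (v : Δ.Vertex) {y y' : RSpace n} (h1 : y.1 = y'.1)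
    (h2 : ∀ i, Circle.exp (y.2 i) = Circle.exp (y'.2 i)) :
    v.ofActionAngle y = v.ofActionAngle y' := by
  have h3 : ∀ (z : RSpace n) (k : Fin n), Circle.exp ((v.mat⁻¹ᵀ *ᵥ z.2) k)
      = ∏ j, Circle.exp (z.2 j) ^ ((Matrix.of fun k => Δ.normal (v.facet k))⁻¹ j k) := by
    intro z k
    rw [← circleExp_sum]
    congr 1
    simp only [Matrix.mulVec, dotProduct, Matrix.transpose_apply, v.mat_inv_apply]
  have h4 : ∀ k, Circle.exp ((v.mat⁻¹ᵀ *ᵥ y.2) k) = Circle.exp ((v.mat⁻¹ᵀ *ᵥ y'.2) k) := by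
    intro k
    rw [h3, h3]
    exact Finset.prod_congr rfl fun j _ => by rw [h2]
  have h5 : ∀ t : ℝ, (Circle.exp t : ℂ) = (Real.cos t : ℂ) + (Real.sin t : ℂ) * Complex.I := by
    intro t
    rw [Circle.coe_exp, Complex.exp_mul_I, Complex.ofReal_cos, Complex.ofReal_sin]
  have h6 : ∀ k, (Real.cos ((v.mat⁻¹ᵀ *ᵥ y.2) k) : ℂ) + Real.sin ((v.mat⁻¹ᵀ *ᵥ y.2) k) * Complex.I
      = (Real.cos ((v.mat⁻¹ᵀ *ᵥ y'.2) k) : ℂ) + Real.sin ((v.mat⁻¹ᵀ *ᵥ y'.2) k) * Complex.I := by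
    intro k
    rw [← h5, ← h5, h4]
  have hc : ∀ k, Real.cos ((v.mat⁻¹ᵀ *ᵥ y.2) k) = Real.cos ((v.mat⁻¹ᵀ *ᵥ y'.2) k) := by
    intro k
    simpa [← Complex.ofReal_cos, ← Complex.ofReal_sin] using congrArg Complex.re (h6 k)
  have hs : ∀ k, Real.sin ((v.mat⁻¹ᵀ *ᵥ y.2) k) = Real.sin ((v.mat⁻¹ᵀ *ᵥ y'.2) k) := by
    intro k
    simpa [← Complex.ofReal_cos, ← Complex.ofReal_sin] using congrArg Complex.im (h6 k)
  ext k
  · change Real.sqrt (2 * Δ.l (v.facet k) y.1) * _ = Real.sqrt (2 * Δ.l (v.facet k) y'.1) * _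
    rw [h1, hc]
  · change Real.sqrt (2 * Δ.l (v.facet k) y.1) * _ = Real.sqrt (2 * Δ.l (v.facet k) y'.1) * _
    rw [h1, hs]

theorem Vertex.norm_slice (v : Δ.Vertex) {q : RSpace n} (hq : q ∈ v.domain) (r : Fin Δ.d) :
    ‖v.slice q r‖ ^ 2 / 2 = Δ.l r (v.moment q) := by
  by_cases hr : r ∈ Set.range v.facet
  · obtain ⟨k, rfl⟩ := hr
    rw [slice, v.injective.extend_apply, v.l_moment, Complex.sq_norm, Complex.normSq_mk]
    ring
  · have h0 := hq r hr
    rw [slice, Function.extend_apply' _ _ _ hr, Complex.norm_real, Real.norm_eq_abs, sq_abs,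
      Real.sq_sqrt (by linarith)]
    ring

/-- In every chart, the point of `M` with action-angle coordinates `y` is `v.ofActionAngle y`. -/
theorem Vertex.eq_ofActionAngle_of_param_eq {v v' : Δ.Vertex} {y : RSpace n}
    (hy : y ∈ Δ.actionAngle) {q' : RSpace n} (hq' : q' ∈ v'.domain)
    (hq : v.ofActionAngle y ∈ v.domain)
    (h : v'.param q' hq' = v.param (v.ofActionAngle y) hq) : q' = v'.ofActionAngle y := by
  obtain ⟨t, ht, hz⟩ := Quotient.exact h
  have hz' : ∀ r, v.slice (v.ofActionAngle y) r = (t r : ℂ) * v'.slice q' r := hz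
  have hl : ∀ r, Δ.l r (v'.moment q') = Δ.l r y.1 := by
    intro r
    rw [← v'.norm_slice hq', ← v.moment_ofActionAngle hy, ← v.norm_slice hq, hz', norm_mul,
      Circle.norm_coe, one_mul]
  have hint : q' ∈ v'.chartInterior := by
    refine ⟨hq', fun k => ?_⟩
    have h1 := hl (v'.facet k)
    have h2 : 0 < Δ.l (v'.facet k) y.1 := hy _
    rw [v'.l_moment] at h1
    linarith
  obtain ⟨y', hy', rfl⟩ := v'.exists_actionAngle hint
  have h1 : y'.1 = y.1 := by
    rw [v'.moment_ofActionAngle hy'] at hl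
    have : v'.mat *ᵥ y'.1 = v'.mat *ᵥ y.1 := by
      ext k
      have := hl (v'.facet k)
      rw [v'.l_facet, v'.l_facet] at this
      linarith
    have := congrArg (fun z => v'.mat⁻¹ *ᵥ z) this
    simpa only [Matrix.mulVec_mulVec, v'.inv_mul_mat, Matrix.one_mulVec] using this
  refine v'.ofActionAngle_congr h1 fun i => ?_
  have hphase : ∀ r, v.phase y r = t r * v'.phase y' r := by
    intro r
    have h2 := hz' r
    have hpos : 0 < Δ.l r y.1 := hy r
    have hsq : (Real.sqrt (2 * Δ.l r y.1) : ℂ) ≠ 0 := by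
      exact_mod_cast (Real.sqrt_pos.mpr (by positivity)).ne'
    rw [v.slice_ofActionAngle hy, v'.slice_ofActionAngle hy', h1, mul_left_comm] at h2
    have h3 := mul_left_cancel₀ hsq h2
    exact Circle.ext (by rw [h3, Circle.coe_mul])
  rw [← v'.prod_phase, ← v.prod_phase]
  simp only [hphase, mul_zpow, Finset.prod_mul_distrib, ht i, one_mul]

theorem Vertex.preimage_openOrbit (v : Δ.Vertex) : v.preimage Δ.openOrbit = v.chartInterior := by
  ext q
  constructor
  · rintro ⟨hq, z, hz, heq⟩
    obtain ⟨t, -, hzt⟩ := Quotient.exact heq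
    refine ⟨hq, fun k h0 => ?_⟩
    have h1 : v.slice q (v.facet k) = (t (v.facet k) : ℂ) * z.1 (v.facet k) := hzt _
    have h2 : ‖v.slice q (v.facet k)‖ ^ 2 / 2 = 0 := by
      rw [v.norm_slice hq, v.l_moment, h0, zero_div]
    have h3 : v.slice q (v.facet k) = 0 := by simpa using h2
    rw [h3] at h1
    rcases mul_eq_zero.mp h1.symm with h | h
    · exact Circle.coe_ne_zero _ h
    · exact hz _ h
  · intro hq
    refine ⟨hq.1, ⟨v.slice q, v.slice_mem hq.1⟩, fun r h0 => ?_, rfl⟩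
    have h1 := v.norm_slice hq.1 r
    change v.slice q r = 0 at h0
    rw [h0] at h1
    have h2 := v.moment_mem_inside hq r
    rw [← h1] at h2
    simp at h2

theorem isOpen_openOrbit (Δ : DelzantPolytope n) : IsOpen Δ.openOrbit := by
  have hq : Topology.IsQuotientMap (Quotient.mk Δ.orbitSetoid) := isQuotientMap_quotient_mk'
  refine hq.isOpen_preimage.mp ?_
  have : Quotient.mk Δ.orbitSetoid ⁻¹' Δ.openOrbit = {z | ∀ r, z.1 r ≠ 0} := by
    ext z
    constructor
    · rintro ⟨z', hz', heq⟩ r h0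
      obtain ⟨t, -, hzt⟩ := Quotient.exact heq
      have h1 := hzt r
      rw [h0] at h1
      rcases mul_eq_zero.mp h1.symm with h | h
      · exact Circle.coe_ne_zero _ h
      · exact hz' _ h
    · intro hz
      exact ⟨z, hz, rfl⟩
  rw [this]
  have : {z : Δ.levelSet | ∀ r, z.1 r ≠ 0} = ⋂ r, {z | z.1 r ≠ 0} := by
    ext z
    simp
  rw [this]
  exact isOpen_iInter_of_finite fun r =>
    isOpen_ne_fun ((continuous_apply r).comp continuous_subtype_val) continuous_const

theorem Vertex.continuous_slice (v : Δ.Vertex) : Continuous v.slice := by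
  refine continuous_pi fun r => ?_
  by_cases hr : r ∈ Set.range v.facet
  · obtain ⟨k, rfl⟩ := hr
    have : (fun q => v.slice q (v.facet k)) = fun q => (q.1 k : ℂ) + q.2 k * Complex.I := by
      ext q
      rw [slice, v.injective.extend_apply, Complex.mk_eq_add_mul_I]
    rw [this]
    fun_prop
  · have : (fun q => v.slice q r)
        = fun q => ((Real.sqrt (2 * Δ.l r (v.moment q)) : ℝ) : ℂ) := by
      ext q
      rw [slice, Function.extend_apply' _ _ _ hr]
    rw [this]
    have h1 := v.contDiff_moment.continuous
    have h2 := (Δ.contDiff_l r).continuous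
    fun_prop

theorem Vertex.continuous_param (v : Δ.Vertex) :
    Continuous fun q : v.domain => v.param q.1 q.2 := by
  have h1 : Continuous fun q : v.domain => (⟨v.slice q.1, v.slice_mem q.2⟩ : Δ.levelSet) :=
    (v.continuous_slice.comp continuous_subtype_val).subtype_mk _
  exact Continuous.comp (g := Quotient.mk Δ.orbitSetoid) continuous_quotient_mk' h1

theorem Vertex.mem_closure_chartInterior (v : Δ.Vertex) (q : v.domain) :
    q ∈ closure (Subtype.val ⁻¹' v.chartInterior : Set v.domain) := by
  rw [closure_subtype, Subtype.image_preimage_coe, Set.inter_eq_right.mpr fun _ h => h.1]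
  exact mem_closure_iff_nhdsWithin_neBot.mpr (v.neBot_chartInterior q.2)

theorem dense_openOrbit (Δ : DelzantPolytope n) : Dense Δ.openOrbit := by
  intro m
  obtain ⟨v, q, hq, rfl⟩ := Δ.exists_chart m
  have hmaps : Set.MapsTo (fun q : v.domain => v.param q.1 q.2)
      (Subtype.val ⁻¹' v.chartInterior) Δ.openOrbit := by
    intro q' h
    rw [Set.mem_preimage, ← v.preimage_openOrbit] at h
    exact h.2
  have h := map_mem_closure v.continuous_param (v.mem_closure_chartInterior ⟨q, hq⟩) hmaps
  exact h

theorem isOpen_actionAngle (Δ : DelzantPolytope n) : IsOpen Δ.actionAngle :=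
  Δ.isOpen_inside.preimage continuous_fst

section Transition

variable {v v' : Δ.Vertex} {W : Set (RSpace n)} {τ : RSpace n → RSpace n}

/-- On the open orbit, the derivative of a change of charts identifies the push forwards of
`∂/∂x_k` and `∂/∂θ_k`. -/
theorem pushC_transition_frameMap (hW : IsOpen W) (hτ : ContDiffOn ℝ ∞ τ W)
    (h : ∀ q ∈ W, ∃ (hq : q ∈ v.domain) (hq' : τ q ∈ v'.domain),
      v'.param (τ q) hq' = v.param q hq) {q : RSpace n} (hq : q ∈ W)
    (hqi : q ∈ v.chartInterior) :
    τ q ∈ v'.chartInterior ∧ v'.moment (τ q) = v.moment q ∧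
      ∀ w, pushC τ q (v.frameMap q w) = v'.frameMap (τ q) w := by
  obtain ⟨y, hy, rfl⟩ := v.exists_actionAngle hqi
  have hkey : ∀ y' ∈ Δ.actionAngle, v.ofActionAngle y' ∈ W →
      τ (v.ofActionAngle y') = v'.ofActionAngle y' := by
    intro y' hy' hW'
    obtain ⟨h1, h2, h3⟩ := h _ hW'
    exact Vertex.eq_ofActionAngle_of_param_eq hy' h2 h1 h3
  have hτq := hkey y hy hq
  refine ⟨hτq ▸ v'.ofActionAngle_mem hy, ?_, fun w => ?_⟩
  · rw [hτq, v'.moment_ofActionAngle hy, v.moment_ofActionAngle hy]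
  · have hd := v.differentiableAt_ofActionAngle hy
    have hdτ : DifferentiableAt ℝ τ (v.ofActionAngle y) :=
      (hτ.contDiffAt (hW.mem_nhds hq)).differentiableAt (by simp)
    have heq : τ ∘ v.ofActionAngle =ᶠ[𝓝 y] v'.ofActionAngle := by
      filter_upwards [hd.continuousAt.preimage_mem_nhds (hW.mem_nhds hq),
        Δ.isOpen_actionAngle.mem_nhds hy] with y' h1 h2 using hkey y' h2 h1
    have h1 := pushC_comp hdτ hd
    have h2 : pushC (τ ∘ v.ofActionAngle) y = pushC v'.ofActionAngle y := by
      unfold pushC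
      rw [heq.fderiv_eq]
    rw [h2, v'.pushC_ofActionAngle hy, v.pushC_ofActionAngle hy] at h1
    rw [hτq, h1]
    rfl

theorem tendsto_pushC (hW : IsOpen W) (hτ : ContDiffOn ℝ ∞ τ W) {q : RSpace n} (hq : q ∈ W)
    {X : Type*} {F : Filter X} {Q : X → RSpace n} {U : X → CSpace n} {u : CSpace n}
    (hQ : Filter.Tendsto Q F (𝓝 q)) (hU : Filter.Tendsto U F (𝓝 u)) :
    Filter.Tendsto (fun t => pushC τ (Q t) (U t)) F (𝓝 (pushC τ q u)) := by
  have hc : ContinuousAt (fderiv ℝ τ) q :=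
    (hτ.continuousOn_fderiv_of_isOpen hW (by simp)).continuousAt (hW.mem_nhds hq)
  have hQ' : Filter.Tendsto (fun t => fderiv ℝ τ (Q t)) F (𝓝 (fderiv ℝ τ q)) :=
    hc.tendsto.comp hQ
  have hb : Continuous fun p : (RSpace n →L[ℝ] RSpace n) × RSpace n => p.1 p.2 :=
    isBoundedBilinearMap_apply.continuous
  have h1 := (hb.tendsto (_, _)).comp (hQ'.prodMk_nhds ((continuous_rePart.tendsto u).comp hU))
  have h2 := (hb.tendsto (_, _)).comp (hQ'.prodMk_nhds ((continuous_imPart.tendsto u).comp hU))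
  have h3 := ((continuous_toC.tendsto _).comp h1).add
    (((continuous_toC.tendsto _).comp h2).const_smul Complex.I)
  simpa only [Function.comp_def, pushC_apply] using h3

/-- Changes of charts are symplectic. -/
theorem omega_pushC_transition (hW : IsOpen W) (hτ : ContDiffOn ℝ ∞ τ W)
    (h : ∀ q ∈ W, ∃ (hq : q ∈ v.domain) (hq' : τ q ∈ v'.domain),
      v'.param (τ q) hq' = v.param q hq) {q : RSpace n} (hq : q ∈ W) (u w : CSpace n) :
    omega (pushC τ q u) (pushC τ q w) = omega u w := by
  have hne := v.neBot_chartInterior (h q hq).1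
  have hid : Filter.Tendsto id (𝓝[v.chartInterior] q) (𝓝 q) :=
    Filter.tendsto_id.mono_left nhdsWithin_le_nhds
  have hp := (tendsto_pushC hW hτ hq hid (tendsto_const_nhds (x := u))).prodMk_nhds
    (tendsto_pushC hW hτ hq hid (tendsto_const_nhds (x := w)))
  have h1 := (continuous_omega.tendsto _).comp hp
  refine tendsto_nhds_unique h1 (tendsto_const_nhds.congr' ?_)
  filter_upwards [self_mem_nhdsWithin, nhdsWithin_le_nhds (hW.mem_nhds hq)] with q' hi hqW
  obtain ⟨u', rfl⟩ := v.frameMap_surjective hi u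
  obtain ⟨w', rfl⟩ := v.frameMap_surjective hi w
  obtain ⟨h2, -, h3⟩ := pushC_transition_frameMap hW hτ h hqW hi
  change _ = omega (pushC τ q' _) (pushC τ q' _)
  rw [h3, h3, v'.omega_frameMap h2, v.omega_frameMap hi]

theorem pushC_transition_injective (hW : IsOpen W) (hτ : ContDiffOn ℝ ∞ τ W)
    (h : ∀ q ∈ W, ∃ (hq : q ∈ v.domain) (hq' : τ q ∈ v'.domain),
      v'.param (τ q) hq' = v.param q hq) {q : RSpace n} (hq : q ∈ W) :
    Function.Injective (pushC τ q) := by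
  rw [← LinearMap.ker_eq_bot, LinearMap.ker_eq_bot']
  intro u hu
  refine eq_zero_of_omega fun w => ?_
  rw [← omega_pushC_transition hW hτ h hq, hu]
  simp [omega]

end Transition

theorem IsAdmissible.isLagrangian {g h : (Fin n → ℝ) → ℝ} (H : Δ.IsAdmissible g h)
    (v : Δ.Vertex) {q : RSpace n} (hq : q ∈ v.domain) : IsLagrangian (Δ.kahlerPol g v q) := by
  rw [H.kahlerPol_eq v hq]
  exact isLagrangian_modelPol (v.curv_transpose H.smooth hq) q

/-- Changes of charts preserve the polarization on the open orbit, where it is `T^{1,0}` in both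
charts, and hence everywhere by continuity of its frame. -/
theorem IsAdmissible.isGlobal {g h : (Fin n → ℝ) → ℝ} (H : Δ.IsAdmissible g h) :
    (Δ.kahlerPol g).IsGlobal := by
  intro v v' W τ hW hτ hpar q hq
  obtain ⟨hqd, hqd', -⟩ := hpar q hq
  have hle : (Δ.kahlerPol g v q).map (pushC τ q) ≤ Δ.kahlerPol g v' (τ q) := by
    rw [H.kahlerPol_eq v hqd, H.kahlerPol_eq v' hqd']
    rintro _ ⟨u, hu, rfl⟩
    have hu' : u ∈ modelPol (v.curv h (v.moment q)) q := hu
    rw [← range_modelFrame] at hu'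
    obtain ⟨c, rfl⟩ := hu'
    refine mem_modelPol.mpr fun j => ?_
    have hne := v.neBot_chartInterior hqd
    have hid : Filter.Tendsto id (𝓝[v.chartInterior] q) (𝓝 q) :=
      Filter.tendsto_id.mono_left nhdsWithin_le_nhds
    have hτc : Filter.Tendsto τ (𝓝[v.chartInterior] q) (𝓝 (τ q)) :=
      ((hτ.continuousOn.continuousAt (hW.mem_nhds hq)).tendsto).mono_left nhdsWithin_le_nhds
    have hfr : Filter.Tendsto (fun q' => modelFrame (v.curv h (v.moment q')) q' c)
        (𝓝[v.chartInterior] q) (𝓝 (modelFrame (v.curv h (v.moment q)) q c)) :=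
      (v.continuousAt_modelFrame H.smooth hqd c).tendsto.mono_left nhdsWithin_le_nhds
    have h1 := v'.tendsto_modelForm H.smooth hqd' hτc (tendsto_pushC hW hτ hq hid hfr) j
    refine tendsto_nhds_unique h1 (tendsto_const_nhds.congr' ?_)
    filter_upwards [self_mem_nhdsWithin, nhdsWithin_le_nhds (hW.mem_nhds hq)] with q' hi hqW
    obtain ⟨h2, hmom, h3⟩ := pushC_transition_frameMap hW hτ hpar hqW hi
    obtain ⟨w, hw⟩ := v.frameMap_surjective hi (modelFrame (v.curv h (v.moment q')) q' c)
    have h4 := modelFrame_mem (v.curv h (v.moment q')) q' c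
    rw [← hw, v.frameMap_mem_modelPol H.smooth H.eq hi, ← hmom,
      ← v'.frameMap_mem_modelPol H.smooth H.eq h2, ← h3, hw] at h4
    exact (mem_modelPol.mp h4 j).symm
  refine (Submodule.eq_of_le_of_finrank_eq hle ?_).symm
  rw [← (Submodule.equivMapOfInjective _
    (pushC_transition_injective hW hτ hpar hq) _).finrank_eq, (H.isLagrangian v' hqd').finrank,
    (H.isLagrangian v hqd).finrank]

end DelzantPolytope

/-! ### Rules for complexified differentials -/

theorem dC_of_hasFDerivAt {n : ℕ} {f : RSpace n → ℂ} {y : RSpace n} {f' : RSpace n →L[ℝ] ℂ}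
    (hf : HasFDerivAt f f' y) (w : CSpace n) :
    dC f y w = f' (rePart w) + Complex.I * f' (imPart w) := by
  rw [dC_apply, hf.fderiv, smul_eq_mul]

theorem dC_add {n : ℕ} {f₁ f₂ : RSpace n → ℂ} {y : RSpace n} (h₁ : DifferentiableAt ℝ f₁ y)
    (h₂ : DifferentiableAt ℝ f₂ y) (w : CSpace n) :
    dC (fun q => f₁ q + f₂ q) y w = dC f₁ y w + dC f₂ y w := by
  rw [dC_of_hasFDerivAt (h₁.hasFDerivAt.fun_add h₂.hasFDerivAt), dC_apply, dC_apply]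
  simp only [add_apply, smul_eq_mul]
  ring

theorem dC_mul {n : ℕ} {f₁ f₂ : RSpace n → ℂ} {y : RSpace n} (h₁ : DifferentiableAt ℝ f₁ y)
    (h₂ : DifferentiableAt ℝ f₂ y) (w : CSpace n) :
    dC (fun q => f₁ q * f₂ q) y w = f₁ y * dC f₂ y w + f₂ y * dC f₁ y w := by
  rw [dC_of_hasFDerivAt (h₁.hasFDerivAt.fun_mul h₂.hasFDerivAt), dC_apply, dC_apply]
  simp only [add_apply, smul_apply, smul_eq_mul]
  ring

theorem dC_const_mul {n : ℕ} {f : RSpace n → ℂ} {y : RSpace n} (h : DifferentiableAt ℝ f y)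
    (c : ℂ) (w : CSpace n) : dC (fun q => c * f q) y w = c * dC f y w := by
  rw [dC_of_hasFDerivAt (h.hasFDerivAt.const_mul c), dC_apply]
  simp only [smul_apply, smul_eq_mul]
  ring

theorem dC_sum {n : ℕ} {ι : Type*} {S : Finset ι} {f : ι → RSpace n → ℂ} {y : RSpace n}
    (h : ∀ i ∈ S, DifferentiableAt ℝ (f i) y) (w : CSpace n) :
    dC (fun q => ∑ i ∈ S, f i q) y w = ∑ i ∈ S, dC (f i) y w := by
  rw [dC_of_hasFDerivAt (HasFDerivAt.fun_sum fun i hi => (h i hi).hasFDerivAt)]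
  simp only [dC_apply, sum_apply, Finset.mul_sum, ← Finset.sum_add_distrib,
    smul_eq_mul]

theorem dC_cexp {n : ℕ} {f : RSpace n → ℂ} {y : RSpace n} (h : DifferentiableAt ℝ f y)
    (w : CSpace n) : dC (fun q => Complex.exp (f q)) y w = Complex.exp (f y) * dC f y w := by
  rw [dC_of_hasFDerivAt h.hasFDerivAt.cexp, dC_apply]
  simp only [smul_apply, smul_eq_mul]
  ring

theorem dC_clog {n : ℕ} {f : RSpace n → ℂ} {y : RSpace n} (h : DifferentiableAt ℝ f y)
    (hs : f y ∈ Complex.slitPlane) (w : CSpace n) :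
    dC (fun q => Complex.log (f q)) y w = (f y)⁻¹ * dC f y w := by
  have hl := ((Complex.hasStrictDerivAt_log hs).hasDerivAt.hasFDerivAt.restrictScalars ℝ).comp y
    h.hasFDerivAt
  change dC (Complex.log ∘ f) y w = _
  rw [dC_of_hasFDerivAt hl, dC_apply]
  simp
  ring

theorem dC_zbar {n : ℕ} (y : RSpace n) (j : Fin n) (w : CSpace n) :
    dC (fun q => zbar q j) y w = w.1 j - Complex.I * w.2 j := by
  have h : HasFDerivAt (fun q : RSpace n => zbar q j)
      (Complex.ofRealCLM ∘L (ContinuousLinearMap.proj j ∘L ContinuousLinearMap.fst ℝ _ _)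
        - (Complex.ofRealCLM ∘L (ContinuousLinearMap.proj j ∘L
          ContinuousLinearMap.snd ℝ _ _)).smulRight Complex.I) y := by
    have := (Complex.ofRealCLM ∘L (ContinuousLinearMap.proj j ∘L ContinuousLinearMap.fst ℝ _ _)
        - (Complex.ofRealCLM ∘L (ContinuousLinearMap.proj j ∘L
          ContinuousLinearMap.snd ℝ (Fin n → ℝ) (Fin n → ℝ))).smulRight
            Complex.I : RSpace n →L[ℝ] ℂ).hasFDerivAt (x := y)
    exact this
  rw [dC_of_hasFDerivAt h]
  change ((w.1 j).re - (w.2 j).re * Complex.I : ℂ)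
    + Complex.I * ((w.1 j).im - (w.2 j).im * Complex.I) = _
  linear_combination Complex.re_add_im (w.1 j) - Complex.I * Complex.re_add_im (w.2 j)

theorem contDiff_zbar {n : ℕ} (j : Fin n) : ContDiff ℝ ∞ fun q : RSpace n => zbar q j := by
  have h : (fun q : RSpace n => zbar q j)
      = (Complex.ofRealCLM ∘L (ContinuousLinearMap.proj j ∘L ContinuousLinearMap.fst ℝ _ _)
        - (Complex.ofRealCLM ∘L (ContinuousLinearMap.proj j ∘L
          ContinuousLinearMap.snd ℝ (Fin n → ℝ) (Fin n → ℝ))).smulRight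
            Complex.I : RSpace n →L[ℝ] ℂ) := rfl
  rw [h]
  exact ContinuousLinearMap.contDiff _

theorem dC_ofReal {n : ℕ} {f : RSpace n → ℝ} {y : RSpace n} {f' : RSpace n →L[ℝ] ℝ}
    (hf : HasFDerivAt f f' y) (w : CSpace n) :
    dC (fun q => (f q : ℂ)) y w = (f' (rePart w) : ℂ) + Complex.I * (f' (imPart w) : ℂ) :=
  dC_of_hasFDerivAt (f' := Complex.ofRealCLM ∘L f') (Complex.ofRealCLM.hasFDerivAt.comp y hf) w

/-! ### Positivity of complexified quadratic forms -/

theorem star_dotProduct_cMat_mulVec {n : ℕ} {G : Matrix (Fin n) (Fin n) ℝ} (hG : Gᵀ = G)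
    (z : Fin n → ℂ) :
    star z ⬝ᵥ (cMat G *ᵥ z) = (((fun k => (z k).re) ⬝ᵥ (G *ᵥ fun k => (z k).re)
      + (fun k => (z k).im) ⬝ᵥ (G *ᵥ fun k => (z k).im) : ℝ) : ℂ) := by
  have hz : z = (fun k => ((z k).re : ℂ)) + Complex.I • fun k => ((z k).im : ℂ) := by
    ext k
    rw [Pi.add_apply, Pi.smul_apply, smul_eq_mul, mul_comm, Complex.re_add_im]
  have hs : star z = (fun k => ((z k).re : ℂ)) - Complex.I • fun k => ((z k).im : ℂ) := by
    ext k
    apply Complex.ext <;> simp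
  have hc : ∀ a b : Fin n → ℝ, (fun k => (a k : ℂ)) ⬝ᵥ (cMat G *ᵥ fun k => (b k : ℂ))
      = ((a ⬝ᵥ (G *ᵥ b) : ℝ) : ℂ) := by
    intro a b
    simp [dotProduct, Matrix.mulVec, cMat]
  have hsymm := cMat_dotProduct_comm hG (fun k => ((z k).re : ℂ)) (fun k => ((z k).im : ℂ))
  rw [dotProduct_comm (cMat G *ᵥ _)] at hsymm
  rw [hs]
  nth_rw 3 [hz]
  rw [Matrix.mulVec_add, Matrix.mulVec_smul, sub_dotProduct, dotProduct_add, dotProduct_add,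
    dotProduct_smul, dotProduct_smul, smul_dotProduct, smul_dotProduct, hsymm,
    hc (fun k => (z k).re) fun k => (z k).re, hc (fun k => (z k).im) fun k => (z k).im]
  simp only [smul_eq_mul]
  push_cast
  linear_combination (-(((fun k => (z k).im) ⬝ᵥ (G *ᵥ fun k => (z k).im) : ℝ) : ℂ)) * Complex.I_sq

theorem posDef_transpose {n : ℕ} {G : Matrix (Fin n) (Fin n) ℝ} (hG : G.PosDef) : Gᵀ = G := by
  have h := hG.isHermitian
  rwa [Matrix.IsHermitian, Matrix.conjTranspose_eq_transpose_of_trivial] at h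

theorem re_star_dotProduct_pos {n : ℕ} {G : Matrix (Fin n) (Fin n) ℝ} (hG : G.PosDef)
    {z : Fin n → ℂ} (hz : z ≠ 0) : 0 < (star z ⬝ᵥ (cMat G *ᵥ z)).re := by
  rw [star_dotProduct_cMat_mulVec (posDef_transpose hG), Complex.ofReal_re]
  have h0 : ∀ a : Fin n → ℝ, 0 ≤ a ⬝ᵥ (G *ᵥ a) := fun a => by
    simpa using hG.posSemidef.dotProduct_mulVec_nonneg a
  have h1 : ∀ a : Fin n → ℝ, a ≠ 0 → 0 < a ⬝ᵥ (G *ᵥ a) := fun a ha => by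
    simpa using hG.dotProduct_mulVec_pos ha
  by_cases hre : (fun k => (z k).re) = 0
  · refine add_pos_of_nonneg_of_pos (h0 _) (h1 _ fun him => hz ?_)
    ext k
    exact Complex.ext (congrFun hre k) (congrFun him k)
  · exact add_pos_of_pos_of_nonneg (h1 _ hre) (h0 _)

theorem re_star_dotProduct_gram_nonneg {n : ℕ} (C : Matrix (Fin n) (Fin n) ℝ) (z : Fin n → ℂ) :
    0 ≤ (star z ⬝ᵥ (cMat (Cᵀ * C) *ᵥ z)).re := by
  rw [star_dotProduct_cMat_mulVec (by rw [Matrix.transpose_mul, Matrix.transpose_transpose]),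
    Complex.ofReal_re]
  have h0 : ∀ a : Fin n → ℝ, 0 ≤ a ⬝ᵥ ((Cᵀ * C) *ᵥ a) := fun a => by
    rw [← Matrix.mulVec_mulVec, Matrix.dotProduct_mulVec, Matrix.vecMul_transpose]
    exact Finset.sum_nonneg fun k _ => mul_self_nonneg _
  exact add_nonneg (h0 _) (h0 _)

namespace DelzantPolytope

variable {n : ℕ} {Δ : DelzantPolytope n}

/-! ### The extended polarization is Kähler -/

theorem Vertex.hasFDerivAt_moment (v : Δ.Vertex) (q : RSpace n) :
    ∃ L : RSpace n →L[ℝ] (Fin n → ℝ), HasFDerivAt v.moment L q ∧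
      ∀ u, L u = v.mat⁻¹ *ᵥ fun k => q.1 k * u.1 k + q.2 k * u.2 k := by
  have h1 : ∀ k, HasFDerivAt (fun q : RSpace n => q.1 k)
      (ContinuousLinearMap.proj k ∘L ContinuousLinearMap.fst ℝ (Fin n → ℝ) (Fin n → ℝ)) q :=
    fun k => (ContinuousLinearMap.proj (R := ℝ) (φ := fun _ : Fin n => ℝ) k ∘L
      ContinuousLinearMap.fst ℝ (Fin n → ℝ) (Fin n → ℝ)).hasFDerivAt
  have h2 : ∀ k, HasFDerivAt (fun q : RSpace n => q.2 k)
      (ContinuousLinearMap.proj k ∘L ContinuousLinearMap.snd ℝ (Fin n → ℝ) (Fin n → ℝ)) q :=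
    fun k => (ContinuousLinearMap.proj (R := ℝ) (φ := fun _ : Fin n => ℝ) k ∘L
      ContinuousLinearMap.snd ℝ (Fin n → ℝ) (Fin n → ℝ)).hasFDerivAt
  have h3 : ∀ k, HasFDerivAt (fun q : RSpace n =>
      (q.1 k ^ 2 + q.2 k ^ 2) / 2 - Δ.lam (v.facet k)) _ q := fun k =>
    ((((h1 k).pow 2).fun_add ((h2 k).pow 2)).mul_const (2⁻¹ : ℝ)).sub_const _
  have h4 := (LinearMap.toContinuousLinearMap v.mat⁻¹.mulVecLin).hasFDerivAt.comp q
    (hasFDerivAt_pi.mpr h3)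
  refine ⟨_, h4, fun u => ?_⟩
  change v.mat⁻¹ *ᵥ _ = _
  congr 1
  ext k
  simp
  ring

/-- The differential of a function of the moment map. -/
theorem Vertex.dC_comp_moment (v : Δ.Vertex) {f : (Fin n → ℝ) → ℝ} {q : RSpace n}
    (hf : DifferentiableAt ℝ f (v.moment q)) (w : CSpace n) :
    dC (fun q => (f (v.moment q) : ℂ)) q w
      = ∑ i, (partialD f i (v.moment q) : ℂ) * (cMat v.mat⁻¹ *ᵥ dXi q w) i := by
  obtain ⟨L, hL, hLu⟩ := v.hasFDerivAt_moment q
  have hd : HasFDerivAt (fun q => f (v.moment q)) _ q := hf.hasFDerivAt.comp q hL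
  rw [dC_ofReal hd]
  simp only [ContinuousLinearMap.comp_apply, fderiv_eq_sum_partialD, hLu]
  push_cast
  rw [Finset.mul_sum, ← Finset.sum_add_distrib]
  refine Finset.sum_congr rfl fun i _ => ?_
  rw [← cMat_mulVec_ofReal, ← cMat_mulVec_ofReal]
  have : dXi q w = (fun k => ((q.1 k * (rePart w).1 k + q.2 k * (rePart w).2 k : ℝ) : ℂ))
      + Complex.I • fun k => ((q.1 k * (imPart w).1 k + q.2 k * (imPart w).2 k : ℝ) : ℂ) := by
    ext k
    rw [dXi_apply, Pi.add_apply, Pi.smul_apply, smul_eq_mul]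
    simp only [rePart, imPart]
    push_cast
    linear_combination (-(q.1 k : ℂ)) * Complex.re_add_im (w.1 k)
      - q.2 k * Complex.re_add_im (w.2 k)
  rw [this, Matrix.mulVec_add, Matrix.mulVec_smul, Pi.add_apply, Pi.smul_apply, smul_eq_mul]
  ring

/-- The derivative of the regular part of the potential in the direction of `∂/∂x_v^j`. -/
def Vertex.regGrad (v : Δ.Vertex) (h : (Fin n → ℝ) → ℝ) (j : Fin n) (x : Fin n → ℝ) : ℝ :=
  ∑ i, v.mat⁻¹ i j * partialD (v.reg h) i x

theorem Vertex.contDiffAt_regGrad (v : Δ.Vertex) {h : (Fin n → ℝ) → ℝ} (hh : ContDiff ℝ ∞ h)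
    (j : Fin n) {x : Fin n → ℝ} (hx : x ∈ v.nearby) : ContDiffAt ℝ ∞ (v.regGrad h j) x := by
  unfold regGrad
  exact ContDiffAt.sum fun i _ =>
    contDiffAt_const.mul (contDiffAt_partialD (v.contDiffAt_reg hh hx) i)

/-- The conjugates of the holomorphic coordinates `ζ_j exp(∂_j (g - ½ ∑_k x_v^k log x_v^k))`; unlike
the logarithms `z_j`, they are defined on the whole chart. -/
def Vertex.antiHol (v : Δ.Vertex) (h : (Fin n → ℝ) → ℝ) (j : Fin n) (q : RSpace n) : ℂ :=
  zbar q j * Complex.exp (v.regGrad h j (v.moment q) : ℂ)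

theorem Vertex.contDiffAt_regGrad_moment (v : Δ.Vertex) {h : (Fin n → ℝ) → ℝ}
    (hh : ContDiff ℝ ∞ h) (j : Fin n) {q : RSpace n} (hq : q ∈ v.domain) :
    ContDiffAt ℝ ∞ (fun q => (v.regGrad h j (v.moment q) : ℂ)) q :=
  Complex.ofRealCLM.contDiff.contDiffAt.comp q
    (ContDiffAt.comp (g := v.regGrad h j) (f := v.moment) q (v.contDiffAt_regGrad hh j hq)
      v.contDiff_moment.contDiffAt)

theorem Vertex.contDiffAt_antiHol (v : Δ.Vertex) {h : (Fin n → ℝ) → ℝ} (hh : ContDiff ℝ ∞ h)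
    (j : Fin n) {q : RSpace n} (hq : q ∈ v.domain) : ContDiffAt ℝ ∞ (v.antiHol h j) q :=
  (contDiff_zbar j).contDiffAt.mul (v.contDiffAt_regGrad_moment hh j hq).cexp

/-- The forms that define the polarization are, up to nonvanishing factors, exact. -/
theorem Vertex.dC_antiHol (v : Δ.Vertex) {h : (Fin n → ℝ) → ℝ} (hh : ContDiff ℝ ∞ h)
    (j : Fin n) {q : RSpace n} (hq : q ∈ v.domain) (w : CSpace n) :
    dC (v.antiHol h j) q w = Complex.exp (v.regGrad h j (v.moment q) : ℂ)
      * modelForm (v.curv h (v.moment q)) q w j := by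
  have hgrad := v.contDiffAt_regGrad_moment hh j hq
  have hreg := v.contDiffAt_reg hh hq
  have hpart : ∀ k, partialD (v.regGrad h j) k (v.moment q)
      = ∑ i, v.mat⁻¹ i j * hessian (v.reg h) (v.moment q) i k := by
    intro k
    have hd : ∀ i, DifferentiableAt ℝ (partialD (v.reg h) i) (v.moment q) := fun i =>
      (contDiffAt_partialD hreg i).differentiableAt (by simp)
    have : HasFDerivAt (v.regGrad h j) _ (v.moment q) :=
      HasFDerivAt.fun_sum fun i (_ : i ∈ Finset.univ) => (hd i).hasFDerivAt.const_mul (v.mat⁻¹ i j)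
    rw [partialD, this.fderiv, sum_apply]
    rfl
  have hcurv : (cMat (v.curv h (v.moment q)) *ᵥ dXi q w) j
      = ∑ k, (partialD (v.regGrad h j) k (v.moment q) : ℂ) * (cMat v.mat⁻¹ *ᵥ dXi q w) k := by
    rw [curv, cMat_mul, ← Matrix.mulVec_mulVec]
    change ∑ k, cMat (v.mat⁻¹ᵀ * hessian (v.reg h) (v.moment q)) j k * _ = _
    refine Finset.sum_congr rfl fun k _ => ?_
    rw [hpart]
    rfl
  have h1 := dC_mul ((contDiff_zbar j).contDiffAt.differentiableAt (x := q) (by simp))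
    (hgrad.cexp.differentiableAt (by simp)) w
  change dC (fun q => zbar q j * Complex.exp (v.regGrad h j (v.moment q) : ℂ)) q w = _
  rw [h1, dC_cexp (hgrad.differentiableAt (by simp)), dC_zbar, v.dC_comp_moment
    ((v.contDiffAt_regGrad hh j hq).differentiableAt (by simp)), ← hcurv, modelForm_apply]
  ring

theorem IsAdmissible.involutiveOn {g h : (Fin n → ℝ) → ℝ} (H : Δ.IsAdmissible g h)
    (v : Δ.Vertex) : InvolutiveOn (Δ.kahlerPol g v) v.domain := by
  refine involutiveOn_of_functions fun q hq => ⟨v.antiHol h,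
    fun i => v.contDiffAt_antiHol H.smooth i hq, Filter.Eventually.of_forall ?_, ?_⟩
  · intro q' hq' u hu i
    rw [H.kahlerPol_eq v hq'] at hu
    rw [v.dC_antiHol H.smooth i hq', mem_modelPol.mp hu i, mul_zero]
  · intro u hu
    rw [H.kahlerPol_eq v hq]
    refine mem_modelPol.mpr fun j => ?_
    have := hu j
    rw [v.dC_antiHol H.smooth j hq] at this
    exact (mul_eq_zero.mp this).resolve_left (Complex.exp_ne_zero _)

theorem Vertex.contDiffOn_cMat_curv (v : Δ.Vertex) {h : (Fin n → ℝ) → ℝ} (hh : ContDiff ℝ ∞ h)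
    (i j : Fin n) : ContDiffOn ℝ ∞ (fun q => cMat (v.curv h (v.moment q)) i j) v.domain :=
  Complex.ofRealCLM.contDiff.comp_contDiffOn
    ((v.contDiffOn_curv hh i j).comp v.contDiff_moment.contDiffOn fun _ hq => hq)

theorem contDiff_ofReal_fst (k : Fin n) : ContDiff ℝ ∞ fun q : RSpace n => (q.1 k : ℂ) :=
  Complex.ofRealCLM.contDiff.comp (by fun_prop)

theorem contDiff_ofReal_snd (k : Fin n) : ContDiff ℝ ∞ fun q : RSpace n => (q.2 k : ℂ) :=
  Complex.ofRealCLM.contDiff.comp (by fun_prop)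

theorem IsAdmissible.smoothOn {g h : (Fin n → ℝ) → ℝ} (H : Δ.IsAdmissible g h)
    (v : Δ.Vertex) : SmoothOn (Δ.kahlerPol g v) v.domain := by
  intro q hq
  refine ⟨v.domain, v.isOpen_domain, hq,
    fun i q => modelFrame (v.curv h (v.moment q)) q (Pi.basisFun ℂ (Fin n) i), fun i => ?_, ?_⟩
  · have hw : ∀ k, ContDiffOn ℝ ∞ (fun q => (cMat (v.curv h (v.moment q)) *ᵥ
        fun k => zbar q k * Pi.basisFun ℂ (Fin n) i k) k) v.domain := by
      intro k
      simp only [Matrix.mulVec, dotProduct]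
      exact ContDiffOn.sum fun j _ => (v.contDiffOn_cMat_curv H.smooth k j).mul
        ((contDiff_zbar j).contDiffOn.mul contDiffOn_const)
    refine ContDiffOn.prodMk (contDiffOn_pi.mpr fun k => ?_) (contDiffOn_pi.mpr fun k => ?_)
    · exact contDiffOn_const.add (contDiffOn_const.mul
        ((contDiff_ofReal_snd k).contDiffOn.mul (hw k)))
    · exact contDiffOn_const.add (contDiffOn_const.mul
        ((contDiff_ofReal_fst k).contDiffOn.mul (hw k))).neg
  · rintro q' ⟨hq', -⟩
    refine ⟨(Pi.basisFun ℂ (Fin n)).linearIndependent.map' _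
      (LinearMap.ker_eq_bot.mpr (modelFrame_injective _ _)), ?_⟩
    rw [H.kahlerPol_eq v hq', ← range_modelFrame, LinearMap.range_eq_map,
      ← (Pi.basisFun ℂ (Fin n)).span_eq, Submodule.map_span, ← Set.range_comp]
    rfl

theorem IsAdmissible.isKahler {g h : (Fin n → ℝ) → ℝ} (H : Δ.IsAdmissible g h) :
    (Δ.kahlerPol g).IsKahler := by
  refine ⟨H.isGlobal, fun v => ⟨fun q hq => H.isLagrangian v hq, H.smoothOn v, H.involutiveOn v,
    fun q hq w hw hw0 => ?_⟩⟩
  rw [H.kahlerPol_eq v hq, ← range_modelFrame] at hw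
  obtain ⟨c, rfl⟩ := hw
  have hc : c ≠ 0 := by
    rintro rfl
    exact hw0 (map_zero _)
  rw [omega_modelFrame_conjVec (v.curv_transpose H.smooth hq)]
  have h1 := H.pos v q hq c hc
  generalize star c ⬝ᵥ c + star (fun k => zbar q k * c k) ⬝ᵥ
      (cMat (v.curv h (v.moment q)) *ᵥ fun k => zbar q k * c k) = X at *
  have : (2 * Complex.I * X).im = 2 * X.re := by simp
  rw [this]
  linarith

end DelzantPolytope

namespace DelzantPolytope

variable {n : ℕ} {Δ : DelzantPolytope n}

/-! ### Positivity at the boundary of the polytope -/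

/-- The matrix of the Hermitian form of the model polarization, in the frame `modelFrame`. -/
def hermMat (K : Matrix (Fin n) (Fin n) ℝ) (q : RSpace n) : Matrix (Fin n) (Fin n) ℂ :=
  1 + Matrix.diagonal (star (zbar q)) * cMat K * Matrix.diagonal (zbar q)

theorem star_dotProduct_hermMat (K : Matrix (Fin n) (Fin n) ℝ) (q : RSpace n) (c : Fin n → ℂ) :
    star c ⬝ᵥ (hermMat K q *ᵥ c) = star c ⬝ᵥ c
      + star (fun k => zbar q k * c k) ⬝ᵥ (cMat K *ᵥ fun k => zbar q k * c k) := by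
  have h : Matrix.diagonal (zbar q) *ᵥ c = fun k => zbar q k * c k := by
    ext k
    rw [Matrix.mulVec_diagonal]
  rw [hermMat, Matrix.add_mulVec, dotProduct_add, Matrix.one_mulVec, ← Matrix.mulVec_mulVec,
    ← Matrix.mulVec_mulVec, h]
  congr 1
  simp only [dotProduct, Matrix.mulVec_diagonal, Pi.star_apply, star_mul']
  exact Finset.sum_congr rfl fun k _ => by ring

theorem isHermitian_hermMat {K : Matrix (Fin n) (Fin n) ℝ} (hK : Kᵀ = K) (q : RSpace n) :
    (hermMat K q).IsHermitian := by
  rw [Matrix.IsHermitian, hermMat, Matrix.conjTranspose_add, Matrix.conjTranspose_mul,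
    Matrix.conjTranspose_mul, Matrix.diagonal_conjTranspose, Matrix.diagonal_conjTranspose,
    cMat_conjTranspose, ← cMat_transpose, hK, star_star, Matrix.conjTranspose_one, Matrix.mul_assoc]

theorem zbar_mul_star (q : RSpace n) (k : Fin n) :
    star (zbar q k) * zbar q k = ((q.1 k ^ 2 + q.2 k ^ 2 : ℝ) : ℂ) := by
  have : star (zbar q k) = q.1 k + q.2 k * Complex.I := by simp [zbar]
  rw [this, zbar]
  push_cast
  linear_combination (-(q.2 k : ℂ) ^ 2) * Complex.I_sq

/-- On the open orbit the Hermitian form is the Hessian of the potential. -/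
theorem Vertex.hermMat_eq (v : Δ.Vertex) {g h : (Fin n → ℝ) → ℝ} (hh : ContDiff ℝ ∞ h)
    (hg : ∀ x ∈ Δ.inside, g x = Δ.guillemin x + h x) {q : RSpace n} (hq : q ∈ v.chartInterior) :
    hermMat (v.curv h (v.moment q)) q = Matrix.diagonal (star (zbar q))
      * cMat (v.mat⁻¹ᵀ * hessian g (v.moment q) * v.mat⁻¹) * Matrix.diagonal (zbar q) := by
  have hT : v.mat⁻¹ᵀ * v.matᵀ = 1 := by
    rw [← Matrix.transpose_mul, v.mat_mul_inv, Matrix.transpose_one]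
  have h1 : v.mat⁻¹ᵀ * hessian g (v.moment q) * v.mat⁻¹ = v.curv h (v.moment q)
      + Matrix.diagonal fun k => (2 * Δ.l (v.facet k) (v.moment q))⁻¹ := by
    rw [v.hessian_potential hh hg (v.moment_mem_inside hq), ← Matrix.mul_assoc, ← Matrix.mul_assoc,
      hT, Matrix.one_mul, Matrix.mul_assoc, v.mat_mul_inv, Matrix.mul_one]
  have h2 : cMat (Matrix.diagonal fun k => (2 * Δ.l (v.facet k) (v.moment q))⁻¹)
      = Matrix.diagonal fun k => (((q.1 k ^ 2 + q.2 k ^ 2)⁻¹ : ℝ) : ℂ) := by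
    ext i k
    rw [cMat, Matrix.map_apply, Matrix.diagonal_apply, Matrix.diagonal_apply, v.l_moment]
    split_ifs
    · congr 2
      ring
    · simp
  rw [h1, cMat_add, h2, Matrix.mul_add, Matrix.add_mul, hermMat, add_comm]
  congr 1
  rw [Matrix.diagonal_mul_diagonal, Matrix.diagonal_mul_diagonal, ← Matrix.diagonal_one]
  congr 1
  ext k
  have h3 := zbar_mul_star q k
  have h4 : ((q.1 k ^ 2 + q.2 k ^ 2 : ℝ) : ℂ) ≠ 0 := by exact_mod_cast hq.2 k
  rw [Pi.star_apply, mul_right_comm, h3, Complex.ofReal_inv, mul_inv_cancel₀ h4]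

theorem Vertex.hermMat_re_pos (v : Δ.Vertex) {g h : (Fin n → ℝ) → ℝ} (hh : ContDiff ℝ ∞ h)
    (hg : ∀ x ∈ Δ.inside, g x = Δ.guillemin x + h x)
    (hpd : ∀ x ∈ Δ.inside, (hessian g x).PosDef) {q : RSpace n} (hq : q ∈ v.chartInterior)
    {c : Fin n → ℂ} (hc : c ≠ 0) :
    0 < (star c ⬝ᵥ (hermMat (v.curv h (v.moment q)) q *ᵥ c)).re := by
  have hz : Matrix.diagonal (zbar q) *ᵥ c = fun k => zbar q k * c k := by
    ext k
    rw [Matrix.mulVec_diagonal]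
  set η : Fin n → ℂ := fun k => zbar q k * c k with hη
  have h1 : star c ⬝ᵥ (hermMat (v.curv h (v.moment q)) q *ᵥ c)
      = star (cMat v.mat⁻¹ *ᵥ η) ⬝ᵥ (cMat (hessian g (v.moment q)) *ᵥ (cMat v.mat⁻¹ *ᵥ η)) := by
    rw [v.hermMat_eq hh hg hq, ← Matrix.mulVec_mulVec, ← Matrix.mulVec_mulVec, hz, cMat_mul,
      cMat_mul, Matrix.star_mulVec, cMat_conjTranspose, ← Matrix.mulVec_mulVec,
      ← Matrix.mulVec_mulVec, cMat_transpose, ← Matrix.dotProduct_mulVec]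
    simp only [dotProduct, Matrix.mulVec_diagonal, Pi.star_apply, star_mul', hη]
    exact Finset.sum_congr rfl fun k _ => by ring
  rw [h1]
  refine re_star_dotProduct_pos (hpd _ (v.moment_mem_inside hq)) fun h0 => hc ?_
  have h2 := congrArg (fun z => cMat v.mat *ᵥ z) h0
  simp only [Matrix.mulVec_mulVec, ← cMat_mul, v.mat_mul_inv, cMat_one, Matrix.one_mulVec,
    Matrix.mulVec_zero] at h2
  ext k
  exact (mul_eq_zero.mp (congrFun h2 k)).resolve_left (zbar_ne_zero (hq.2 k))

theorem Vertex.continuousAt_hermMat (v : Δ.Vertex) {h : (Fin n → ℝ) → ℝ} (hh : ContDiff ℝ ∞ h)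
    {q : RSpace n} (hq : q ∈ v.domain) :
    ContinuousAt (fun q' => hermMat (v.curv h (v.moment q')) q') q := by
  have hz : Continuous fun q' : RSpace n => zbar q' := continuous_pi fun k => continuous_zbar k
  have h1 : Continuous fun q' : RSpace n => Matrix.diagonal (star (zbar q')) :=
    (continuous_star.comp hz).matrix_diagonal
  have h2 : Continuous fun q' : RSpace n => Matrix.diagonal (zbar q') := hz.matrix_diagonal
  unfold hermMat
  exact continuousAt_const.add ((h1.continuousAt.mul (v.continuousAt_cMat_curv hh hq)).mul
    h2.continuousAt)

open Classical in
/-- The determinant condition on a symplectic potential, extended to the whole chart. -/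
theorem Vertex.det_hermMat (v : Δ.Vertex) {g h δ : (Fin n → ℝ) → ℝ} (hh : ContDiff ℝ ∞ h)
    (hg : ∀ x ∈ Δ.inside, g x = Δ.guillemin x + h x) (hδ : ContDiff ℝ ∞ δ)
    (hpos : ∀ x ∈ Δ.polytope, 0 < δ x)
    (hdet : ∀ x ∈ Δ.inside, (hessian g x).det = (δ x * ∏ r, Δ.l r x)⁻¹) {q : RSpace n}
    (hq : q ∈ v.domain) :
    (hermMat (v.curv h (v.moment q)) q).det
      * ((δ (v.moment q) * ∏ r ∈ Finset.univ.filter (fun r => r ∉ Set.range v.facet),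
        Δ.l r (v.moment q) : ℝ) : ℂ) = 2 ^ n * ((v.mat⁻¹.det ^ 2 : ℝ) : ℂ) := by
  have hne := v.neBot_chartInterior hq
  have hcont : ContinuousAt (fun q => (hermMat (v.curv h (v.moment q)) q).det
      * ((δ (v.moment q) * ∏ r ∈ Finset.univ.filter (fun r => r ∉ Set.range v.facet),
        Δ.l r (v.moment q) : ℝ) : ℂ)) q := by
    have h1 : ContinuousAt (fun q => (hermMat (v.curv h (v.moment q)) q).det) q :=
      ContinuousAt.comp (g := Matrix.det) (Continuous.matrix_det continuous_id).continuousAt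
        (v.continuousAt_hermMat hh hq)
    have hm := v.contDiff_moment.continuous
    have hl : ∀ r, Continuous fun q => Δ.l r (v.moment q) := fun r =>
      (Δ.contDiff_l r).continuous.comp hm
    have h2 : Continuous fun q => ((δ (v.moment q) *
        ∏ r ∈ Finset.univ.filter (fun r => r ∉ Set.range v.facet),
        Δ.l r (v.moment q) : ℝ) : ℂ) :=
      Complex.continuous_ofReal.comp ((hδ.continuous.comp hm).mul
        (continuous_finsetProd _ fun r _ => hl r))
    exact h1.mul h2.continuousAt
  refine tendsto_nhds_unique (hcont.tendsto.mono_left (nhdsWithin_le_nhds (s := v.chartInterior)))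
    (tendsto_const_nhds.congr' ?_)
  filter_upwards [self_mem_nhdsWithin] with q' hi
  have hx := v.moment_mem_inside hi
  have himg : Finset.univ.filter (fun r => r ∈ Set.range v.facet)
      = Finset.univ.image v.facet := by
    ext r
    simp
  have hprod : ∏ r, Δ.l r (v.moment q') = (∏ k, (q'.1 k ^ 2 + q'.2 k ^ 2) / 2)
      * ∏ r ∈ Finset.univ.filter (fun r => r ∉ Set.range v.facet), Δ.l r (v.moment q') := by
    rw [← Finset.prod_filter_mul_prod_filter_not Finset.univ (fun r => r ∈ Set.range v.facet),
      himg, Finset.prod_image fun a _ b _ h => v.injective h]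
    simp only [v.l_moment]
  have hne1 : ∏ r ∈ Finset.univ.filter (fun r => r ∉ Set.range v.facet),
      Δ.l r (v.moment q') ≠ 0 := Finset.prod_ne_zero_iff.mpr fun r _ => (hx r).ne'
  have hne2 : δ (v.moment q') ≠ 0 := (hpos _ fun r => (hx r).le).ne'
  have hne3 : ∏ k, (q'.1 k ^ 2 + q'.2 k ^ 2) ≠ 0 := Finset.prod_ne_zero_iff.mpr fun k _ => hi.2 k
  have hcd : ∀ A : Matrix (Fin n) (Fin n) ℝ, (cMat A).det = (A.det : ℂ) := fun A =>
    (RingHom.map_det Complex.ofRealHom A).symm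
  have hzz : (∏ k, star (zbar q') k) * ∏ k, zbar q' k
      = ((∏ k, (q'.1 k ^ 2 + q'.2 k ^ 2) : ℝ) : ℂ) := by
    rw [← Finset.prod_mul_distrib, Complex.ofReal_prod]
    exact Finset.prod_congr rfl fun k _ => zbar_mul_star q' k
  rw [v.hermMat_eq hh hg hi, Matrix.det_mul, Matrix.det_mul, Matrix.det_diagonal,
    Matrix.det_diagonal, mul_right_comm (∏ k, star (zbar q') k), hzz, hcd, Matrix.det_mul,
    Matrix.det_mul, Matrix.det_transpose, hdet _ hx, hprod, Finset.prod_div_distrib,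
    Finset.prod_const, Finset.card_univ, Fintype.card_fin]
  norm_cast
  push_cast
  field_simp

open ComplexOrder in
/-- The Hermitian form of the polarization of a symplectic potential is positive definite on the
whole chart: it is semidefinite by continuity, and its determinant does not vanish by the condition
on `det G`. -/
theorem isAdmissible_of_isSymplecticPotential {g : (Fin n → ℝ) → ℝ}
    (H : Δ.IsSymplecticPotential g) : ∃ h, Δ.IsAdmissible g h := by
  classical
  obtain ⟨⟨h, hh, hg⟩, hpd, δ, hδ, hpos, hdet⟩ := H
  refine ⟨h, hh, hg, hpd, fun v q hq c hc => ?_⟩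
  have hherm := isHermitian_hermMat (v.curv_transpose hh hq) q
  have him : ∀ x : Fin n → ℂ,
      (star x ⬝ᵥ (hermMat (v.curv h (v.moment q)) q *ᵥ x)).im = 0 := by
    intro x
    exact hherm.im_star_dotProduct_mulVec_self x
  -- the form is positive semidefinite, as a limit of positive definite forms
  have hsemi : (hermMat (v.curv h (v.moment q)) q).PosSemidef := by
    refine Matrix.PosSemidef.of_dotProduct_mulVec_nonneg hherm fun x => ?_
    rw [Complex.nonneg_iff]
    refine ⟨?_, (him x).symm⟩
    have hne := v.neBot_chartInterior hq
    have hlim : ContinuousAt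
        (fun q' => (star x ⬝ᵥ (hermMat (v.curv h (v.moment q')) q' *ᵥ x)).re) q := by
      have hc' : Continuous fun M : Matrix (Fin n) (Fin n) ℂ => (star x ⬝ᵥ (M *ᵥ x)).re := by
        simp only [dotProduct, Matrix.mulVec]
        fun_prop
      exact ContinuousAt.comp (g := fun M : Matrix (Fin n) (Fin n) ℂ => (star x ⬝ᵥ (M *ᵥ x)).re)
        hc'.continuousAt (v.continuousAt_hermMat hh hq)
    refine ge_of_tendsto
      (hlim.tendsto.mono_left (nhdsWithin_le_nhds (s := v.chartInterior))) ?_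
    filter_upwards [self_mem_nhdsWithin] with q' hi
    by_cases hx : x = 0
    · simp [hx]
    · exact (v.hermMat_re_pos hh hg hpd hi hx).le
  have hdet0 : (hermMat (v.curv h (v.moment q)) q).det ≠ 0 := by
    intro h0
    have h1 := v.det_hermMat hh hg hδ hpos hdet hq
    rw [h0, zero_mul] at h1
    have h2 : v.mat⁻¹.det ≠ 0 := (Matrix.isUnit_nonsing_inv_det _ v.isUnit_det).ne_zero
    have h3 : (2 : ℂ) ^ n * ((v.mat⁻¹.det ^ 2 : ℝ) : ℂ) ≠ 0 :=
      mul_ne_zero (pow_ne_zero _ two_ne_zero) (by exact_mod_cast pow_ne_zero 2 h2)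
    exact h3 h1.symm
  have hpd' := (hsemi.posDef_iff_det_ne_zero).mpr hdet0
  have := hpd'.dotProduct_mulVec_pos hc
  rw [star_dotProduct_hermMat] at this
  exact (Complex.pos_iff.mp this).1

theorem posDef_add_gram {G C : Matrix (Fin n) (Fin n) ℝ} (hG : G.PosDef) {s : ℝ} (hs : 0 ≤ s) :
    (G + s • (Cᵀ * C)).PosDef := by
  refine hG.add_posSemidef (Matrix.PosSemidef.smul ?_ hs)
  have := Matrix.posSemidef_conjTranspose_mul_self C
  rwa [Matrix.conjTranspose_eq_transpose_of_trivial] at this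

theorem IsAdmissible.contDiffAt {g h : (Fin n → ℝ) → ℝ} (H : Δ.IsAdmissible g h)
    {x : Fin n → ℝ} (hx : x ∈ Δ.inside) : ContDiffAt ℝ ∞ g x := by
  obtain ⟨v, -⟩ := Δ.exists_vertex (x := x) fun r => (hx r).le
  exact v.contDiffAt_potential H.smooth H.eq hx

/-- Adding a nonnegative multiple of the convex function `H` keeps a potential admissible. -/
theorem IsAdmissible.potAt {g h : (Fin n → ℝ) → ℝ} (H : Δ.IsAdmissible g h)
    (B : Matrix.SpecialLinearGroup (Fin n) ℤ) (p : ℕ) {s : ℝ} (hs : 0 ≤ s) :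
    Δ.IsAdmissible (potAt B p g s) (potAt B p h s) where
  smooth := H.smooth.add (contDiff_const.mul (contDiff_hamH B p))
  eq x hx := by
    rw [ToricPol.potAt, ToricPol.potAt, H.eq x hx, add_assoc]
  posDef x hx := by
    rw [hessian_potAt B p s (H.contDiffAt hx)]
    exact posDef_add_gram (H.posDef x hx) hs
  pos v q hq c hc := by
    rw [v.curv_potAt B p H.smooth s hq, cMat_add, cMat_smul, Matrix.add_mulVec, Matrix.smul_mulVec,
      dotProduct_add, dotProduct_smul, ← add_assoc, Complex.add_re, smul_eq_mul,
      Complex.re_ofReal_mul]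
    exact add_pos_of_pos_of_nonneg (H.pos v q hq c hc)
      (mul_nonneg hs (re_star_dotProduct_gram_nonneg _ _))

end DelzantPolytope

section

variable {n : ℕ}

/-! ### The coordinates attached to an integral change of basis -/

/-- The coefficients of `dx̃_j`, and of `∂/∂θ̃_j`. -/
def rowC (B : Matrix.SpecialLinearGroup (Fin n) ℤ) (j : Fin n) : Fin n → ℂ :=
  fun k => ((B.1 j k : ℝ) : ℂ)

/-- The coefficients of `dθ̃_j`, and of `∂/∂x̃_j`. -/
def colC (B : Matrix.SpecialLinearGroup (Fin n) ℤ) (j : Fin n) : Fin n → ℂ :=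
  fun k => (((B⁻¹).1 k j : ℝ) : ℂ)

theorem sum_mul_inv (B : Matrix.SpecialLinearGroup (Fin n) ℤ) (i j : Fin n) :
    ∑ k, B.1 i k * (B⁻¹).1 k j = if i = j then 1 else 0 := by
  have h : (B * B⁻¹).1 i j = (1 : Matrix.SpecialLinearGroup (Fin n) ℤ).1 i j := by
    rw [mul_inv_cancel]
  rw [Matrix.SpecialLinearGroup.coe_mul, Matrix.mul_apply] at h
  rw [h]
  exact Matrix.one_apply

theorem sum_inv_mul (B : Matrix.SpecialLinearGroup (Fin n) ℤ) (i j : Fin n) :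
    ∑ k, (B⁻¹).1 i k * B.1 k j = if i = j then 1 else 0 := by
  have h := sum_mul_inv B⁻¹ i j
  rwa [inv_inv] at h

theorem rowC_dotProduct_colC (B : Matrix.SpecialLinearGroup (Fin n) ℤ) (i j : Fin n) :
    rowC B i ⬝ᵥ colC B j = if i = j then 1 else 0 := by
  have h := congrArg (fun z : ℤ => (z : ℂ)) (sum_mul_inv B i j)
  simp only [Int.cast_sum, Int.cast_mul, Int.cast_ite, Int.cast_one, Int.cast_zero] at h
  rw [← h]
  simp [rowC, colC, dotProduct]

theorem sum_colC (B : Matrix.SpecialLinearGroup (Fin n) ℤ) (w : Fin n → ℂ) :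
    ∑ j, (rowC B j ⬝ᵥ w) • colC B j = w := by
  ext i
  have h : ∀ k, ∑ j, (((B⁻¹).1 i j : ℝ) : ℂ) * ((B.1 j k : ℝ) : ℂ) = if i = k then 1 else 0 := by
    intro k
    have h := congrArg (fun z : ℤ => (z : ℂ)) (sum_inv_mul B i k)
    simp only [Int.cast_sum, Int.cast_mul, Int.cast_ite, Int.cast_one, Int.cast_zero] at h
    rw [← h]
    simp
  simp only [Finset.sum_apply, Pi.smul_apply, smul_eq_mul, dotProduct, Finset.sum_mul]
  rw [Finset.sum_comm]
  have h2 : ∀ k, ∑ j, rowC B j k * w k * colC B j i = (if i = k then 1 else 0) * w k := by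
    intro k
    rw [← h, Finset.sum_mul]
    exact Finset.sum_congr rfl fun j _ => by rw [rowC, colC]; ring
  simp [h2]

theorem sum_rowC (B : Matrix.SpecialLinearGroup (Fin n) ℤ) (w : Fin n → ℂ) :
    ∑ j, (colC B j ⬝ᵥ w) • rowC B j = w := by
  ext i
  have h : ∀ k, ∑ j, (((B⁻¹).1 k j : ℝ) : ℂ) * ((B.1 j i : ℝ) : ℂ) = if k = i then 1 else 0 := by
    intro k
    have h := congrArg (fun z : ℤ => (z : ℂ)) (sum_inv_mul B k i)
    simp only [Int.cast_sum, Int.cast_mul, Int.cast_ite, Int.cast_one, Int.cast_zero] at h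
    rw [← h]
    simp
  simp only [Finset.sum_apply, Pi.smul_apply, smul_eq_mul, dotProduct, Finset.sum_mul]
  rw [Finset.sum_comm]
  have h2 : ∀ k, ∑ j, colC B j k * w k * rowC B j i = (if k = i then 1 else 0) * w k := by
    intro k
    rw [← h, Finset.sum_mul]
    exact Finset.sum_congr rfl fun j _ => by rw [rowC, colC]; ring
  simp [h2]

theorem dtheta_eq (B : Matrix.SpecialLinearGroup (Fin n) ℤ) (j : Fin n) :
    dtheta B j = (0, rowC B j) := rfl

theorem dC_xt (B : Matrix.SpecialLinearGroup (Fin n) ℤ) (j : Fin n) (y : RSpace n)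
    (w : CSpace n) : dC (fun y' => (xt B j y'.1 : ℂ)) y w = rowC B j ⬝ᵥ w.1 := by
  have h : HasFDerivAt (fun y' : RSpace n => xt B j y'.1) _ y :=
    (hasFDerivAt_xt B j y.1).comp y (hasFDerivAt_fst (𝕜 := ℝ))
  rw [dC_ofReal h]
  simp only [ContinuousLinearMap.comp_apply, sum_apply, smul_apply,
    ContinuousLinearMap.proj_apply, ContinuousLinearMap.coe_fst', smul_eq_mul, dotProduct, rowC]
  push_cast
  rw [Finset.mul_sum, ← Finset.sum_add_distrib]
  refine Finset.sum_congr rfl fun k _ => ?_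
  have := Complex.re_add_im (w.1 k)
  simp only [rePart, imPart]
  linear_combination ((B.1 j k : ℂ)) * this

theorem dC_thetat (B : Matrix.SpecialLinearGroup (Fin n) ℤ) (j : Fin n) (y : RSpace n)
    (w : CSpace n) : dC (fun y' => (thetat B j y'.2 : ℂ)) y w = colC B j ⬝ᵥ w.2 := by
  have h0 : HasFDerivAt (thetat B j) (∑ i, ((B⁻¹).1 i j : ℝ) •
      ContinuousLinearMap.proj (R := ℝ) (φ := fun _ => ℝ) i) y.2 := by
    unfold thetat
    refine HasFDerivAt.fun_sum fun i _ => ?_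
    exact (ContinuousLinearMap.proj (R := ℝ) (φ := fun _ => ℝ) i).hasFDerivAt.const_mul _
  have h : HasFDerivAt (fun y' : RSpace n => thetat B j y'.2) _ y :=
    h0.comp y (hasFDerivAt_snd (𝕜 := ℝ))
  rw [dC_ofReal h]
  simp only [ContinuousLinearMap.comp_apply, sum_apply, smul_apply,
    ContinuousLinearMap.proj_apply, ContinuousLinearMap.coe_snd', smul_eq_mul, dotProduct, colC]
  push_cast
  rw [Finset.mul_sum, ← Finset.sum_add_distrib]
  refine Finset.sum_congr rfl fun k _ => ?_
  have := Complex.re_add_im (w.2 k)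
  simp only [rePart, imPart]
  linear_combination (((B⁻¹).1 k j : ℂ)) * this

theorem differentiableAt_thetat (B : Matrix.SpecialLinearGroup (Fin n) ℤ) (j : Fin n)
    (y : RSpace n) : DifferentiableAt ℝ (fun y' : RSpace n => (thetat B j y'.2 : ℂ)) y := by
  unfold thetat
  have : Differentiable ℝ fun y' : RSpace n => ∑ k, ((B⁻¹).1 k j : ℝ) * y'.2 k := by fun_prop
  exact Complex.ofRealCLM.differentiableAt.comp y this.differentiableAt

theorem yt_eq (B : Matrix.SpecialLinearGroup (Fin n) ℤ) (g : (Fin n → ℝ) → ℝ) (j : Fin n) :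
    yt B g j = fun x => ∑ k, ((B⁻¹).1 k j : ℝ) * partialD g k x := by
  ext x
  exact fderiv_eq_sum_partialD g x _

theorem differentiableAt_yt (B : Matrix.SpecialLinearGroup (Fin n) ℤ) {g : (Fin n → ℝ) → ℝ}
    {x : Fin n → ℝ} (hg : ContDiffAt ℝ ∞ g x) (j : Fin n) : DifferentiableAt ℝ (yt B g j) x := by
  rw [yt_eq]
  exact DifferentiableAt.fun_sum fun k _ =>
    ((contDiffAt_partialD hg k).differentiableAt (by simp)).const_mul _

theorem dC_yt (B : Matrix.SpecialLinearGroup (Fin n) ℤ) {g : (Fin n → ℝ) → ℝ} {y : RSpace n}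
    (hg : ContDiffAt ℝ ∞ g y.1) (j : Fin n) (w : CSpace n) :
    dC (fun y' => (yt B g j y'.1 : ℂ)) y w = colC B j ⬝ᵥ (cMat (hessian g y.1) *ᵥ w.1) := by
  have h : HasFDerivAt (fun y' : RSpace n => yt B g j y'.1) _ y :=
    (differentiableAt_yt B hg j).hasFDerivAt.comp y (hasFDerivAt_fst (𝕜 := ℝ))
  have hd : ∀ k, DifferentiableAt ℝ (partialD g k) y.1 := fun k =>
    (contDiffAt_partialD hg k).differentiableAt (by simp)
  have h1 : ∀ u : Fin n → ℝ, fderiv ℝ (yt B g j) y.1 u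
      = ∑ k, ((B⁻¹).1 k j : ℝ) * ∑ i, u i * hessian g y.1 k i := by
    intro u
    have h2 : HasFDerivAt (fun x => ∑ k, ((B⁻¹).1 k j : ℝ) * partialD g k x)
        (∑ k, ((B⁻¹).1 k j : ℝ) • fderiv ℝ (partialD g k) y.1) y.1 :=
      HasFDerivAt.fun_sum fun k _ => (hd k).hasFDerivAt.const_mul _
    rw [yt_eq, h2.fderiv, sum_apply]
    refine Finset.sum_congr rfl fun k _ => ?_
    rw [smul_apply, fderiv_eq_sum_partialD]
    rfl
  rw [dC_ofReal h]
  simp only [ContinuousLinearMap.comp_apply, ContinuousLinearMap.coe_fst', h1]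
  simp only [dotProduct, Matrix.mulVec, colC, Complex.ofReal_sum, Complex.ofReal_mul,
    Finset.mul_sum, ← Finset.sum_add_distrib]
  refine Finset.sum_congr rfl fun k _ => Finset.sum_congr rfl fun i _ => ?_
  have := Complex.re_add_im (w.1 i)
  simp only [rePart, imPart, cMat, Matrix.map_apply]
  linear_combination (((B⁻¹).1 k j : ℝ) : ℂ) * hessian g y.1 k i * this

theorem differentiableAt_yt_fst (B : Matrix.SpecialLinearGroup (Fin n) ℤ) {g : (Fin n → ℝ) → ℝ}
    {y : RSpace n} (hg : ContDiffAt ℝ ∞ g y.1) (j : Fin n) :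
    DifferentiableAt ℝ (fun y' : RSpace n => (yt B g j y'.1 : ℂ)) y :=
  Complex.ofRealCLM.differentiableAt.comp y
    (DifferentiableAt.comp (f := Prod.fst) y (differentiableAt_yt B hg j) differentiableAt_fst)

theorem dC_zt (B : Matrix.SpecialLinearGroup (Fin n) ℤ) {g : (Fin n → ℝ) → ℝ} {y : RSpace n}
    (hg : ContDiffAt ℝ ∞ g y.1) (j : Fin n) (w : CSpace n) :
    dC (zt B g j) y w
      = colC B j ⬝ᵥ (cMat (hessian g y.1) *ᵥ w.1) + Complex.I * (colC B j ⬝ᵥ w.2) := by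
  have h := dC_add (differentiableAt_yt_fst B hg j)
    ((differentiableAt_thetat B j y).const_mul Complex.I) w
  rw [dC_const_mul (differentiableAt_thetat B j y), dC_yt B hg, dC_thetat] at h
  exact h

theorem dC_ztbar (B : Matrix.SpecialLinearGroup (Fin n) ℤ) {g : (Fin n → ℝ) → ℝ} {y : RSpace n}
    (hg : ContDiffAt ℝ ∞ g y.1) (j : Fin n) (w : CSpace n) :
    dC (ztbar B g j) y w
      = colC B j ⬝ᵥ (cMat (hessian g y.1) *ᵥ w.1) - Complex.I * (colC B j ⬝ᵥ w.2) := by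
  have heq : ztbar B g j
      = fun y' => (yt B g j y'.1 : ℂ) + (-Complex.I) * (thetat B j y'.2 : ℂ) := by
    ext y'
    simp [ztbar, zt]
  rw [heq, dC_add (differentiableAt_yt_fst B hg j)
    ((differentiableAt_thetat B j y).const_mul (-Complex.I)),
    dC_const_mul (differentiableAt_thetat B j y), dC_yt B hg, dC_thetat]
  ring

theorem cMat_mulVec_single {G : Matrix (Fin n) (Fin n) ℝ} (hG : Gᵀ = G) (u : Fin n → ℂ)
    (k : Fin n) : u ⬝ᵥ (cMat G *ᵥ Pi.single k 1) = (cMat G *ᵥ u) k := by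
  rw [cMat_dotProduct_comm hG, dotProduct_single, mul_one]

theorem hamVec_zt (B : Matrix.SpecialLinearGroup (Fin n) ℤ) {g : (Fin n → ℝ) → ℝ} {y : RSpace n}
    (hg : ContDiffAt ℝ ∞ g y.1) (j : Fin n) :
    hamVec (zt B g j) y = (Complex.I • colC B j, -(cMat (hessian g y.1) *ᵥ colC B j)) := by
  ext k
  · simp [hamVec, dC_zt B hg]
  · simp only [hamVec, dC_zt B hg, cMat_mulVec_single (hessian_transpose hg), Pi.neg_apply]
    simp

theorem hamVec_ztbar (B : Matrix.SpecialLinearGroup (Fin n) ℤ) {g : (Fin n → ℝ) → ℝ}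
    {y : RSpace n} (hg : ContDiffAt ℝ ∞ g y.1) (j : Fin n) :
    hamVec (ztbar B g j) y
      = ((-Complex.I) • colC B j, -(cMat (hessian g y.1) *ᵥ colC B j)) := by
  ext k
  · simp [hamVec, dC_ztbar B hg]
  · simp only [hamVec, dC_ztbar B hg, cMat_mulVec_single (hessian_transpose hg), Pi.neg_apply]
    simp

/-- Vectors whose first components are nonzero multiples of the fields `∂/∂x̃_j` are independent. -/
theorem linearIndependent_of_fst (B : Matrix.SpecialLinearGroup (Fin n) ℤ) {a : Fin n → ℂ}
    (ha : ∀ j, a j ≠ 0) {u : Fin n → CSpace n} (hu : ∀ j, (u j).1 = a j • colC B j) :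
    LinearIndependent ℂ u := by
  rw [Fintype.linearIndependent_iff]
  intro c hc i
  have h1 := congrArg (fun w : CSpace n => rowC B i ⬝ᵥ w.1) hc
  simp only [Prod.fst_sum, Prod.smul_fst, hu, dotProduct_sum, dotProduct_smul,
    rowC_dotProduct_colC, Prod.fst_zero, dotProduct_zero] at h1
  simpa [ha i] using h1

theorem toricT10_eq_span (B : Matrix.SpecialLinearGroup (Fin n) ℤ) {g : (Fin n → ℝ) → ℝ}
    {y : RSpace n} (hg : ContDiffAt ℝ ∞ g y.1) (hG : (hessian g y.1).PosDef) :
    toricT10 g y = Submodule.span ℂ (Set.range fun j => hamVec (ztbar B g j) y) := by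
  apply le_antisymm
  · intro w hw
    rw [mem_toricT10 hG] at hw
    have hsum : w = ∑ j, (Complex.I * (rowC B j ⬝ᵥ w.1)) • hamVec (ztbar B g j) y := by
      have h1 : w.1 = ∑ j, (rowC B j ⬝ᵥ w.1) • colC B j := (sum_colC B w.1).symm
      have h2 : w.2 = (-Complex.I) • (cMat (hessian g y.1) *ᵥ w.1) := by
        rw [hw, smul_smul, neg_mul, Complex.I_mul_I, neg_neg, one_smul]
      refine Prod.ext ?_ ?_
      · rw [Prod.fst_sum]
        conv_lhs => rw [h1]
        refine Finset.sum_congr rfl fun j _ => ?_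
        rw [hamVec_ztbar B hg, Prod.smul_fst, smul_smul]
        congr 1
        linear_combination (rowC B j ⬝ᵥ w.1) * Complex.I_sq
      · rw [Prod.snd_sum, h2]
        conv_lhs => rw [h1, ← Matrix.mulVecLin_apply, map_sum, Finset.smul_sum]
        refine Finset.sum_congr rfl fun j _ => ?_
        rw [hamVec_ztbar B hg, Prod.smul_snd, map_smul, Matrix.mulVecLin_apply, smul_smul,
          smul_neg, neg_mul, neg_smul]
    rw [hsum]
    exact Submodule.sum_mem _ fun j _ => Submodule.smul_mem _ _ (Submodule.subset_span ⟨j, rfl⟩)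
  · refine Submodule.span_le.mpr ?_
    rintro _ ⟨j, rfl⟩
    refine (mem_toricT10 hG).mpr ?_
    simp only [hamVec_ztbar B hg, Matrix.mulVec_smul, Matrix.mulVec_neg, neg_smul, smul_neg]

/-! ### The flow of the Hamiltonian in imaginary time -/

theorem partialD_hamH (B : Matrix.SpecialLinearGroup (Fin n) ℤ) (p : ℕ) (k : Fin n)
    (x : Fin n → ℝ) :
    partialD (hamH B p) k x = ∑ j : Fin n, if j.val < p then xt B j x * (B.1 j k : ℝ) else 0 := by
  have h : ∀ j : Fin n, HasFDerivAt (fun y => if j.val < p then xt B j y ^ 2 else 0)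
      (if j.val < p then (2 * xt B j x) • ∑ i, (B.1 j i : ℝ) •
        ContinuousLinearMap.proj (R := ℝ) (φ := fun _ => ℝ) i else 0) x := by
    intro j
    by_cases hj : j.val < p
    · simp only [hj, if_true]
      simpa using (hasFDerivAt_xt B j x).pow 2
    · simp only [hj, if_false]
      exact hasFDerivAt_const _ _
  have h2 : HasFDerivAt (hamH B p) _ x := (HasFDerivAt.fun_sum fun j _ => h j).const_mul (1 / 2)
  rw [partialD, h2.fderiv, smul_apply, sum_apply, smul_eq_mul, Finset.mul_sum]
  refine Finset.sum_congr rfl fun j _ => ?_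
  by_cases hj : j.val < p
  · simp only [hj, if_true, smul_apply, sum_apply, smul_eq_mul, ContinuousLinearMap.proj_apply]
    simp [Pi.single_apply]
    ring
  · simp [hj]

theorem hamVec_hamH (B : Matrix.SpecialLinearGroup (Fin n) ℤ) (p : ℕ) (y : RSpace n) :
    hamVec (fun y' => ((hamH B p y'.1 : ℝ) : ℂ)) y
      = (0, -∑ j : Fin n, if j.val < p then (xt B j y.1 : ℂ) • rowC B j else 0) := by
  have hd : HasFDerivAt (fun y' : RSpace n => hamH B p y'.1) _ y :=
    HasFDerivAt.comp (g := hamH B p) (f := Prod.fst) y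
      ((contDiff_hamH B p).differentiable (by simp) y.1).hasFDerivAt (hasFDerivAt_fst (𝕜 := ℝ))
  have h0 : ∀ k : Fin n, imPart ((Pi.single k 1, 0) : CSpace n) = 0 := by
    intro k
    ext i
    · rcases eq_or_ne i k with rfl | h <;> simp [imPart, *]
    · simp [imPart]
  have h1 : ∀ k : Fin n, rePart ((Pi.single k 1, 0) : CSpace n) = (Pi.single k 1, 0) := by
    intro k
    ext i
    · rcases eq_or_ne i k with rfl | h <;> simp [rePart, *]
    · simp [rePart]
  ext k
  · have e1 : (rePart ((0, Pi.single k 1) : CSpace n)).1 = 0 := by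
      ext i
      simp [rePart]
    have e2 : (imPart ((0, Pi.single k 1) : CSpace n)).1 = 0 := by
      ext i
      simp [imPart]
    simp only [hamVec, dC_ofReal hd, ContinuousLinearMap.comp_apply, ContinuousLinearMap.coe_fst',
      e1, e2, map_zero]
    simp
  · simp only [hamVec, dC_ofReal hd, h0, h1]
    have h2 : fderiv ℝ (hamH B p) y.1 (Pi.single k 1) = partialD (hamH B p) k y.1 := rfl
    simp only [ContinuousLinearMap.comp_apply, ContinuousLinearMap.coe_fst', h2, partialD_hamH]
    simp only [Prod.fst_zero, map_zero, Complex.ofReal_zero, mul_zero, add_zero, Pi.neg_apply,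
      Finset.sum_apply, Complex.ofReal_sum]
    congr 1
    refine Finset.sum_congr rfl fun j _ => ?_
    by_cases hj : j.val < p <;> simp [hj, rowC]

theorem lieH_congr (B : Matrix.SpecialLinearGroup (Fin n) ℤ) (p : ℕ) {f₁ f₂ : RSpace n → ℂ}
    {V : Set (RSpace n)} (hV : IsOpen V) (h : ∀ y ∈ V, f₁ y = f₂ y) :
    ∀ y ∈ V, lieH B p f₁ y = lieH B p f₂ y := by
  intro y hy
  have : f₁ =ᶠ[𝓝 y] f₂ := by
    filter_upwards [hV.mem_nhds hy] with y' hy' using h y' hy'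
  rw [lieH, lieH, dC_congr this]

theorem colC_dotProduct_rowC (B : Matrix.SpecialLinearGroup (Fin n) ℤ) (i j : Fin n) :
    colC B i ⬝ᵥ rowC B j = if i = j then 1 else 0 := by
  rw [dotProduct_comm, rowC_dotProduct_colC]
  exact if_congr eq_comm rfl rfl

theorem lieH_zt (B : Matrix.SpecialLinearGroup (Fin n) ℤ) (p : ℕ) {g : (Fin n → ℝ) → ℝ}
    {y : RSpace n} (hg : ContDiffAt ℝ ∞ g y.1) (j : Fin n) :
    lieH B p (zt B g j) y = if j.val < p then -Complex.I * (xt B j y.1 : ℂ) else 0 := by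
  rw [lieH, hamVec_hamH, dC_zt B hg, Matrix.mulVec_zero, dotProduct_zero, zero_add,
    dotProduct_neg, dotProduct_sum, Finset.sum_eq_single j]
  · by_cases hj : j.val < p
    · simp [hj, colC_dotProduct_rowC]
    · simp [hj]
  · intro i _ hij
    by_cases hi : i.val < p
    · simp [hi, colC_dotProduct_rowC, hij.symm]
    · simp [hi]
  · simp

theorem lieH_xt (B : Matrix.SpecialLinearGroup (Fin n) ℤ) (p : ℕ) (j : Fin n) (y : RSpace n) :
    lieH B p (fun y => if j.val < p then -Complex.I * (xt B j y.1 : ℂ) else 0) y = 0 := by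
  rw [lieH, hamVec_hamH]
  by_cases hj : j.val < p
  · simp only [hj, if_true]
    have hd : DifferentiableAt ℝ (fun y : RSpace n => (xt B j y.1 : ℂ)) y :=
      Complex.ofRealCLM.differentiableAt.comp y (DifferentiableAt.comp (g := xt B j) (f := Prod.fst)
        y (hasFDerivAt_xt B j y.1).differentiableAt differentiableAt_fst)
    rw [dC_const_mul hd, dC_xt, dotProduct_zero, mul_zero]
  · simp only [hj, if_false]
    rw [dC_of_hasFDerivAt (hasFDerivAt_const _ _)]
    simp

theorem lieH_zero (B : Matrix.SpecialLinearGroup (Fin n) ℤ) (p : ℕ) (y : RSpace n) :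
    lieH B p (fun _ => 0) y = 0 := by
  rw [lieH, dC_of_hasFDerivAt (hasFDerivAt_const _ _)]
  simp

/-- The exponential series terminates: `X_H z̃_j = -i x̃_j` for `j ≤ p` and `X_H x̃_j = 0`. -/
theorem hasSum_lieH (B : Matrix.SpecialLinearGroup (Fin n) ℤ) (p : ℕ) {g : (Fin n → ℝ) → ℝ}
    {V : Set (RSpace n)} (hV : IsOpen V) (hg : ∀ y ∈ V, ContDiffAt ℝ ∞ g y.1) (s : ℝ)
    {y : RSpace n} (hy : y ∈ V) (j : Fin n) :
    HasSum (fun k : ℕ => (Complex.I * s) ^ k / (k.factorial : ℂ) * ((lieH B p)^[k] (zt B g j)) y)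
      (zt B (potAt B p g s) j y) := by
  have h1 : ∀ y ∈ V, (lieH B p)^[1] (zt B g j) y
      = if j.val < p then -Complex.I * (xt B j y.1 : ℂ) else 0 :=
    fun y hy => lieH_zt B p (hg y hy) j
  have h2 : ∀ k, ∀ y ∈ V, (lieH B p)^[k + 2] (zt B g j) y = 0 := by
    intro k
    induction k with
    | zero =>
      intro y hy
      rw [Function.iterate_succ_apply', lieH_congr B p hV h1 y hy, lieH_xt]
    | succ k ih =>
      intro y hy
      rw [show k + 1 + 2 = (k + 2) + 1 from rfl, Function.iterate_succ_apply',
        lieH_congr B p hV ih y hy, lieH_zero]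
  have h3 : yt B (potAt B p g s) j y.1
      = yt B g j y.1 + s * if j.val < p then xt B j y.1 else 0 := by
    have hd : HasFDerivAt (potAt B p g s) _ y.1 :=
      ((hg y hy).differentiableAt (by simp)).hasFDerivAt.add
        (((contDiff_hamH B p).differentiable (by simp) y.1).hasFDerivAt.const_mul s)
    rw [yt, hd.fderiv, add_apply, smul_apply, smul_eq_mul, fderiv_eq_sum_partialD (hamH B p)]
    congr 2
    simp only [partialD_hamH, Finset.mul_sum]
    rw [Finset.sum_comm, Finset.sum_eq_single j]
    · by_cases hj : j.val < p
      · simp only [hj, if_true]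
        have h4 := congrArg (fun z : ℤ => (z : ℝ)) (sum_mul_inv B j j)
        simp only [Int.cast_sum, Int.cast_mul, if_true, Int.cast_one] at h4
        calc _ = xt B j y.1 * ∑ k, (B.1 j k : ℝ) * ((B⁻¹).1 k j : ℝ) := by
              rw [Finset.mul_sum]
              exact Finset.sum_congr rfl fun k _ => by ring
          _ = _ := by rw [h4, mul_one]
      · simp [hj]
    · intro i _ hij
      by_cases hi : i.val < p
      · simp only [hi, if_true]
        have h4 := congrArg (fun z : ℤ => (z : ℝ)) (sum_mul_inv B i j)
        simp only [Int.cast_sum, Int.cast_mul, hij, if_false, Int.cast_zero] at h4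
        calc _ = xt B i y.1 * ∑ k, (B.1 i k : ℝ) * ((B⁻¹).1 k j : ℝ) := by
              rw [Finset.mul_sum]
              exact Finset.sum_congr rfl fun k _ => by ring
          _ = _ := by rw [h4, mul_zero]
      · simp [hi]
    · simp
  have h5 : zt B (potAt B p g s) j y = ∑ k ∈ Finset.range 2,
      (Complex.I * s) ^ k / (k.factorial : ℂ) * ((lieH B p)^[k] (zt B g j)) y := by
    rw [Finset.sum_range_succ, Finset.sum_range_one, h1 y hy]
    change (yt B (potAt B p g s) j y.1 : ℂ) + Complex.I * (thetat B j y.2 : ℂ) = _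
    rw [h3, Function.iterate_zero, id, zt]
    by_cases hj : j.val < p
    · simp only [hj, if_true, Nat.factorial, pow_zero, pow_one]
      push_cast
      linear_combination (s * xt B j y.1 : ℂ) * Complex.I_sq
    · simp [hj]
  rw [h5]
  refine hasSum_sum_of_ne_finset_zero fun k hk => ?_
  obtain ⟨m, rfl⟩ : ∃ m, k = m + 2 := ⟨k - 2, by
    have := Finset.mem_range.not.mp hk
    omega⟩
  rw [h2 m y hy, mul_zero]

/-! ### The limit polarization on the open orbit -/

/-- The fields `∂/∂θ̃_j` for `j ≤ p` and `X_{z̃bar_j}` for `j > p` at a point over `x`. -/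
def limitFrame (B : Matrix.SpecialLinearGroup (Fin n) ℤ) (p : ℕ) (g : (Fin n → ℝ) → ℝ)
    (x : Fin n → ℝ) (j : Fin n) : CSpace n :=
  if j.val < p then (0, rowC B j)
  else ((-Complex.I) • colC B j, -(cMat (hessian g x) *ᵥ colC B j))

theorem linearIndependent_limitFrame (B : Matrix.SpecialLinearGroup (Fin n) ℤ) (p : ℕ)
    (g : (Fin n → ℝ) → ℝ) (x : Fin n → ℝ) : LinearIndependent ℂ (limitFrame B p g x) := by
  rw [Fintype.linearIndependent_iff]
  intro c hc
  have hge : ∀ i : Fin n, ¬ i.val < p → c i = 0 := by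
    intro i hi
    have h1 := congrArg (fun w : CSpace n => rowC B i ⬝ᵥ w.1) hc
    simp only [Prod.fst_sum, Prod.smul_fst, dotProduct_sum, dotProduct_smul, Prod.fst_zero,
      dotProduct_zero] at h1
    rw [Finset.sum_eq_single i] at h1
    · simpa [limitFrame, hi, rowC_dotProduct_colC] using h1
    · intro j _ hj
      by_cases hjp : j.val < p
      · simp [limitFrame, hjp]
      · simp [limitFrame, hjp, rowC_dotProduct_colC, hj.symm]
    · simp
  intro i
  by_cases hi : i.val < p
  · have h1 := congrArg (fun w : CSpace n => colC B i ⬝ᵥ w.2) hc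
    simp only [Prod.snd_sum, Prod.smul_snd, dotProduct_sum, dotProduct_smul, Prod.snd_zero,
      dotProduct_zero] at h1
    rw [Finset.sum_eq_single i] at h1
    · simpa [limitFrame, hi, colC_dotProduct_rowC] using h1
    · intro j _ hj
      by_cases hjp : j.val < p
      · simp [limitFrame, hjp, colC_dotProduct_rowC, hj.symm]
      · rw [hge j hjp, zero_smul]
    · simp
  · exact hge i hi

theorem span_limitFrame (B : Matrix.SpecialLinearGroup (Fin n) ℤ) (p : ℕ)
    {g : (Fin n → ℝ) → ℝ} {y : RSpace n} (hg : ContDiffAt ℝ ∞ g y.1) :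
    Submodule.span ℂ (Set.range (limitFrame B p g y.1)) = spanHam B p (ztbar B g) y := by
  rw [spanHam]
  congr 1
  ext w
  constructor
  · rintro ⟨j, rfl⟩
    by_cases hj : j.val < p
    · exact Or.inl ⟨j, hj, by simp [limitFrame, hj, dtheta_eq]⟩
    · exact Or.inr ⟨j, not_lt.mp hj, by simp [limitFrame, hj, hamVec_ztbar B hg]⟩
  · rintro (⟨j, hj, rfl⟩ | ⟨j, hj, rfl⟩)
    · exact ⟨j, by simp [limitFrame, hj, dtheta_eq]⟩
    · exact ⟨j, by simp [limitFrame, not_lt.mpr hj, hamVec_ztbar B hg]⟩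

/-- The limit polarization is the common kernel of `dx̃_j` for `j ≤ p` and `dz̃bar_j` for `j > p`. -/
theorem mem_spanHam_ztbar (B : Matrix.SpecialLinearGroup (Fin n) ℤ) (p : ℕ)
    {g : (Fin n → ℝ) → ℝ} {y : RSpace n} (hg : ContDiffAt ℝ ∞ g y.1) (u : CSpace n) :
    u ∈ spanHam B p (ztbar B g) y ↔ ∀ j : Fin n, if j.val < p then rowC B j ⬝ᵥ u.1 = 0
      else colC B j ⬝ᵥ (cMat (hessian g y.1) *ᵥ u.1) - Complex.I * (colC B j ⬝ᵥ u.2) = 0 := by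
  rw [← span_limitFrame B p hg]
  constructor
  · intro hu
    induction hu using Submodule.span_induction with
    | mem u h =>
      obtain ⟨i, rfl⟩ := h
      intro j
      by_cases hj : j.val < p
      · rw [if_pos hj]
        by_cases hi : i.val < p
        · simp [limitFrame, hi]
        · have hij : j ≠ i := fun h => hi (h ▸ hj)
          simp [limitFrame, hi, rowC_dotProduct_colC, hij]
      · rw [if_neg hj]
        by_cases hi : i.val < p
        · have hij : j ≠ i := fun h => hj (h ▸ hi)
          simp [limitFrame, hi, colC_dotProduct_rowC, hij]
        · simp only [limitFrame, hi, if_false, Matrix.mulVec_smul, dotProduct_smul,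
            dotProduct_neg, smul_eq_mul]
          ring
    | zero =>
      intro j
      split_ifs <;> simp
    | add a b _ _ ha hb =>
      intro j
      have h1 := ha j
      have h2 := hb j
      split_ifs at h1 h2 ⊢
      · rw [Prod.fst_add, dotProduct_add, h1, h2, add_zero]
      · rw [Prod.fst_add, Prod.snd_add, Matrix.mulVec_add, dotProduct_add, dotProduct_add]
        linear_combination h1 + h2
    | smul c a _ ha =>
      intro j
      have h1 := ha j
      split_ifs at h1 ⊢
      · rw [Prod.smul_fst, dotProduct_smul, h1, smul_zero]
      · rw [Prod.smul_fst, Prod.smul_snd, Matrix.mulVec_smul, dotProduct_smul, dotProduct_smul,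
          smul_eq_mul, smul_eq_mul]
        linear_combination c * h1
  · intro hu
    let c : Fin n → ℂ := fun j => if j.val < p then
      colC B j ⬝ᵥ (u.2 + Complex.I • (cMat (hessian g y.1) *ᵥ u.1))
      else Complex.I * (rowC B j ⬝ᵥ u.1)
    have hfst : ∀ j, c j • (limitFrame B p g y.1 j).1 = (rowC B j ⬝ᵥ u.1) • colC B j := by
      intro j
      have h1 := hu j
      by_cases hj : j.val < p
      · rw [if_pos hj] at h1
        simp [limitFrame, hj, h1]
      · simp only [c, limitFrame, hj, if_false, smul_smul]
        congr 1
        linear_combination (-(rowC B j ⬝ᵥ u.1)) * Complex.I_sq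
    have hsnd : ∀ j, c j • (limitFrame B p g y.1 j).2
        = (colC B j ⬝ᵥ (u.2 + Complex.I • (cMat (hessian g y.1) *ᵥ u.1))) • rowC B j
          - Complex.I • (cMat (hessian g y.1)).mulVecLin ((rowC B j ⬝ᵥ u.1) • colC B j) := by
      intro j
      have h1 := hu j
      by_cases hj : j.val < p
      · rw [if_pos hj] at h1
        simp [limitFrame, hj, h1, c]
      · rw [if_neg hj] at h1
        have h2 : colC B j ⬝ᵥ (u.2 + Complex.I • (cMat (hessian g y.1) *ᵥ u.1)) = 0 := by
          rw [dotProduct_add, dotProduct_smul, smul_eq_mul]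
          linear_combination Complex.I * h1 + (colC B j ⬝ᵥ u.2) * Complex.I_sq
        rw [h2, zero_smul, zero_sub, map_smul, smul_smul, Matrix.mulVecLin_apply]
        simp only [c, limitFrame, hj, if_false, smul_neg]
    have hsum : u = ∑ j, c j • limitFrame B p g y.1 j := by
      refine Prod.ext ?_ ?_
      · rw [Prod.fst_sum]
        simp only [Prod.smul_fst, hfst, sum_colC]
      · rw [Prod.snd_sum]
        simp only [Prod.smul_snd, hsnd]
        rw [Finset.sum_sub_distrib, sum_rowC, ← Finset.smul_sum, ← map_sum, sum_colC,
          Matrix.mulVecLin_apply, add_sub_cancel_right]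
    rw [hsum]
    exact Submodule.sum_mem _ fun j _ => Submodule.smul_mem _ _ (Submodule.subset_span ⟨j, rfl⟩)

theorem star_eq_sum_colC (B : Matrix.SpecialLinearGroup (Fin n) ℤ) (w : Fin n → ℂ) :
    star w = ∑ j, star (rowC B j ⬝ᵥ w) • colC B j := by
  have h : ∀ j, star (rowC B j ⬝ᵥ w) = rowC B j ⬝ᵥ star w := by
    intro j
    simp [dotProduct, rowC]
  simp only [h, sum_colC]

/-- A vector annihilated by `dx̃_j` for `j ≤ p` and by `Re dz̃_j` for `j > p` has no component in the
directions `∂/∂x`: the corresponding block of the Hessian is positive definite. -/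
theorem fst_eq_zero_of_block (B : Matrix.SpecialLinearGroup (Fin n) ℤ) (p : ℕ)
    {G : Matrix (Fin n) (Fin n) ℝ} (hG : G.PosDef) {w : Fin n → ℂ}
    (h1 : ∀ j : Fin n, j.val < p → rowC B j ⬝ᵥ w = 0)
    (h2 : ∀ j : Fin n, p ≤ j.val → colC B j ⬝ᵥ (cMat G *ᵥ w) = 0) : w = 0 := by
  by_contra hw
  have h3 := re_star_dotProduct_pos hG hw
  have h4 : star w ⬝ᵥ (cMat G *ᵥ w) = 0 := by
    rw [star_eq_sum_colC B w, sum_dotProduct]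
    refine Finset.sum_eq_zero fun j _ => ?_
    rw [smul_dotProduct]
    by_cases hj : j.val < p
    · rw [h1 j hj, star_zero, zero_smul]
    · rw [h2 j (not_lt.mp hj), smul_zero]
  rw [h4] at h3
  exact lt_irrefl _ h3

/-- Both sides are cut out by `dx̃_j` for `j ≤ p` and `dz̃bar_j` for `j > p`. The vectors `∂/∂z̃_k` exist
because the differentials of the mixed coordinates are independent, which uses that the block of `G`
with indices `> p` is nondegenerate. -/
theorem spanHam_eq_spanHol (B : Matrix.SpecialLinearGroup (Fin n) ℤ) (p : ℕ)
    {g : (Fin n → ℝ) → ℝ} {y : RSpace n} (hg : ContDiffAt ℝ ∞ g y.1)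
    (hG : (hessian g y.1).PosDef) : spanHam B p (ztbar B g) y = spanHol B p g y := by
  -- the coordinates `(dx̃_j, dθ̃_j)` for `j ≤ p` and `(dz̃_j, dz̃bar_j)` for `j > p`
  let Ψ : CSpace n →ₗ[ℂ] CSpace n :=
    LinearMap.prod
      (LinearMap.pi fun j => if j.val < p then dC (fun y' => (xt B j y'.1 : ℂ)) y
        else dC (zt B g j) y)
      (LinearMap.pi fun j => if j.val < p then dC (fun y' => (thetat B j y'.2 : ℂ)) y
        else dC (ztbar B g j) y)
  have hΨ1 : ∀ u (j : Fin n), j.val < p → (Ψ u).1 j = rowC B j ⬝ᵥ u.1 := by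
    intro u j hj
    change (if j.val < p then dC (fun y' => (xt B j y'.1 : ℂ)) y else dC (zt B g j) y) u = _
    rw [if_pos hj, dC_xt]
  have hΨ2 : ∀ u (j : Fin n), j.val < p → (Ψ u).2 j = colC B j ⬝ᵥ u.2 := by
    intro u j hj
    change (if j.val < p then dC (fun y' => (thetat B j y'.2 : ℂ)) y else dC (ztbar B g j) y) u = _
    rw [if_pos hj, dC_thetat]
  have hΨ3 : ∀ u (j : Fin n), ¬ j.val < p → (Ψ u).1 j = dC (zt B g j) y u := by
    intro u j hj
    change (if j.val < p then dC (fun y' => (xt B j y'.1 : ℂ)) y else dC (zt B g j) y) u = _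
    rw [if_neg hj]
  have hΨ4 : ∀ u (j : Fin n), ¬ j.val < p → (Ψ u).2 j = dC (ztbar B g j) y u := by
    intro u j hj
    change (if j.val < p then dC (fun y' => (thetat B j y'.2 : ℂ)) y else dC (ztbar B g j) y) u = _
    rw [if_neg hj]
  have hinj : Function.Injective Ψ := by
    rw [← LinearMap.ker_eq_bot, LinearMap.ker_eq_bot']
    intro u hu
    have e1 : ∀ j, (Ψ u).1 j = 0 := fun j => by rw [hu]; rfl
    have e2 : ∀ j, (Ψ u).2 j = 0 := fun j => by rw [hu]; rfl
    have hz : ∀ j : Fin n, ¬ j.val < p → colC B j ⬝ᵥ (cMat (hessian g y.1) *ᵥ u.1) = 0 ∧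
        colC B j ⬝ᵥ u.2 = 0 := by
      intro j hj
      have f1 := e1 j
      have f2 := e2 j
      rw [hΨ3 u j hj, dC_zt B hg] at f1
      rw [hΨ4 u j hj, dC_ztbar B hg] at f2
      constructor
      · linear_combination (f1 + f2) / 2
      · linear_combination (-Complex.I / 2) * (f1 - f2) + (colC B j ⬝ᵥ u.2) * Complex.I_sq
    have hu1 : u.1 = 0 := fst_eq_zero_of_block B p hG (fun j hj => by rw [← hΨ1 u j hj, e1])
      fun j hj => (hz j (not_lt.mpr hj)).1
    have hu2 : u.2 = 0 := by
      rw [← sum_rowC B u.2]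
      refine Finset.sum_eq_zero fun j _ => ?_
      by_cases hj : j.val < p
      · rw [← hΨ2 u j hj, e2, zero_smul]
      · rw [(hz j hj).2, zero_smul]
    exact Prod.ext hu1 hu2
  have hsurj : Function.Surjective Ψ := LinearMap.injective_iff_surjective.mp hinj
  have hpart : ∀ (k : Fin n), p ≤ k.val → ∀ w,
      IsPartialZ B p g y k w ↔ Ψ w = (Pi.single k 1, 0) := by
    intro k hk w
    constructor
    · rintro ⟨h1, h2⟩
      ext j
      · by_cases hj : j.val < p
        · have hjk : j ≠ k := fun h => absurd hj (not_lt.mpr (h ▸ hk))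
          rw [hΨ1 w j hj, ← dC_xt B j y, (h1 j hj).1]
          simp [hjk]
        · rw [hΨ3 w j hj, (h2 j (not_lt.mp hj)).1]
          simp [Pi.single_apply]
      · by_cases hj : j.val < p
        · rw [hΨ2 w j hj, ← dC_thetat B j y, (h1 j hj).2]
          rfl
        · rw [hΨ4 w j hj, (h2 j (not_lt.mp hj)).2]
          rfl
    · intro hw
      refine ⟨fun j hj => ?_, fun j hj => ?_⟩
      · have hjk : j ≠ k := fun h => absurd hj (not_lt.mpr (h ▸ hk))
        rw [dC_xt, dC_thetat, ← hΨ1 w j hj, ← hΨ2 w j hj, hw]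
        simp [hjk]
      · rw [← hΨ3 w j (not_lt.mpr hj), ← hΨ4 w j (not_lt.mpr hj), hw]
        simp [Pi.single_apply]
  apply le_antisymm
  · intro u hu
    rw [mem_spanHam_ztbar B p hg] at hu
    choose w hw using fun k => hsurj (Pi.single k 1, 0)
    let e : Fin n → CSpace n := fun j => if j.val < p then (0, rowC B j) else w j
    let c : Fin n → ℂ := fun j => if j.val < p then colC B j ⬝ᵥ u.2 else dC (zt B g j) y u
    have hΨe : ∀ j, Ψ (e j) = if j.val < p then (0, Pi.single j 1) else (Pi.single j 1, 0) := by
      intro j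
      by_cases hj : j.val < p
      · simp only [e, hj, if_true]
        ext i
        · by_cases hi : i.val < p
          · rw [hΨ1 _ i hi]
            simp
          · have hij : i ≠ j := fun h => hi (h ▸ hj)
            rw [hΨ3 _ i hi, dC_zt B hg]
            simp [colC_dotProduct_rowC, hij]
        · by_cases hi : i.val < p
          · rw [hΨ2 _ i hi]
            simp [colC_dotProduct_rowC, Pi.single_apply]
          · have hij : i ≠ j := fun h => hi (h ▸ hj)
            rw [hΨ4 _ i hi, dC_ztbar B hg]
            simp [colC_dotProduct_rowC, hij]
      · simp only [e, hj, if_false]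
        exact hw j
    have hsum : u = ∑ j, c j • e j := by
      apply hinj
      rw [map_sum]
      simp only [map_smul, hΨe]
      ext i
      · rw [Prod.fst_sum, Finset.sum_apply]
        by_cases hi : i.val < p
        · have h1 := hu i
          rw [if_pos hi] at h1
          rw [hΨ1 u i hi, h1]
          refine (Finset.sum_eq_zero fun j _ => ?_).symm
          by_cases hj : j.val < p
          · simp [hj]
          · have hij : i ≠ j := fun h => hj (h ▸ hi)
            simp [hj, hij]
        · rw [hΨ3 u i hi, Finset.sum_eq_single i]
          · simp [hi, c]
          · intro j _ hj
            by_cases hjp : j.val < p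
            · simp [hjp]
            · simp [hjp, hj.symm]
          · simp
      · rw [Prod.snd_sum, Finset.sum_apply]
        by_cases hi : i.val < p
        · rw [hΨ2 u i hi, Finset.sum_eq_single i]
          · simp [hi, c]
          · intro j _ hj
            by_cases hjp : j.val < p
            · simp [hjp, hj.symm]
            · simp [hjp]
          · simp
        · have h1 := hu i
          rw [if_neg hi] at h1
          rw [hΨ4 u i hi, dC_ztbar B hg, h1]
          refine (Finset.sum_eq_zero fun j _ => ?_).symm
          by_cases hj : j.val < p
          · have hij : i ≠ j := fun h => hi (h ▸ hj)
            simp [hj, hij]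
          · simp [hj]
    rw [hsum]
    refine Submodule.sum_mem _ fun j _ => Submodule.smul_mem _ _ (Submodule.subset_span ?_)
    by_cases hj : j.val < p
    · exact Or.inl ⟨j, hj, by simp [e, hj, dtheta_eq]⟩
    · refine Or.inr ⟨j, not_lt.mp hj, (hpart j (not_lt.mp hj) _).mpr ?_⟩
      simp only [e, hj, if_false]
      exact hw j
  · refine Submodule.span_le.mpr ?_
    rintro u (⟨j, hj, rfl⟩ | ⟨k, hk, hu⟩)
    · exact Submodule.subset_span (Or.inl ⟨j, hj, rfl⟩)
    · refine (mem_spanHam_ztbar B p hg u).mpr fun j => ?_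
      by_cases hj : j.val < p
      · rw [if_pos hj, ← dC_xt B j y]
        exact (hu.1 j hj).1
      · rw [if_neg hj, ← dC_ztbar B hg]
        exact (hu.2 j (not_lt.mp hj)).2

theorem subtorusMat_mulVec_colC (B : Matrix.SpecialLinearGroup (Fin n) ℤ) (p : ℕ) (j : Fin n) :
    cMat ((subtorusMat B p)ᵀ * subtorusMat B p) *ᵥ colC B j
      = if j.val < p then rowC B j else 0 := by
  have h1 : cMat (subtorusMat B p) *ᵥ colC B j = if j.val < p then Pi.single j 1 else 0 := by
    ext i
    change (fun k => cMat (subtorusMat B p) i k) ⬝ᵥ colC B j = _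
    have h2 : (fun k => cMat (subtorusMat B p) i k) = if i.val < p then rowC B i else 0 := by
      ext k
      by_cases hi : i.val < p <;> simp [cMat, subtorusMat, hi, rowC]
    rw [h2]
    by_cases hi : i.val < p
    · rw [if_pos hi, rowC_dotProduct_colC]
      by_cases hij : i = j
      · subst hij
        simp [hi]
      · by_cases hj : j.val < p <;> simp [hij, hj]
    · have : j.val < p → i ≠ j := fun hj h => hi (h ▸ hj)
      by_cases hj : j.val < p <;> simp [hi, hj, this]
  rw [cMat_mul, ← Matrix.mulVec_mulVec, h1]
  by_cases hj : j.val < p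
  · ext k
    simp [hj, cMat, subtorusMat, rowC]
  · simp [hj]

theorem hamVec_ztbar_potAt (B : Matrix.SpecialLinearGroup (Fin n) ℤ) (p : ℕ)
    {g : (Fin n → ℝ) → ℝ} {y : RSpace n} (hg : ContDiffAt ℝ ∞ g y.1) (s : ℝ) (j : Fin n) :
    hamVec (ztbar B (potAt B p g s) j) y = ((-Complex.I) • colC B j,
      -(cMat (hessian g y.1) *ᵥ colC B j + if j.val < p then (s : ℂ) • rowC B j else 0)) := by
  have hgs : ContDiffAt ℝ ∞ (potAt B p g s) y.1 :=
    hg.add (contDiffAt_const.mul (contDiff_hamH B p).contDiffAt)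
  rw [hamVec_ztbar B hgs, hessian_potAt B p s hg, cMat_add, cMat_smul, Matrix.add_mulVec,
    Matrix.smul_mulVec, subtorusMat_mulVec_colC]
  by_cases hj : j.val < p <;> simp [hj]

/-- The vectors `-s⁻¹ X_{z̃bar_{j,s}}` with `j ≤ p` tend to `∂/∂θ̃_j`, and those with `j > p` do not
depend on `s`. -/
theorem grTendsto_toricT10 (B : Matrix.SpecialLinearGroup (Fin n) ℤ) (p : ℕ)
    {g : (Fin n → ℝ) → ℝ} {y : RSpace n} (hg : ContDiffAt ℝ ∞ g y.1)
    (hG : ∀ s : ℝ, 0 ≤ s → (hessian (potAt B p g s) y.1).PosDef) :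
    GrTendsto (fun s => toricT10 (potAt B p g s) y) (spanHam B p (ztbar B g) y) := by
  let a : ℝ → Fin n → ℂ := fun s j => if j.val < p then -(s : ℂ)⁻¹ else 1
  have ha : ∀ s : ℝ, s ≠ 0 → ∀ j, a s j ≠ 0 := by
    intro s hs j
    by_cases hj : j.val < p
    · simp [a, hj, hs]
    · simp [a, hj]
  refine ⟨fun s j => a s j • hamVec (ztbar B (potAt B p g s) j) y, limitFrame B p g y.1, ?_,
    linearIndependent_limitFrame B p g y.1, span_limitFrame B p hg, ?_⟩
  · filter_upwards [Filter.eventually_gt_atTop 0] with s hs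
    have hgs : ContDiffAt ℝ ∞ (potAt B p g s) y.1 :=
      hg.add (contDiffAt_const.mul (contDiff_hamH B p).contDiffAt)
    constructor
    · refine linearIndependent_of_fst B (a := fun j => a s j * (-Complex.I))
        (fun j => mul_ne_zero (ha s hs.ne' j) (neg_ne_zero.mpr Complex.I_ne_zero)) fun j => ?_
      rw [Prod.smul_fst, hamVec_ztbar B hgs, smul_smul]
    · rw [toricT10_eq_span B hgs (hG s hs.le)]
      apply le_antisymm
      · refine Submodule.span_le.mpr ?_
        rintro _ ⟨j, rfl⟩
        exact Submodule.smul_mem _ _ (Submodule.subset_span ⟨j, rfl⟩)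
      · refine Submodule.span_le.mpr ?_
        rintro _ ⟨j, rfl⟩
        have h1 := Submodule.smul_mem (Submodule.span ℂ
          (Set.range fun j => a s j • hamVec (ztbar B (potAt B p g s) j) y)) (a s j)⁻¹
          (Submodule.subset_span ⟨j, rfl⟩)
        simp only [smul_smul, inv_mul_cancel₀ (ha s hs.ne' j), one_smul] at h1
        exact h1
  · refine tendsto_pi_nhds.mpr fun j => ?_
    by_cases hj : j.val < p
    · have hinv : Filter.Tendsto (fun s : ℝ => (s : ℂ)⁻¹) Filter.atTop (𝓝 0) := by
        have := (Complex.continuous_ofReal.tendsto 0).comp tendsto_inv_atTop_zero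
        simpa [Function.comp_def] using this
      have hlim : Filter.Tendsto (fun s : ℝ => (s : ℂ)⁻¹ • ((Complex.I • colC B j,
          cMat (hessian g y.1) *ᵥ colC B j) : CSpace n) + (0, rowC B j)) Filter.atTop
          (𝓝 ((0 : ℂ) • ((Complex.I • colC B j,
          cMat (hessian g y.1) *ᵥ colC B j) : CSpace n) + (0, rowC B j))) :=
        (hinv.smul_const _).add tendsto_const_nhds
      rw [zero_smul, zero_add] at hlim
      have hl : limitFrame B p g y.1 j = (0, rowC B j) := by simp [limitFrame, hj]
      rw [hl]
      refine hlim.congr' ?_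
      filter_upwards [Filter.eventually_ne_atTop 0] with s hs
      have hs' : (s : ℂ) ≠ 0 := by exact_mod_cast hs
      rw [hamVec_ztbar_potAt B p hg]
      simp only [a, hj, if_true]
      refine Prod.ext ?_ ?_
      · simp
      · change (s : ℂ)⁻¹ • (cMat (hessian g y.1) *ᵥ colC B j) + rowC B j
          = (-(s : ℂ)⁻¹) • -(cMat (hessian g y.1) *ᵥ colC B j + (s : ℂ) • rowC B j)
        rw [smul_neg, neg_smul, neg_neg, smul_add, smul_smul, inv_mul_cancel₀ hs', one_smul]
    · refine tendsto_const_nhds.congr fun s => ?_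
      rw [hamVec_ztbar_potAt B p hg]
      simp [limitFrame, a, hj]

theorem spanHam_zt (B : Matrix.SpecialLinearGroup (Fin n) ℤ) (p : ℕ)
    {g : (Fin n → ℝ) → ℝ} {y : RSpace n} (hg : ContDiffAt ℝ ∞ g y.1) :
    spanHam B p (zt B g) y = conjSub (spanHam B p (ztbar B g) y) := by
  have hcol : ∀ j k, starRingEnd ℂ (colC B j k) = colC B j k := fun j k =>
    Complex.conj_ofReal _
  have h1 : ∀ j, conjVec (dtheta B j) = dtheta B j := by
    intro j
    rw [dtheta_eq]
    ext k
    · simp [conjVec]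
    · exact Complex.conj_ofReal _
  have h2 : ∀ j, conjVec (hamVec (ztbar B g j) y) = hamVec (zt B g j) y := by
    intro j
    rw [hamVec_ztbar B hg, hamVec_zt B hg]
    ext k
    · simp [conjVec, hcol]
    · change starRingEnd ℂ (-(cMat (hessian g y.1) *ᵥ colC B j) k) = _
      rw [map_neg, DelzantPolytope.conj_cMat_mulVec]
      simp [hcol]
  rw [spanHam, spanHam, conjSub_span]
  congr 1
  ext w
  constructor
  · rintro (⟨j, hj, rfl⟩ | ⟨j, hj, rfl⟩)
    · exact ⟨dtheta B j, Or.inl ⟨j, hj, rfl⟩, h1 j⟩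
    · exact ⟨_, Or.inr ⟨j, hj, rfl⟩, h2 j⟩
  · rintro ⟨_, ⟨j, hj, rfl⟩ | ⟨j, hj, rfl⟩, rfl⟩
    · exact Or.inl ⟨j, hj, h1 j⟩
    · exact Or.inr ⟨j, hj, h2 j⟩

/-- The real directions of the limit polarization are spanned by `∂/∂θ̃_1, …, ∂/∂θ̃_p`. -/
theorem finrank_spanHam_inf_conj (B : Matrix.SpecialLinearGroup (Fin n) ℤ) {p : ℕ} (hpn : p ≤ n)
    {g : (Fin n → ℝ) → ℝ} {y : RSpace n} (hg : ContDiffAt ℝ ∞ g y.1)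
    (hG : (hessian g y.1).PosDef) :
    Module.finrank ℂ ↥(spanHam B p (ztbar B g) y ⊓ conjSub (spanHam B p (ztbar B g) y)) = p := by
  let e : Fin p → CSpace n := fun j => (0, rowC B (Fin.castLE hpn j))
  have he : LinearIndependent ℂ e := by
    rw [Fintype.linearIndependent_iff]
    intro c hc i
    have h1 := congrArg (fun w : CSpace n => colC B (Fin.castLE hpn i) ⬝ᵥ w.2) hc
    simp only [Prod.snd_sum, Prod.smul_snd, dotProduct_sum, dotProduct_smul, Prod.snd_zero,
      dotProduct_zero, e, colC_dotProduct_rowC] at h1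
    simpa [Fin.castLE_inj] using h1
  have hspan : spanHam B p (ztbar B g) y ⊓ conjSub (spanHam B p (ztbar B g) y)
      = Submodule.span ℂ (Set.range e) := by
    apply le_antisymm
    · rintro u ⟨hu1, hu2⟩
      have hu1' := (mem_spanHam_ztbar B p hg u).mp hu1
      have hu2' := (mem_spanHam_ztbar B p hg (conjVec u)).mp hu2
      have hz : ∀ j : Fin n, ¬ j.val < p → colC B j ⬝ᵥ (cMat (hessian g y.1) *ᵥ u.1) = 0 ∧
          colC B j ⬝ᵥ u.2 = 0 := by
        intro j hj
        have f1 := hu1' j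
        have f2 := hu2' j
        rw [if_neg hj] at f1 f2
        have hc1 : colC B j ⬝ᵥ (cMat (hessian g y.1) *ᵥ (conjVec u).1)
            = starRingEnd ℂ (colC B j ⬝ᵥ (cMat (hessian g y.1) *ᵥ u.1)) := by
          simp only [dotProduct, map_sum, map_mul, DelzantPolytope.conj_cMat_mulVec, colC,
            Complex.conj_ofReal]
          rfl
        have hc2 : colC B j ⬝ᵥ (conjVec u).2 = starRingEnd ℂ (colC B j ⬝ᵥ u.2) := by
          simp only [dotProduct, map_sum, map_mul, colC, Complex.conj_ofReal]
          rfl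
        rw [hc1, hc2] at f2
        have f3 := congrArg (starRingEnd ℂ) f2
        rw [map_sub, map_mul, Complex.conj_conj, Complex.conj_conj, Complex.conj_I, map_zero] at f3
        constructor
        · linear_combination (f1 + f3) / 2
        · linear_combination (Complex.I / 2) * (f1 - f3) + (colC B j ⬝ᵥ u.2) * Complex.I_sq
      have h0 : u.1 = 0 := fst_eq_zero_of_block B p hG (fun j hj => by
        have := hu1' j
        rwa [if_pos hj] at this) fun j hj => (hz j (not_lt.mpr hj)).1
      have hu : u = ∑ j, ((colC B j ⬝ᵥ u.2) • ((0, rowC B j) : CSpace n)) := by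
        refine Prod.ext ?_ ?_
        · rw [Prod.fst_sum, h0]
          simp
        · rw [Prod.snd_sum]
          exact (sum_rowC B u.2).symm
      rw [hu]
      refine Submodule.sum_mem _ fun j _ => ?_
      by_cases hj : j.val < p
      · exact Submodule.smul_mem _ _ (Submodule.subset_span ⟨⟨j.val, hj⟩, rfl⟩)
      · rw [(hz j hj).2, zero_smul]
        exact Submodule.zero_mem _
    · refine Submodule.span_le.mpr ?_
      rintro _ ⟨j, rfl⟩
      have hmem : e j ∈ spanHam B p (ztbar B g) y :=
        Submodule.subset_span (Or.inl ⟨Fin.castLE hpn j, j.2, rfl⟩)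
      have hconj : conjVec (e j) = e j := by
        ext k
        · simp [conjVec, e]
        · exact Complex.conj_ofReal _
      exact ⟨hmem, mem_conjSub.mpr (by rwa [hconj])⟩
  rw [hspan, finrank_span_eq_card he, Fintype.card_fin]

end

namespace DelzantPolytope

variable {n : ℕ} {Δ : DelzantPolytope n}

/-! ### The moment map and the orbits of the subtorus in a chart -/

theorem Vertex.dC_muChart (v : Δ.Vertex) (B : Matrix.SpecialLinearGroup (Fin n) ℤ) (j : Fin n)
    (q : RSpace n) (w : CSpace n) :
    dC (muChart B v j) q w = rowC B j ⬝ᵥ (cMat v.mat⁻¹ *ᵥ dXi q w) := by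
  have hd := hasFDerivAt_xt B j (v.moment q)
  have hp : ∀ i, partialD (xt B j) i (v.moment q) = (B.1 j i : ℝ) := by
    intro i
    rw [partialD, hd.fderiv]
    simp [Pi.single_apply]
  change dC (fun q => (xt B j (v.moment q) : ℂ)) q w = _
  rw [v.dC_comp_moment hd.differentiableAt]
  simp only [hp]
  rfl

theorem cMat_subtorusMat_mulVec (B : Matrix.SpecialLinearGroup (Fin n) ℤ) (p : ℕ)
    (z : Fin n → ℂ) (j : Fin n) :
    (cMat (subtorusMat B p) *ᵥ z) j = if j.val < p then rowC B j ⬝ᵥ z else 0 := by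
  by_cases hj : j.val < p <;>
    simp [Matrix.mulVec, dotProduct, cMat, subtorusMat, rowC, hj]

theorem cMat_subtorusMat_transpose_mulVec (B : Matrix.SpecialLinearGroup (Fin n) ℤ) (p : ℕ)
    (z : Fin n → ℂ) :
    (cMat (subtorusMat B p))ᵀ *ᵥ z = ∑ j : Fin n, if j.val < p then z j • rowC B j else 0 := by
  ext k
  rw [Finset.sum_apply]
  simp only [Matrix.mulVec, dotProduct]
  refine Finset.sum_congr rfl fun j _ => ?_
  by_cases hj : j.val < p <;> simp [cMat, subtorusMat, rowC, hj, mul_comm]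

theorem Vertex.kerMu_eq (v : Δ.Vertex) (B : Matrix.SpecialLinearGroup (Fin n) ℤ) (p : ℕ)
    (q : RSpace n) :
    kerMu B p v q = LinearMap.ker ((cMat (v.subMat B p)).mulVecLin ∘ₗ dXi q) := by
  ext w
  simp only [kerMu, Submodule.mem_iInf, LinearMap.mem_ker, LinearMap.comp_apply,
    Matrix.mulVecLin_apply, v.dC_muChart, Subtype.forall]
  rw [Vertex.subMat, cMat_mul, ← Matrix.mulVec_mulVec, funext_iff]
  simp only [cMat_subtorusMat_mulVec, Pi.zero_apply, ite_eq_right_iff]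

theorem Vertex.hamVec_muChart (v : Δ.Vertex) (B : Matrix.SpecialLinearGroup (Fin n) ℤ) (j : Fin n)
    (q : RSpace n) : hamVec (muChart B v j) q
      = (-Complex.I) • rot q ((cMat v.mat⁻¹)ᵀ *ᵥ rowC B j) := by
  have h : ∀ (k : Fin n) (c : ℂ), rowC B j ⬝ᵥ (cMat v.mat⁻¹ *ᵥ Pi.single k c)
      = c * ((cMat v.mat⁻¹)ᵀ *ᵥ rowC B j) k := by
    intro k c
    rw [Matrix.dotProduct_mulVec, Matrix.mulVec_transpose, dotProduct_single, mul_comm]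
  have h1 : ∀ k, dXi q (0, Pi.single k 1) = Pi.single k (q.2 k : ℂ) := by
    intro k
    ext i
    rw [dXi_apply]
    by_cases hi : i = k
    · subst hi; simp
    · simp [hi]
  have h2 : ∀ k, dXi q (Pi.single k 1, 0) = Pi.single k (q.1 k : ℂ) := by
    intro k
    ext i
    rw [dXi_apply]
    by_cases hi : i = k
    · subst hi; simp
    · simp [hi]
  ext k
  · change dC (muChart B v j) q (0, Pi.single k 1) = -Complex.I * (Complex.I * (q.2 k * _))
    rw [v.dC_muChart, h1, h]
    linear_combination ((q.2 k : ℂ) * ((cMat v.mat⁻¹)ᵀ *ᵥ rowC B j) k) * Complex.I_sq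
  · change -dC (muChart B v j) q (Pi.single k 1, 0) = -Complex.I * -(Complex.I * (q.1 k * _))
    rw [v.dC_muChart, h2, h]
    linear_combination (-((q.1 k : ℂ) * ((cMat v.mat⁻¹)ᵀ *ᵥ rowC B j) k)) * Complex.I_sq

theorem Vertex.orbitTangent_eq (v : Δ.Vertex) (B : Matrix.SpecialLinearGroup (Fin n) ℤ) (p : ℕ)
    (q : RSpace n) :
    orbitTangent B p v q = LinearMap.range (rot q ∘ₗ (cMat (v.subMat B p))ᵀ.mulVecLin) := by
  have hS : ∀ z, (cMat (v.subMat B p))ᵀ *ᵥ z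
      = (cMat v.mat⁻¹)ᵀ *ᵥ ((cMat (subtorusMat B p))ᵀ *ᵥ z) := by
    intro z
    rw [Vertex.subMat, cMat_mul, Matrix.transpose_mul, Matrix.mulVec_mulVec]
  apply le_antisymm
  · refine Submodule.span_le.mpr ?_
    rintro _ ⟨j, hj, rfl⟩
    refine ⟨Pi.single j (-Complex.I), ?_⟩
    rw [LinearMap.comp_apply, Matrix.mulVecLin_apply, hS, cMat_subtorusMat_transpose_mulVec,
      Finset.sum_eq_single j, if_pos hj, Pi.single_eq_same, Matrix.mulVec_smul, map_smul,
      v.hamVec_muChart]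
    · intro i _ hi
      simp [hi]
    · simp
  · rintro _ ⟨z, rfl⟩
    rw [LinearMap.comp_apply, Matrix.mulVecLin_apply, hS, cMat_subtorusMat_transpose_mulVec,
      ← Matrix.mulVecLin_apply, map_sum, map_sum]
    refine Submodule.sum_mem _ fun j _ => ?_
    by_cases hj : j.val < p
    · have h1 : rot q ((cMat v.mat⁻¹)ᵀ.mulVecLin (z j • rowC B j))
          = (Complex.I * z j) • hamVec (muChart B v j) q := by
        rw [v.hamVec_muChart, map_smul, map_smul, smul_smul, Matrix.mulVecLin_apply]
        congr 1
        linear_combination (z j) * Complex.I_sq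
      rw [if_pos hj, h1]
      exact Submodule.smul_mem _ _ (Submodule.subset_span ⟨j, hj, rfl⟩)
    · rw [if_neg hj, map_zero, map_zero]
      exact Submodule.zero_mem _

/-! ### The limit polarization -/

/-- The limit polarization `((ker dμ_p ⊗ ℂ) ∩ P_0) ⊕ I_ℂ`. -/
def limitPol (Δ : DelzantPolytope n) (B : Matrix.SpecialLinearGroup (Fin n) ℤ) (p : ℕ)
    (g : (Fin n → ℝ) → ℝ) : Δ.Distribution := fun v q =>
  (kerMu B p v q ⊓ Δ.kahlerPol g v q) ⊔ orbitTangent B p v q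

variable {g h : (Fin n → ℝ) → ℝ}

theorem IsAdmissible.disjoint (H : Δ.IsAdmissible g h)
    (B : Matrix.SpecialLinearGroup (Fin n) ℤ) (p : ℕ) (v : Δ.Vertex) {q : RSpace n}
    (hq : q ∈ v.domain) :
    Disjoint (kerMu B p v q ⊓ Δ.kahlerPol g v q) (orbitTangent B p v q) := by
  rw [v.kerMu_eq, v.orbitTangent_eq, H.kahlerPol_eq v hq]
  exact disjoint_modelPol_rot _ _ _

/-- The potential `g + s H` replaces `K` by `K + s ᵗC C`, so that the limit is that of the linear model. -/
theorem IsAdmissible.grTendsto (H : Δ.IsAdmissible g h)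
    (B : Matrix.SpecialLinearGroup (Fin n) ℤ) (p : ℕ) (v : Δ.Vertex) {q : RSpace n}
    (hq : q ∈ v.domain) :
    GrTendsto (fun s => Δ.kahlerPol (ToricPol.potAt B p g s) v q) (Δ.limitPol B p g v q) := by
  rw [limitPol, v.kerMu_eq, v.orbitTangent_eq, H.kahlerPol_eq v hq]
  refine (grTendsto_modelPol _ _ _).congr' ?_
  filter_upwards [Filter.eventually_ge_atTop 0] with s hs
  rw [(H.potAt B p hs).kahlerPol_eq v hq, v.curv_potAt B p H.smooth s hq]

theorem IsAdmissible.eventually_isLagrangian (H : Δ.IsAdmissible g h)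
    (B : Matrix.SpecialLinearGroup (Fin n) ℤ) (p : ℕ) (v : Δ.Vertex) {q : RSpace n}
    (hq : q ∈ v.domain) :
    ∀ᶠ s in Filter.atTop, IsLagrangian (Δ.kahlerPol (ToricPol.potAt B p g s) v q) := by
  filter_upwards [Filter.eventually_ge_atTop 0] with s hs
  exact (H.potAt B p hs).isLagrangian v hq

/-- The limit polarization is independent of the chart, since limits in the Grassmannian are
unique. -/
theorem IsAdmissible.isGlobal_limitPol (H : Δ.IsAdmissible g h)
    (B : Matrix.SpecialLinearGroup (Fin n) ℤ) (p : ℕ) : (Δ.limitPol B p g).IsGlobal := by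
  intro v v' W τ hW hτ hpar q hq
  obtain ⟨hqd, hqd', -⟩ := hpar q hq
  refine (H.grTendsto B p v' hqd').unique ?_ (H.eventually_isLagrangian B p v' hqd')
  refine ((H.grTendsto B p v hqd).map (pushC_transition_injective hW hτ hpar hq)).congr' ?_
  filter_upwards [Filter.eventually_ge_atTop 0] with s hs
  exact ((H.potAt B p hs).isGlobal v v' W τ hW hτ hpar q hq).symm

theorem IsAdmissible.grTendsto_toricT10 (H : Δ.IsAdmissible g h)
    (B : Matrix.SpecialLinearGroup (Fin n) ℤ) (p : ℕ) {y : RSpace n} (hy : y ∈ Δ.actionAngle) :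
    GrTendsto (fun s => toricT10 (ToricPol.potAt B p g s) y) (spanHam B p (ztbar B g) y) :=
  ToricPol.grTendsto_toricT10 B p (H.contDiffAt hy) fun _ hs => (H.potAt B p hs).posDef y.1 hy

/-- On the open orbit, the limit in a chart and the limit in action-angle coordinates agree, since
limits in the Grassmannian are unique. -/
theorem IsAdmissible.limitPol_ofActionAngle (H : Δ.IsAdmissible g h)
    (B : Matrix.SpecialLinearGroup (Fin n) ℤ) (p : ℕ) (v : Δ.Vertex) {y : RSpace n}
    (hy : y ∈ Δ.actionAngle) : Δ.limitPol B p g v (v.ofActionAngle y)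
      = (spanHam B p (ztbar B g) y).map (pushC v.ofActionAngle y) := by
  have hq := v.ofActionAngle_mem hy
  have hinj : Function.Injective (pushC v.ofActionAngle y) := by
    rw [v.pushC_ofActionAngle hy]
    exact v.frameMap_injective hq
  refine (H.grTendsto B p v hq.1).unique ?_ (H.eventually_isLagrangian B p v hq.1)
  refine ((H.grTendsto_toricT10 B p hy).map hinj).congr' ?_
  filter_upwards [Filter.eventually_ge_atTop 0] with s hs
  rw [(H.potAt B p hs).map_toricT10 v hy, (H.potAt B p hs).kahlerPol_eq v hq.1]

theorem IsAdmissible.limitPol_eq_map (H : Δ.IsAdmissible g h)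
    (B : Matrix.SpecialLinearGroup (Fin n) ℤ) (p : ℕ) (v : Δ.Vertex) {q : RSpace n}
    (hq : q ∈ v.chartInterior) : ∃ y ∈ Δ.actionAngle, y.1 = v.moment q ∧
      Δ.limitPol B p g v q = (spanHam B p (ztbar B g) y).map (v.frameMap q) := by
  obtain ⟨y, hy, rfl⟩ := v.exists_actionAngle hq
  refine ⟨y, hy, (v.moment_ofActionAngle hy).symm, ?_⟩
  rw [H.limitPol_ofActionAngle B p v hy, v.pushC_ofActionAngle hy]

/-- The equations of the limit polarization on the open orbit. -/
theorem IsAdmissible.mem_limitPol (H : Δ.IsAdmissible g h)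
    (B : Matrix.SpecialLinearGroup (Fin n) ℤ) (p : ℕ) (v : Δ.Vertex) {q : RSpace n}
    (hq : q ∈ v.chartInterior) (w : CSpace n) :
    v.frameMap q w ∈ Δ.limitPol B p g v q ↔ ∀ j : Fin n, if j.val < p then rowC B j ⬝ᵥ w.1 = 0
      else colC B j ⬝ᵥ (cMat (hessian g (v.moment q)) *ᵥ w.1)
        - Complex.I * (colC B j ⬝ᵥ w.2) = 0 := by
  obtain ⟨y, hy, hy1, hD⟩ := H.limitPol_eq_map B p v hq
  rw [hD, ← hy1, ← mem_spanHam_ztbar B p (H.contDiffAt hy)]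
  constructor
  · rintro ⟨w', hw', h⟩
    rwa [← v.frameMap_injective hq h]
  · intro h
    exact ⟨w, h, rfl⟩

theorem IsAdmissible.finrank_limitPol_inf_conj (H : Δ.IsAdmissible g h)
    (B : Matrix.SpecialLinearGroup (Fin n) ℤ) {p : ℕ} (hpn : p ≤ n) (v : Δ.Vertex)
    {q : RSpace n} (hq : q ∈ v.chartInterior) :
    Module.finrank ℂ ↥(Δ.limitPol B p g v q ⊓ conjSub (Δ.limitPol B p g v q)) = p := by
  obtain ⟨y, hy, -, hD⟩ := H.limitPol_eq_map B p v hq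
  have hinj := v.frameMap_injective hq
  have hconj : ∀ L : Submodule ℂ (CSpace n),
      conjSub (L.map (v.frameMap q)) = (conjSub L).map (v.frameMap q) := by
    intro L
    ext u
    obtain ⟨w, rfl⟩ := v.frameMap_surjective hq u
    rw [mem_conjSub, v.conjVec_frameMap, Submodule.mem_map, Submodule.mem_map]
    constructor
    · rintro ⟨w', hw', h⟩
      exact ⟨w, mem_conjSub.mpr (hinj h ▸ hw'), rfl⟩
    · rintro ⟨w', hw', h⟩
      exact ⟨conjVec w, mem_conjSub.mp (hinj h ▸ hw'), rfl⟩
  rw [hD, hconj, ← Submodule.map_inf _ hinj,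
    ← (Submodule.equivMapOfInjective _ hinj _).finrank_eq,
    finrank_spanHam_inf_conj B hpn (H.contDiffAt hy) (H.posDef y.1 hy)]

theorem Vertex.contDiffOn_frameMap (v : Δ.Vertex) {w : RSpace n → CSpace n}
    (hw1 : ∀ k, ContDiffOn ℝ ∞ (fun q => (w q).1 k) v.chartInterior)
    (hw2 : ∀ k, ContDiffOn ℝ ∞ (fun q => (w q).2 k) v.chartInterior) :
    ContDiffOn ℝ ∞ (fun q => v.frameMap q (w q)) v.chartInterior := by
  have hm : ∀ (A : Matrix (Fin n) (Fin n) ℂ) {z : RSpace n → Fin n → ℂ},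
      (∀ k, ContDiffOn ℝ ∞ (fun q => z q k) v.chartInterior) → ∀ k,
      ContDiffOn ℝ ∞ (fun q => (A *ᵥ z q) k) v.chartInterior := by
    intro A z hz k
    simp only [Matrix.mulVec, dotProduct]
    exact ContDiffOn.sum fun j _ => contDiffOn_const.mul (hz j)
  have h1 : ∀ k, ContDiffOn ℝ ∞ (fun q => (cMat v.mat *ᵥ (w q).1) k) v.chartInterior :=
    hm _ hw1
  have h2 : ∀ k, ContDiffOn ℝ ∞ (fun q => (cMat v.mat⁻¹ᵀ *ᵥ (w q).2) k) v.chartInterior :=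
    hm _ hw2
  have hinv : ∀ k, ContDiffOn ℝ ∞ (fun q : RSpace n => (((q.1 k ^ 2 + q.2 k ^ 2)⁻¹ : ℝ) : ℂ))
      v.chartInterior := fun k =>
    Complex.ofRealCLM.contDiff.comp_contDiffOn
      (ContDiffOn.inv (by fun_prop) fun q hq => hq.2 k)
  have ha := fun k => (contDiff_ofReal_fst (n := n) k).contDiffOn (s := v.chartInterior)
  have hb := fun k => (contDiff_ofReal_snd (n := n) k).contDiffOn (s := v.chartInterior)
  refine ContDiffOn.prodMk (contDiffOn_pi.mpr fun k => ?_) (contDiffOn_pi.mpr fun k => ?_)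
  · exact (((ha k).mul (hinv k)).mul (h1 k)).sub ((hb k).mul (h2 k))
  · exact (((hb k).mul (hinv k)).mul (h1 k)).add ((ha k).mul (h2 k))

theorem IsAdmissible.smoothOn_limitPol (H : Δ.IsAdmissible g h)
    (B : Matrix.SpecialLinearGroup (Fin n) ℤ) (p : ℕ) (v : Δ.Vertex) :
    SmoothOn (Δ.limitPol B p g v) v.chartInterior := by
  intro q hq
  refine ⟨v.chartInterior, v.isOpen_chartInterior, hq,
    fun j q => v.frameMap q (limitFrame B p g (v.moment q) j), fun j => ?_, ?_⟩
  · by_cases hj : j.val < p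
    · simp only [limitFrame, hj, if_true]
      exact v.contDiffOn_frameMap (fun k => contDiffOn_const) fun k => contDiffOn_const
    · simp only [limitFrame, hj, if_false]
      refine v.contDiffOn_frameMap (fun k => contDiffOn_const) fun k => ?_
      have hg : ContDiffOn ℝ ∞ g Δ.inside := fun x hx => (H.contDiffAt hx).contDiffWithinAt
      have hG : ∀ i, ContDiffOn ℝ ∞ (fun q => cMat (hessian g (v.moment q)) k i)
          v.chartInterior := fun i =>
        Complex.ofRealCLM.contDiff.comp_contDiffOn
          ((contDiffOn_hessian Δ.isOpen_inside hg k i).comp v.contDiff_moment.contDiffOn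
            fun _ hq => v.moment_mem_inside hq)
      have : ContDiffOn ℝ ∞ (fun q => (cMat (hessian g (v.moment q)) *ᵥ colC B j) k)
          v.chartInterior := by
        simp only [Matrix.mulVec, dotProduct]
        exact ContDiffOn.sum fun i _ => (hG i).mul contDiffOn_const
      exact this.neg
  · rintro q' ⟨hq', -⟩
    obtain ⟨y, hy, hy1, hD⟩ := H.limitPol_eq_map B p v hq'
    refine ⟨(linearIndependent_limitFrame B p g _).map' _
      (LinearMap.ker_eq_bot.mpr (v.frameMap_injective hq')), ?_⟩
    rw [hD, ← span_limitFrame B p (H.contDiffAt hy), Submodule.map_span, ← Set.range_comp, hy1]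
    rfl

theorem Vertex.antiHol_ne_zero (v : Δ.Vertex) (h : (Fin n → ℝ) → ℝ) (j : Fin n) {q : RSpace n}
    (hq : q ∈ v.chartInterior) : v.antiHol h j q ≠ 0 :=
  mul_ne_zero (zbar_ne_zero (hq.2 j)) (Complex.exp_ne_zero _)

/-- The logarithmic differentials of the antiholomorphic coordinates of the chart are combinations
of the `dz̃bar_k`. -/
theorem Vertex.sum_dC_antiHol (v : Δ.Vertex) (B : Matrix.SpecialLinearGroup (Fin n) ℤ)
    (hh : ContDiff ℝ ∞ h) (hg : ∀ x ∈ Δ.inside, g x = Δ.guillemin x + h x) {q : RSpace n}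
    (hq : q ∈ v.chartInterior) (w : CSpace n) (k : Fin n) :
    ∑ j, (cMat v.mat *ᵥ colC B k) j * ((v.antiHol h j q)⁻¹ * dC (v.antiHol h j) q (v.frameMap q w))
      = colC B k ⬝ᵥ (cMat (hessian g (v.moment q)) *ᵥ w.1) - Complex.I * (colC B k ⬝ᵥ w.2) := by
  set z := cMat (hessian g (v.moment q)) *ᵥ w.1 - Complex.I • w.2 with hz
  have h1 : ∀ j, (v.antiHol h j q)⁻¹ * dC (v.antiHol h j) q (v.frameMap q w)
      = (cMat v.mat⁻¹ᵀ *ᵥ z) j := by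
    intro j
    rw [v.dC_antiHol hh j hq.1, v.modelForm_frameMap hh hg hq, antiHol, ← hz]
    have := zbar_ne_zero (hq.2 j)
    have := Complex.exp_ne_zero (v.regGrad h j (v.moment q) : ℂ)
    field_simp
  simp only [h1]
  change (cMat v.mat *ᵥ colC B k) ⬝ᵥ (cMat v.mat⁻¹ᵀ *ᵥ z) = _
  rw [Matrix.dotProduct_mulVec, cMat_transpose, Matrix.vecMul_transpose, Matrix.mulVec_mulVec,
    ← cMat_mul, v.inv_mul_mat, cMat_one, Matrix.one_mulVec, hz, dotProduct_sub, dotProduct_smul,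
    smul_eq_mul]

/-- Near a point `q₀` of the open orbit, the limit polarization is the common kernel of the
differentials of `x̃_1, …, x̃_p` and of local branches of `z̃bar_{p+1}, …, z̃bar_n`. -/
theorem IsAdmissible.involutiveOn_limitPol (H : Δ.IsAdmissible g h)
    (B : Matrix.SpecialLinearGroup (Fin n) ℤ) (p : ℕ) (v : Δ.Vertex) :
    InvolutiveOn (Δ.limitPol B p g v) v.chartInterior := by
  refine involutiveOn_of_functions fun q₀ hq₀ => ?_
  let r : Fin n → RSpace n → ℂ := fun j q => (v.antiHol h j q₀)⁻¹ * v.antiHol h j q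
  let f : Fin n → RSpace n → ℂ := fun k q => if k.val < p then muChart B v k q
    else ∑ j, (cMat v.mat *ᵥ colC B k) j * Complex.log (r j q)
  have hr : ∀ j, ∀ q ∈ v.chartInterior, ContDiffAt ℝ ∞ (r j) q := fun j q hq =>
    contDiffAt_const.mul (v.contDiffAt_antiHol H.smooth j hq.1)
  have hslit₀ : ∀ j, r j q₀ ∈ Complex.slitPlane := by
    intro j
    change (v.antiHol h j q₀)⁻¹ * v.antiHol h j q₀ ∈ _
    rw [inv_mul_cancel₀ (v.antiHol_ne_zero h j hq₀)]
    exact Complex.one_mem_slitPlane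
  have hlog : ∀ j, ∀ q ∈ v.chartInterior, r j q ∈ Complex.slitPlane →
      ContDiffAt ℝ ∞ (fun q => Complex.log (r j q)) q := fun j q hq hs =>
    ((Complex.contDiffAt_log hs).restrict_scalars ℝ).comp q (hr j q hq)
  -- the differentials of the functions `f k` are the forms that cut out the limit polarization
  have hdf : ∀ q ∈ v.chartInterior, (∀ j, r j q ∈ Complex.slitPlane) → ∀ w k,
      dC (f k) q (v.frameMap q w) = if k.val < p then rowC B k ⬝ᵥ w.1 else
        colC B k ⬝ᵥ (cMat (hessian g (v.moment q)) *ᵥ w.1) - Complex.I * (colC B k ⬝ᵥ w.2) := by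
    intro q hq hs w k
    by_cases hk : k.val < p
    · have hf : f k = muChart B v k := by
        ext q
        simp [f, hk]
      rw [hf, if_pos hk, v.dC_muChart, v.dXi_frameMap hq, Matrix.mulVec_mulVec, ← cMat_mul,
        v.inv_mul_mat, cMat_one, Matrix.one_mulVec]
    · have hf : f k = fun q => ∑ j, (cMat v.mat *ᵥ colC B k) j * Complex.log (r j q) := by
        ext q
        simp [f, hk]
      have hd : ∀ j, DifferentiableAt ℝ (fun q => Complex.log (r j q)) q := fun j =>
        (hlog j q hq (hs j)).differentiableAt (by simp)
      rw [hf, if_neg hk, dC_sum (fun j _ => (hd j).const_mul _),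
        ← v.sum_dC_antiHol B H.smooth H.eq hq]
      refine Finset.sum_congr rfl fun j _ => ?_
      have ha : DifferentiableAt ℝ (v.antiHol h j) q :=
        (v.contDiffAt_antiHol H.smooth j hq.1).differentiableAt (by simp)
      rw [dC_const_mul (hd j), dC_clog ((hr j q hq).differentiableAt (by simp)) (hs j)]
      have h1 : dC (r j) q (v.frameMap q w)
          = (v.antiHol h j q₀)⁻¹ * dC (v.antiHol h j) q (v.frameMap q w) := dC_const_mul ha _ _
      have h2 := v.antiHol_ne_zero h j hq₀
      have h3 := v.antiHol_ne_zero h j hq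
      rw [h1]
      simp only [r]
      field_simp
  refine ⟨f, fun k => ?_, ?_, fun u hu => ?_⟩
  · by_cases hk : k.val < p
    · simp only [f, hk, if_true]
      exact Complex.ofRealCLM.contDiff.contDiffAt.comp q₀
        (((contDiff_xt B k).comp v.contDiff_moment).contDiffAt)
    · simp only [f, hk, if_false]
      exact ContDiffAt.sum fun j _ => contDiffAt_const.mul (hlog j q₀ hq₀ (hslit₀ j))
  · have hev : ∀ᶠ q in 𝓝 q₀, ∀ j, r j q ∈ Complex.slitPlane :=
      Filter.eventually_all.mpr fun j => (hr j q₀ hq₀).continuousAt.eventually_mem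
        (Complex.isOpen_slitPlane.mem_nhds (hslit₀ j))
    filter_upwards [hev] with q hs hq u hu k
    obtain ⟨w, rfl⟩ := v.frameMap_surjective hq u
    have h1 := (H.mem_limitPol B p v hq w).mp hu k
    rw [hdf q hq hs]
    split_ifs at h1 ⊢ <;> exact h1
  · obtain ⟨w, rfl⟩ := v.frameMap_surjective hq₀ u
    refine (H.mem_limitPol B p v hq₀ w).mpr fun k => ?_
    have h1 := hu k
    rw [hdf q₀ hq₀ hslit₀] at h1
    split_ifs at h1 ⊢ <;> exact h1

theorem IsAdmissible.isSingularMixed_limitPol (H : Δ.IsAdmissible g h)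
    (B : Matrix.SpecialLinearGroup (Fin n) ℤ) {p : ℕ} (hp : 0 < p) (hpn : p < n) :
    (Δ.limitPol B p g).IsSingularMixed Δ.openOrbit p := by
  refine ⟨H.isGlobal_limitPol B p, Δ.isOpen_openOrbit, Δ.dense_openOrbit, hp, hpn, fun v => ?_⟩
  rw [v.preimage_openOrbit]
  exact ⟨fun q hq => (H.grTendsto B p v hq).isLagrangian (H.eventually_isLagrangian B p v hq),
    H.smoothOn_limitPol B p v, H.involutiveOn_limitPol B p v,
    fun q hq => H.finrank_limitPol_inf_conj B hpn.le v hq⟩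

end DelzantPolytope

end ToricPol

end

open ToricPol

theorem theorem3p1 {n : ℕ} (Δ : DelzantPolytope n)
    (g : (Fin n → ℝ) → ℝ) (hg : Δ.IsSymplecticPotential g)
    (p : ℕ) (hp : 0 < p) (hpn : p < n) (B : Matrix.SpecialLinearGroup (Fin n) ℤ) :
    -- `P_s` is a Kähler polarization of `M`, obtained by the flow of `X_H` in imaginary time `i s`
    (∀ s : ℝ, 0 ≤ s →
      (Δ.kahlerPol (potAt B p g s)).IsKahler ∧
      ∀ y ∈ Δ.actionAngle,
        (∀ j, HasSum
          (fun k : ℕ => (Complex.I * s) ^ k / (k.factorial : ℂ) * ((lieH B p)^[k] (zt B g j)) y)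
          (zt B (potAt B p g s) j y)) ∧
        toricT10 (potAt B p g s) y =
          Submodule.span ℂ (Set.range fun j => hamVec (ztbar B (potAt B p g s) j) y)) ∧
    -- the limit exists at every point of `M` and is a singular mixed polarization
    ∃ Pinf : Δ.Distribution,
      (∀ v : Δ.Vertex, ∀ q ∈ v.domain,
        GrTendsto (fun s => Δ.kahlerPol (potAt B p g s) v q) (Pinf v q)) ∧
      Pinf.IsSingularMixed Δ.openOrbit p ∧
      (∀ v : Δ.Vertex, ∀ q ∈ v.domain,
        Pinf v q = (kerMu B p v q ⊓ Δ.kahlerPol g v q) ⊔ orbitTangent B p v q ∧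
        Disjoint (kerMu B p v q ⊓ Δ.kahlerPol g v q) (orbitTangent B p v q)) ∧
      -- description on the open orbit, for `P_s = T^{1,0}` and for the conjugates `T^{0,1}`
      (∀ y ∈ Δ.actionAngle,
        GrTendsto (fun s => toricT10 (potAt B p g s) y) (spanHam B p (ztbar B g) y) ∧
        spanHam B p (ztbar B g) y = spanHol B p g y ∧
        GrTendsto (fun s => conjSub (toricT10 (potAt B p g s) y)) (spanHam B p (zt B g) y) ∧
        spanHam B p (zt B g) y = conjSub (spanHol B p g y)) ∧
      (∀ v : Δ.Vertex, ∀ y ∈ Δ.actionAngle,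
        Pinf v (v.ofActionAngle y) =
          (spanHam B p (ztbar B g) y).map (pushC v.ofActionAngle y)) := by
  obtain ⟨h, H⟩ := DelzantPolytope.isAdmissible_of_isSymplecticPotential hg
  have hsm : ∀ y ∈ Δ.actionAngle, ContDiffAt ℝ ∞ g y.1 := fun y hy => H.contDiffAt hy
  refine ⟨fun s hs => ⟨(H.potAt B p hs).isKahler, fun y hy =>
    ⟨fun j => hasSum_lieH B p Δ.isOpen_actionAngle hsm s hy j,
      toricT10_eq_span B ((H.potAt B p hs).contDiffAt hy) ((H.potAt B p hs).posDef y.1 hy)⟩⟩,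
    Δ.limitPol B p g, fun v q hq => H.grTendsto B p v hq, H.isSingularMixed_limitPol B hp hpn,
    fun v q hq => ⟨rfl, H.disjoint B p v hq⟩, fun y hy => ?_,
    fun v y hy => H.limitPol_ofActionAngle B p v hy⟩
  have hlim := H.grTendsto_toricT10 B p hy
  have hhol := spanHam_eq_spanHol B p (hsm y hy) (H.posDef y.1 hy)
  have hconj := spanHam_zt B p (hsm y hy)
  exact ⟨hlim, hhol, hconj ▸ hlim.conj, hhol ▸ hconj⟩
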